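/- Let $n\ge 3$, let $V$ be a finite nonempty set of values, and let $\mathcal M$ be an asynchronous system of $n$ deterministic sequential processes $p_1,\dots,p_n$ (arbitrary state machines, each started on an input from $V$) and one $n$-consensus object $O$. The processes exchange no messages, each invokes $O$ at most once, and no process ever halts of its own accord. A process that executes $\mathtt{invoke}(O,v)$ with $v\in V$ waits until $O$ answers; $O$ gives the same answer to every process, and the answer is a value with which $O$ had been invoked before its first answer. The events of $\mathcal M$ are the steps of the processes, the answers of $O$, and crashes of up to $n-1$ processes. A configuration of $\mathcal M$ consists of the states of the processes, each with a count of its events so far, and the state of $O$; we consider the configurations that occur in legal executions. Then there is a three-dimensional tile assembly system $\mathcal T$ (finitely many types of unit cubes of fixed orientation, with glues of strength $0$, $1$ or $2$ on their six faces, growing at temperature $2$ from a finite stable seed assembly) that simulates a solution of the Consensus Subroutine Problem for $\mathcal M$. That is, there are a finite set $R$ of lattice sites (the consensus object), pairwise disjoint sets $\pi_1,\dots,\pi_n$ of sites outside $R$, and a map $h$ from configurations of $\mathcal M$ to tile configurations of $\mathcal T$, with the following properties. Here $\alpha\to\beta$ means that some assembly sequence leads from $\alpha$ to $\beta$. A *tile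 blockage* is a cube that is bound at a site where some cube could be added stably, that does not fit there, and to which nothing binds; blockages may occur at any such site outside $R$. An assembly sequence is *fair* if every site where a cube can be added is eventually occupied. (A) Modularity. No cube is ever placed outside $R\cup\pi_1\cup\dots\cup\pi_n$, and for configurations $C,C'$ and each $i$, $h(C)$ and $h(C')$ agree on $\pi_i$ if and only if $p_i$ is in the same state in $C$ and $C'$. (B) Simulation. 1. $h$ is 1-1, and every $h(C)$ is stable. The seed can grow without error into $h(C)$ for every initial configuration $C$, and every fair error-free assembly sequence from the seed passes through such an $h(C)$. 2. If an event leads from $C$ to $C'$, then $h(C)\to h(C')$, without errors if the event is not a crash. 3. If no legal execution segment leads from $C$ to $C'$, then $h(C)\not\to h(C')$, even with blockages allowed. 4. If, once in $C$, $\mathcal M$ must eventually achieve a configuration in a set $\mathcal C$ unless a process crashes, then every fair assembly sequence from $h(C)$ without further blockage passes through $h(C')$ for some $C'\in\mathcal C$. 5. If $p_i$ crashes in an event from $C$ to $C'$, then $h(C')$ contains exactly one more blockage than $h(C)$, and it lies in $\pi_i$. 6. If all processes have stopped in $C$, then $h(C)$ is terminal. In 1 and 4, "passes through $h(C')$" is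 meant up to the order of attachments: some error-free assembly sequence leads from the start through $h(C')$ to a stage of the given sequence. (C) Consensus Subroutine Problem. Say that an assembly shows $p_i$ in state $q$ if it contains the part of $h(C)$ in $\pi_i$ for some $C$ in which $p_i$ has state $q$. For assembly sequences from the seed with arbitrary blockages outside $R$: all decision values (answers of $O$) shown in one assembly are equal (agreement); each of them is shown, in the same assembly, to have been proposed by some process (validity); in every fair sequence in which no blockage ever occurs in $\pi_i$, if $p_i$ is shown to have invoked $O$ then it is eventually shown to have decided (termination), and $p_i$ is shown after arbitrarily many of its events, whatever calls of $O$ are made and whatever happens in the other $\pi_j$ (no process becomes more likely to fail by calling the subroutine). -/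

import Mathlib

universe u

namespace TileConsensus

/-! ## Distributed systems with one consensus object -/

/-- What a process does next, as dictated by its internal state: an internal computation step, a call
`invoke(O, v)` of the consensus object (the process then waits for `return(O, w)` and resumes in
the state `resume w`), or nothing any more. -/
inductive Action (S : Type u) (V : Type) : Type u
  | compute (s : S) : Action S V
  | invoke (v : V) (resume : V → S) : Action S V
  | halt : Action S V

/-- A sequential deterministic process: an arbitrary state machine, started on an input from `V`. -/
structure Proc (V : Type) : Type (u + 1) where
  State : Type u
  init : V → State
  act : State → Action State V

/-- A process is either running, or waiting for the answer to a call of the consensus object. -/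
inductive Control (S : Type u) (V : Type) : Type u
  | running (s : S) : Control S V
  | waiting (resume : V → S) : Control S V

/-- The state of a process inside a configuration. The local clock counts the events of the process
so far, so that a machine that returns to an earlier internal state is not identified with its
earlier self (attached tiles are never removed). -/
structure LocalState (S : Type u) (V : Type) : Type u where
  input : V
  clock : ℕ
  control : Control S V
  calls : ℕ
  proposal : Option V
  decision : Option V
  crashed : Bool

/-- The state of the consensus object: the values with which it has been invoked so far, and,
as soon as it has answered once, the invocation (caller and value) that it has decided for. -/
structure ObjectState (n : ℕ) (V : Type) : Type where
  request : Fin n → Option V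
  chosen : Option (Fin n × V)

/-- A system of `n` processes sharing one `n`-process consensus object, without messages. -/
abbrev System (n : ℕ) (V : Type) : Type (u + 1) := Fin n → Proc.{u} V

/-- Events: a computation step of a process (an invocation included), the transmission of the
decision value from the consensus object to a process, the crash of a process. -/
inductive Event (n : ℕ) : Type
  | step (i : Fin n) : Event n
  | respond (i : Fin n) : Event n
  | crash (i : Fin n) : Event n

/-- The process that an event concerns. -/
def Event.process {n : ℕ} : Event n → Fin n
  | .step i => i
  | .respond i => i
  | .crash i => i

/-- Whether an event is a crash. -/
def Event.IsCrash {n : ℕ} : Event n → Prop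
  | .crash _ => True
  | _ => False

namespace System

variable {n : ℕ} {V : Type} (M : System.{u} n V)

/-- Configurations `⟨q₁, …, qₙ, o⟩`. -/
structure Config : Type u where
  proc : (i : Fin n) → LocalState (M i).State V
  obj : ObjectState n V

variable {M} in
/-- Replace the state of process `i`. -/
def Config.setProc (C : M.Config) (i : Fin n) (q : LocalState (M i).State V) : M.Config :=
  { C with proc := Function.update C.proc i q }

/-- The initial configuration with the inputs `x`. -/
def initial (x : Fin n → V) : M.Config where
  proc i :=
    { input := x i, clock := 0, control := .running ((M i).init (x i)), calls := 0,
      proposal := none, decision := none, crashed := false }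
  obj := { request := fun _ => none, chosen := none }

/-- The events and their effects. An undecided consensus object may decide for any value with which
it has been invoked so far; afterwards it gives the same answer to everybody. At most `n - 1`
processes crash. -/
inductive Step : M.Config → Event n → M.Config → Prop
  | compute (C : M.Config) (i : Fin n) (s s' : (M i).State)
      (hlive : (C.proc i).crashed = false) (hs : (C.proc i).control = .running s)
      (hact : (M i).act s = .compute s') :
      Step C (.step i) (C.setProc i
        { C.proc i with clock := (C.proc i).clock + 1, control := .running s' })
  | invoke (C : M.Config) (i : Fin n) (s : (M i).State) (v : V) (resume : V → (M i).State)
      (hlive : (C.proc i).crashed = false) (hs : (C.proc i).control = .running s)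
      (hact : (M i).act s = .invoke v resume) :
      Step C (.step i)
        { proc := Function.update C.proc i
            { C.proc i with
              clock := (C.proc i).clock + 1, control := .waiting resume,
              calls := (C.proc i).calls + 1, proposal := some v }
          obj := { C.obj with request := Function.update C.obj.request i (some v) } }
  | respond (C : M.Config) (i j : Fin n) (w : V) (resume : V → (M i).State)
      (hlive : (C.proc i).crashed = false) (hs : (C.proc i).control = .waiting resume)
      (hw : C.obj.chosen = some (j, w) ∨ (C.obj.chosen = none ∧ C.obj.request j = some w)) :
      Step C (.respond i)
        { proc := Function.update C.proc i
            { C.proc i with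
              clock := (C.proc i).clock + 1, control := .running (resume w), decision := some w }
          obj := { C.obj with chosen := some (j, w) } }
  | crash (C : M.Config) (i : Fin n) (hlive : (C.proc i).crashed = false)
      (hcount : (Finset.univ.filter fun j => (C.proc j).crashed = true).card + 1 < n) :
      Step C (.crash i) (C.setProc i { C.proc i with crashed := true })

/-- There is a legal execution segment from `C` to `C'`. -/
def Leads (C C' : M.Config) : Prop :=
  Relation.ReflTransGen (fun D D' => ∃ e, M.Step D e D') C C'

/-- The configurations that occur in legal executions. -/
def Reachable (C : M.Config) : Prop := ∃ x : Fin n → V, M.Leads (M.initial x) C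

/-- Every process invokes the consensus object at most once. -/
def InvokesAtMostOnce : Prop := ∀ C, M.Reachable C → ∀ i, (C.proc i).calls ≤ 1

/-- No process ever halts of its own accord. -/
def RunsForever : Prop :=
  ∀ C, M.Reachable C → ∀ i s, (C.proc i).control = .running s → (M i).act s ≠ .halt

variable {M} in
/-- Process `i` has stopped, by a crash or by halting. -/
def Config.Stopped (C : M.Config) (i : Fin n) : Prop :=
  (C.proc i).crashed = true ∨ ∃ s, (C.proc i).control = .running s ∧ (M i).act s = .halt

/-- A crash-free execution from `C` (idling is allowed) in which every process that has not stopped,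
and whose next event is a step of its own or an answer of the consensus object, gets to it after
finitely many events. -/
structure IsFairRun (C : M.Config) (c : ℕ → M.Config) (e : ℕ → Option (Event n)) : Prop where
  start : c 0 = C
  idle : ∀ k, e k = none → c (k + 1) = c k
  step : ∀ k φ, e k = some φ → ¬ φ.IsCrash ∧ M.Step (c k) φ (c (k + 1))
  fair : ∀ k i, ¬ (c k).Stopped i → ∃ k' ≥ k, ∃ φ, e k' = some φ ∧ φ.process = i

/-- Once in `C`, the system must eventually achieve a configuration in `𝒞` unless a process
crashes. -/
def MustAchieve (C : M.Config) (𝒞 : Set M.Config) : Prop :=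
  ∀ c e, M.IsFairRun C c e → ∃ k, c k ∈ 𝒞

end System

/-! ## Three-dimensional tile assembly -/

/-- Positions in the cubic lattice. -/
abbrev Site : Type := ℤ × ℤ × ℤ

/-- The six faces of a cube. -/
inductive Face : Type
  | east | west | north | south | up | down
  deriving DecidableEq

instance : Fintype Face :=
  ⟨{.east, .west, .north, .south, .up, .down}, fun f => by cases f <;> decide⟩

/-- The opposite face. -/
def Face.opposite : Face → Face
  | .east => .west
  | .west => .east
  | .north => .south
  | .south => .north
  | .up => .down
  | .down => .up

/-- The site that abuts the site `p` at the face `f`. -/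
def Face.next : Face → Site → Site
  | .east, (x, y, z) => (x + 1, y, z)
  | .west, (x, y, z) => (x - 1, y, z)
  | .north, (x, y, z) => (x, y + 1, z)
  | .south, (x, y, z) => (x, y - 1, z)
  | .up, (x, y, z) => (x, y, z + 1)
  | .down, (x, y, z) => (x, y, z - 1)

/-- A cube that has been placed: its type, and whether it was bound in error. -/
structure Cube (T : Type) : Type where
  tile : T
  faulty : Bool

/-- Finitely many cube types, each with a glue name and a glue strength (0, 1 or 2) on every face,
and the symmetric relation saying which glue names can bind. -/
structure TileSet where
  Tile : Type
  finite_tile : Finite Tile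
  Glue : Type
  glue : Tile → Face → Glue × Fin 3
  binds : Glue → Glue → Prop
  binds_symm : ∀ g g', binds g g' → binds g' g

namespace TileSet

variable (T : TileSet)

/-- Tile configurations. Cubes have one orientation. -/
abbrev Assembly : Type := Site → Option (Cube T.Tile)

open Classical in
/-- The strength with which a cube of type `t` binds with its face `f` to an abutting cube of
type `t'`: glue names and strengths have to fit. -/
noncomputable def bond (t t' : T.Tile) (f : Face) : ℕ :=
  if T.binds (T.glue t f).1 (T.glue t' f.opposite).1 ∧
      (T.glue t f).2 = (T.glue t' f.opposite).2 then
    ((T.glue t f).2 : ℕ)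
  else 0

variable {T}

/-- The total strength with which a cube of type `t` would bind at `p`. Nothing binds to a cube that
was bound in error. -/
noncomputable def pull (α : T.Assembly) (p : Site) (t : T.Tile) : ℕ :=
  ∑ f : Face, match α (f.next p) with
    | some ⟨t', false⟩ => T.bond t t' f
    | _ => 0

/-- The strength of the bond across the face `f` of the cube at `p`. -/
noncomputable def link (α : T.Assembly) (p : Site) (f : Face) : ℕ :=
  match α p, α (f.next p) with
  | some ⟨t, false⟩, some ⟨t', false⟩ => T.bond t t' f
  | _, _ => 0

/-- There is a correctly bound cube at `p`. -/
def Sound (α : T.Assembly) (p : Site) : Prop := ∃ t, α p = some ⟨t, false⟩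

/-- There is a tile blockage (a cube bound in error) at `p`. -/
def Blocked (α : T.Assembly) (p : Site) : Prop := ∃ t, α p = some ⟨t, true⟩

/-- Stability: the binding strength across every cut of the correctly bound cubes is at least 2. -/
def Stable (α : T.Assembly) : Prop :=
  ∀ S : Set Site, (∃ p ∈ S, Sound α p) → (∃ p ∉ S, Sound α p) →
    ∃ F : Finset (Site × Face),
      (∀ e ∈ F, e.1 ∈ S ∧ e.2.next e.1 ∉ S) ∧ 2 ≤ ∑ e ∈ F, link α e.1 e.2

/-- Some cube can stably be added at `p`. -/
def Frontier (α : T.Assembly) (p : Site) : Prop := α p = none ∧ ∃ t, 2 ≤ pull α p t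

/-- No cube can stably be added. -/
def Terminal (α : T.Assembly) : Prop := ∀ p, ¬ Frontier α p

/-- Stable addition of one cube. -/
def Attach (α β : T.Assembly) : Prop :=
  ∃ p t, α p = none ∧ 2 ≤ pull α p t ∧ β = Function.update α p (some ⟨t, false⟩)

/-- A tile blockage outside the protected set `R`: at a site where some cube can be added, a cube
that does not fit there gets bound. -/
def Block (R : Set Site) (α β : T.Assembly) : Prop :=
  ∃ p t, p ∉ R ∧ Frontier α p ∧ pull α p t < 2 ∧ β = Function.update α p (some ⟨t, true⟩)

/-- One assembly step, error-free or a tile blockage outside `R`. -/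
def Move (R : Set Site) (α β : T.Assembly) : Prop := Attach α β ∨ Block R α β

/-- Some error-free assembly sequence leads from `α` to `β`. -/
def Grows (α β : T.Assembly) : Prop := Relation.ReflTransGen Attach α β

/-- Some assembly sequence, possibly with tile blockages outside `R`, leads from `α` to `β`. -/
def GrowsWithin (R : Set Site) (α β : T.Assembly) : Prop := Relation.ReflTransGen (Move R) α β

/-- An assembly sequence from `α` with steps from the relation `next` (idling is allowed) in which
every site where a cube can be added is eventually occupied. -/
structure IsFairSequence (next : T.Assembly → T.Assembly → Prop) (α : T.Assembly)
    (a : ℕ → T.Assembly) : Prop where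
  start : a 0 = α
  step : ∀ k, a (k + 1) = a k ∨ next (a k) (a (k + 1))
  fair : ∀ k p, Frontier (a k) p → ∃ k' ≥ k, a k' p ≠ none

end TileSet

/-- A three-dimensional tile assembly system: a tile set and a seed assembly (temperature 2). -/
structure CubeSystem extends TileSet where
  seed : toTileSet.Assembly
  seed_finite : {p | seed p ≠ none}.Finite
  seed_nonempty : ∃ p, seed p ≠ none
  seed_correct : ∀ p, ¬ TileSet.Blocked seed p
  seed_stable : TileSet.Stable seed

/-! ## Simulation -/

open TileSet

/-- The data of a simulation: the map `h` from configurations to tile configurations, the sites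
`part i` of the subassembly that simulates process `i`, and the sites `object` of the
consensus object (approach pad and decision point), where no blockages are permitted. -/
structure SimulationData {n : ℕ} {V : Type} (T : CubeSystem) (M : System.{u} n V) where
  h : M.Config → T.Assembly
  part : Fin n → Set Site
  object : Set Site

namespace SimulationData

variable {n : ℕ} {V : Type} {T : CubeSystem} {M : System.{u} n V} (S : SimulationData T M)

/-- The consensus object occupies finitely many sites, the processes are simulated by subassemblies
on disjoint sets of sites outside of it, nothing else is ever built, and the subassembly that
simulates a process represents exactly the state of that process. -/
structure IsModular : Prop where
  object_finite : S.object.Finite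
  part_object : ∀ i, Disjoint (S.part i) S.object
  part_part : ∀ i j, i ≠ j → Disjoint (S.part i) (S.part j)
  support : ∀ α, GrowsWithin S.object T.seed α →
    ∀ p, α p ≠ none → p ∈ S.object ∨ ∃ i, p ∈ S.part i
  state : ∀ C C', M.Reachable C → M.Reachable C' → ∀ i,
    (∀ p ∈ S.part i, S.h C p = S.h C' p) ↔ C.proc i = C'.proc i

/-- The tile assembly system simulates the distributed system. -/
structure Simulates : Prop where
  /-- The seed can, and must, grow into representations of initial configurations. -/
  initial : ∀ x, Grows T.seed (S.h (M.initial x))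
  initial_must : ∀ a, IsFairSequence Attach T.seed a →
    ∃ k x, Grows (S.h (M.initial x)) (a k)
  /-- The map is 1-1 into stable tile configurations. -/
  injective : Set.InjOn S.h {C | M.Reachable C}
  stable : ∀ C, M.Reachable C → Stable (S.h C)
  /-- Legal steps are simulated by legal assembly sequences, without errors if no process crashes. -/
  step : ∀ C e C', M.Reachable C → M.Step C e C' → GrowsWithin S.object (S.h C) (S.h C')
  step_correct : ∀ C e C', M.Reachable C → M.Step C e C' → ¬ e.IsCrash → Grows (S.h C) (S.h C')
  /-- What is impossible in the distributed system is impossible in the tile assembly system. -/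
  only : ∀ C C', M.Reachable C → M.Reachable C' → ¬ M.Leads C C' →
    ¬ GrowsWithin S.object (S.h C) (S.h C')
  /-- What must happen unless a process crashes must happen unless there is a tile blockage. Here `h C'`
  has been achieved by a stage of an assembly sequence if the sequence passes through `h C'` on the
  way from `h C` to this stage, up to the order of the attachments. -/
  must : ∀ C 𝒞, M.Reachable C → M.MustAchieve C 𝒞 →
    ∀ a, IsFairSequence Attach (S.h C) a →
      ∃ k, ∃ C' ∈ 𝒞, M.Reachable C' ∧ Grows (S.h C) (S.h C') ∧ Grows (S.h C') (a k)
  /-- The crash of a process adds one tile blockage, and does so in the subassembly of the process. -/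
  crash : ∀ C i C', M.Reachable C → M.Step C (.crash i) C' →
    ∃ p ∈ S.part i, ¬ Blocked (S.h C) p ∧
      {q | Blocked (S.h C') q} = insert p {q | Blocked (S.h C) q}
  /-- If all processes have stopped, then the assembly is terminal. -/
  halted : ∀ C, M.Reachable C → (∀ i, C.Stopped i) → Terminal (S.h C)

/-- The assembly `α` contains the subassembly that represents process `i` in state `q`. -/
def Shows (α : T.Assembly) (i : Fin n) (q : LocalState (M i).State V) : Prop :=
  ∃ C, M.Reachable C ∧ C.proc i = q ∧ ∀ p ∈ S.part i, S.h C p ≠ none → α p = S.h C p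

/-- The simulated calls of the consensus object solve wait-free consensus in every assembly sequence
from the seed, whatever blockages occur outside the consensus object, and a subassembly
is stopped by nothing but a blockage in that subassembly, whoever calls the consensus object. -/
structure SolvesConsensusSubroutine : Prop where
  agreement : ∀ α, GrowsWithin S.object T.seed α → ∀ i j q q' w w',
    S.Shows α i q → S.Shows α j q' → q.decision = some w → q'.decision = some w' → w = w'
  validity : ∀ α, GrowsWithin S.object T.seed α → ∀ i q w,
    S.Shows α i q → q.decision = some w → ∃ j q', S.Shows α j q' ∧ q'.proposal = some w
  termination : ∀ a, IsFairSequence (Move S.object) T.seed a →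
    ∀ i, (∀ k, ∀ p ∈ S.part i, ¬ Blocked (a k) p) →
      ∀ k q, S.Shows (a k) i q → q.proposal ≠ none →
        ∃ k' q', S.Shows (a k') i q' ∧ q'.decision ≠ none
  unobstructed : ∀ a, IsFairSequence (Move S.object) T.seed a →
    ∀ i, (∀ k, ∀ p ∈ S.part i, ¬ Blocked (a k) p) →
      ∀ m, ∃ k q, S.Shows (a k) i q ∧ m ≤ q.clock

end SimulationData

/-- `T` simulates a solution of the Consensus Subroutine Problem for `M`. -/
def CubeSystem.SimulatesConsensusSubroutine {n : ℕ} {V : Type} (T : CubeSystem)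
    (M : System.{u} n V) : Prop :=
  ∃ S : SimulationData T M, S.IsModular ∧ S.Simulates ∧ S.SolvesConsensusSubroutine

end TileConsensus

/-! A process that gets no messages and calls the object at most once is determined by its input,
the answer it receives and the number of its events (`System.run`). So the tiles need not compute
anything: a straight ray of cubes, labelled with the input, the answer and a capped position,
represents the process, and decoding its length into a machine state is left to the map `rep`. The
first cube of a ray chooses the input freely. Since there are finitely many processes and inputs,
some `X` bounds all call times, and a head start (`offset`) makes every call happen at position `X`.

The consensus object is a path one level higher. It crosses all rays above position `X`, turns, and
comes back above position `X + 2`. Above its own cube at `X` a caller may start a path cube with its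
own value, unless the path coming from lower-numbered rays has taken the site. Each site is taken
once, so a single winner is carried past the last ray: this is agreement, and following the label
back to the ray where it entered gives validity. A caller's cube at `X + 2`, the gate, binds with
strength 1 to its ray and 1 to the path, so the ray waits for the answer. Its own call suffices to
set the path going, and the path cannot be blocked, so no other process can hold it up.

All control over assemblies comes from `Legit.fed_of_pull`: bonds join a cube only to cubes that
feed it or that it feeds, and the input strengths of a cube add up to exactly 2, so a cube attaches
only where all its inputs are present. Labels can therefore be traced back through their causes. As
feeding increases `rank`, a legitimate assembly grows from any subassembly that has the seed and all
the blockages (`Legit.grows`); growth is reduced to containment.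

On representations, containment is the order `ConfigLe` on configurations (`rep_sub`,
`configLe_of_sub`). Events go up in this order (`Step.le`), and between reachable configurations the
order implies a legal execution (`leads_of_le`). Hence possible events are simulated and impossible
ones are not. A crash is a misfit cube just beyond the tip of a ray; `not_gate_tip` makes sure that
there is always room for it.

For what must happen, a fair error-free sequence is followed by a round-robin execution (`schedule`)
that admits only events whose result is contained in some stage of the sequence. The sequence
settles who wins, live rays grow forever, and the winner gets to its call in the execution too, so
the execution is fair (`isFairRun_schedule`). It reaches the required configuration, which some
stage contains. -/

namespace TileConsensus

/-! ### Growth and stability in an arbitrary tile assembly system. -/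

namespace TileSet

variable {T : TileSet}

/-! ### Subassemblies -/

/-- Every cube of `α` is also in `β`. -/
def Sub (α β : T.Assembly) : Prop := ∀ p, α p ≠ none → β p = α p

theorem Sub.refl (α : T.Assembly) : Sub α α := fun _ _ => rfl

theorem Sub.trans {α β γ : T.Assembly} (h₁ : Sub α β) (h₂ : Sub β γ) : Sub α γ := by
  intro p hp
  have h := h₁ p hp
  rw [h₂ p (by rwa [h]), h]

theorem Sub.eq_some {α β : T.Assembly} (h : Sub α β) {p : Site} {c : Cube T.Tile}
    (hp : α p = some c) : β p = some c := by
  rw [h p (by simp [hp]), hp]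

theorem sub_update {α : T.Assembly} {p : Site} (hp : α p = none) (c : Option (Cube T.Tile)) :
    Sub α (Function.update α p c) := by
  intro q hq
  rw [Function.update_of_ne]
  rintro rfl
  exact hq hp

theorem Move.sub {R : Set Site} {α β : T.Assembly} (h : Move R α β) : Sub α β := by
  rcases h with ⟨p, t, hp, -, rfl⟩ | ⟨p, t, -, hp, -, rfl⟩
  · exact sub_update hp _
  · exact sub_update hp.1 _

theorem GrowsWithin.sub {R : Set Site} {α β : T.Assembly} (h : GrowsWithin R α β) : Sub α β := by
  induction h with
  | refl => exact Sub.refl _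
  | tail _ h ih => exact ih.trans (Move.sub h)

theorem Grows.within {α β : T.Assembly} (h : Grows α β) (R : Set Site) : GrowsWithin R α β :=
  Relation.ReflTransGen.mono (fun _ _ h => Or.inl h) _ _ h

theorem Grows.sub {α β : T.Assembly} (h : Grows α β) : Sub α β := (h.within ∅).sub

theorem Grows.blocked {α β : T.Assembly} (h : Grows α β) {q : Site} (hq : Blocked β q) :
    Blocked α q := by
  induction h with
  | refl => exact hq
  | tail _ h ih =>
    obtain ⟨p, t, hp, -, rfl⟩ := h
    apply ih
    obtain ⟨s, hs⟩ := hq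
    by_cases hqp : q = p
    · subst hqp; simp at hs
    · exact ⟨s, by rwa [Function.update_of_ne hqp] at hs⟩

/-! ### Binding strength -/

theorem opposite_opposite (f : Face) : f.opposite.opposite = f := by cases f <;> rfl

theorem next_opposite (f : Face) (p : Site) : f.opposite.next (f.next p) = p := by
  obtain ⟨x, y, z⟩ := p
  cases f <;> simp [Face.next, Face.opposite]

theorem next_ne (f : Face) (p : Site) : f.next p ≠ p := by
  obtain ⟨x, y, z⟩ := p
  cases f <;> simp [Face.next]

theorem bond_comm (t t' : T.Tile) (f : Face) : T.bond t t' f = T.bond t' t f.opposite := by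
  unfold bond
  rw [opposite_opposite]
  by_cases h : T.binds (T.glue t f).1 (T.glue t' f.opposite).1 ∧
      (T.glue t f).2 = (T.glue t' f.opposite).2
  · rw [if_pos h, if_pos ⟨T.binds_symm _ _ h.1, h.2.symm⟩, h.2]
  · rw [if_neg h, if_neg]
    exact fun h' => h ⟨T.binds_symm _ _ h'.1, h'.2.symm⟩

/-- The strength with which a cube of type `t` would bind at `p` with its face `f`. -/
noncomputable def facePull (α : T.Assembly) (p : Site) (t : T.Tile) (f : Face) : ℕ :=
  match α (f.next p) with
  | some ⟨t', false⟩ => T.bond t t' f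
  | _ => 0

theorem pull_eq_sum (α : T.Assembly) (p : Site) (t : T.Tile) :
    pull α p t = ∑ f : Face, facePull α p t f := rfl

theorem facePull_of_sound {α : T.Assembly} {p : Site} {t t' : T.Tile} {f : Face}
    (h : α (f.next p) = some ⟨t', false⟩) : facePull α p t f = T.bond t t' f := by
  simp [facePull, h]

theorem facePull_of_not_sound {α : T.Assembly} {p : Site} {t : T.Tile} {f : Face}
    (h : ¬ Sound α (f.next p)) : facePull α p t f = 0 := by
  unfold facePull
  split
  · rename_i t' h'
    exact (h ⟨t', h'⟩).elim
  · rfl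

theorem facePull_mono {α β : T.Assembly} (h : Sub α β) (p : Site) (t : T.Tile) (f : Face) :
    facePull α p t f ≤ facePull β p t f := by
  by_cases hs : Sound α (f.next p)
  · obtain ⟨t', ht⟩ := hs
    rw [facePull_of_sound ht, facePull_of_sound (h.eq_some ht)]
  · rw [facePull_of_not_sound hs]
    exact Nat.zero_le _

theorem pull_mono {α β : T.Assembly} (h : Sub α β) (p : Site) (t : T.Tile) :
    pull α p t ≤ pull β p t :=
  Finset.sum_le_sum fun f _ => facePull_mono h p t f

theorem link_of_sound {α : T.Assembly} {p : Site} {t t' : T.Tile} {f : Face}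
    (h : α p = some ⟨t, false⟩) (h' : α (f.next p) = some ⟨t', false⟩) :
    link α p f = T.bond t t' f := by
  simp [link, h, h']

theorem link_eq_zero {α : T.Assembly} {p : Site} {f : Face}
    (h : ¬ (Sound α p ∧ Sound α (f.next p))) : link α p f = 0 := by
  unfold link
  split
  · rename_i t t' h₁ h₂
    exact (h ⟨⟨t, h₁⟩, ⟨t', h₂⟩⟩).elim
  · rfl

theorem link_mono {α β : T.Assembly} (h : Sub α β) (p : Site) (f : Face) :
    link α p f ≤ link β p f := by
  by_cases hs : Sound α p ∧ Sound α (f.next p)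
  · obtain ⟨⟨t, ht⟩, ⟨t', ht'⟩⟩ := hs
    rw [link_of_sound ht ht', link_of_sound (h.eq_some ht) (h.eq_some ht')]
  · rw [link_eq_zero hs]
    exact Nat.zero_le _

theorem Sub.sound {α β : T.Assembly} (h : Sub α β) {p : Site} (hp : Sound α p) : Sound β p := by
  obtain ⟨t, ht⟩ := hp
  exact ⟨t, h.eq_some ht⟩

/-! ### Stability -/

/-- A cut with old cubes on both sides is strong enough in `α` already, and bonds are never lost.
Otherwise the new cube is the only correctly bound one on its side, and the bonds across the cut are
exactly those that make up its `pull`. -/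
theorem Stable.attach {α β : T.Assembly} (hα : Stable α) (h : Attach α β) : Stable β := by
  classical
  obtain ⟨p, t, hp, hpull, rfl⟩ := h
  set β := Function.update α p (some ⟨t, false⟩) with hβ
  have hsub : Sub α β := sub_update hp _
  have hβp : β p = some ⟨t, false⟩ := by simp [hβ]
  have hsound : ∀ q, Sound β q → q = p ∨ Sound α q := by
    rintro q ⟨s, hs⟩
    by_cases hqp : q = p
    · exact Or.inl hqp
    · rw [hβ, Function.update_of_ne hqp] at hs
      exact Or.inr ⟨s, hs⟩
  have hface : ∀ f, facePull α p t f = link β p f := by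
    intro f
    by_cases hs : Sound α (f.next p)
    · obtain ⟨t', ht'⟩ := hs
      rw [facePull_of_sound ht', link_of_sound hβp (hsub.eq_some ht')]
    · rw [facePull_of_not_sound hs, link_eq_zero]
      rintro ⟨-, h2⟩
      rcases hsound _ h2 with h3 | h3
      · exact next_ne f p h3
      · exact hs h3
  have hlink : ∀ f, link β p f = link β (f.next p) f.opposite := by
    intro f
    by_cases hs : Sound β (f.next p)
    · obtain ⟨t', ht'⟩ := hs
      rw [link_of_sound hβp ht', link_of_sound ht' (by rw [next_opposite]; exact hβp), bond_comm]
    · rw [link_eq_zero (fun h => hs h.2), link_eq_zero (fun h => hs h.1)]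
  intro S hin hout
  by_cases h1 : ∃ q ∈ S, Sound α q
  · by_cases h2 : ∃ q ∉ S, Sound α q
    · obtain ⟨F, hF, hsum⟩ := hα S h1 h2
      exact ⟨F, hF, hsum.trans (Finset.sum_le_sum fun e _ => link_mono hsub _ _)⟩
    · have hpS : p ∉ S := by
        obtain ⟨q, hq, hs⟩ := hout
        rcases hsound q hs with rfl | h3
        · exact hq
        · exact (h2 ⟨q, hq, h3⟩).elim
      -- Cut edges are recorded from inside `S`. The new cube lies outside, so each of its faces is
      -- listed from the neighbour's side.
      refine ⟨(Finset.univ.filter fun f : Face => f.next p ∈ S).image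
        (fun f => (f.next p, f.opposite)), ?_, ?_⟩
      · intro e he
        simp only [Finset.mem_image, Finset.mem_filter, Finset.mem_univ, true_and] at he
        obtain ⟨f, hf, rfl⟩ := he
        exact ⟨hf, by simpa [next_opposite] using hpS⟩
      · rw [Finset.sum_image]
        · rw [Finset.sum_filter]
          refine hpull.trans (Finset.sum_le_sum fun f _ => ?_)
          split_ifs with hf
          · change facePull α p t f ≤ _
            rw [hface, hlink]
          · change facePull α p t f ≤ _
            rw [facePull_of_not_sound]
            exact fun hs => h2 ⟨_, hf, hs⟩
        · intro f _ g _ hfg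
          have h3 : f.opposite = g.opposite := (Prod.ext_iff.1 hfg).2
          rw [← opposite_opposite f, h3, opposite_opposite]
  · have hpS : p ∈ S := by
      obtain ⟨q, hq, hs⟩ := hin
      rcases hsound q hs with rfl | h3
      · exact hq
      · exact (h1 ⟨q, hq, h3⟩).elim
    refine ⟨(Finset.univ.filter fun f : Face => f.next p ∉ S).image (fun f => (p, f)), ?_, ?_⟩
    · intro e he
      simp only [Finset.mem_image, Finset.mem_filter, Finset.mem_univ, true_and] at he
      obtain ⟨f, hf, rfl⟩ := he
      exact ⟨hpS, hf⟩
    · rw [Finset.sum_image (by intro f _ g _ hfg; exact (Prod.ext_iff.1 hfg).2), Finset.sum_filter]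
      refine hpull.trans (Finset.sum_le_sum fun f _ => ?_)
      change facePull α p t f ≤ _
      by_cases hf : f.next p ∈ S
      · rw [facePull_of_not_sound fun hs => h1 ⟨_, hf, hs⟩]
        exact Nat.zero_le _
      · rw [if_pos hf, hface f]

/-- A blockage is not a correctly bound cube, so no new cut has to be tested, and the bonds of `α`
remain. -/
theorem Stable.block {R : Set Site} {α β : T.Assembly} (hα : Stable α) (h : Block R α β) :
    Stable β := by
  obtain ⟨p, t, -, hp, -, rfl⟩ := h
  have hsub := sub_update hp.1 (some ⟨t, true⟩)
  have hsound : ∀ q, Sound (Function.update α p (some ⟨t, true⟩)) q → Sound α q := by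
    rintro q ⟨s, hs⟩
    by_cases hqp : q = p
    · subst hqp
      simp at hs
    · rw [Function.update_of_ne hqp] at hs
      exact ⟨s, hs⟩
  rintro S ⟨q, hq, hs⟩ ⟨r, hr, hs'⟩
  obtain ⟨F, hF, hsum⟩ := hα S ⟨q, hq, hsound q hs⟩ ⟨r, hr, hsound r hs'⟩
  exact ⟨F, hF, hsum.trans (Finset.sum_le_sum fun e _ => link_mono hsub _ _)⟩

theorem Stable.growsWithin {R : Set Site} {α β : T.Assembly} (hα : Stable α)
    (h : GrowsWithin R α β) : Stable β := by
  induction h with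
  | refl => exact hα
  | tail _ h ih => exact h.elim ih.attach ih.block

/-! ### Growth of a superassembly -/

/-- A superassembly `α` of `β` with finitely many additional cubes can be grown from `β` if every
additional cube is held in place by cubes of smaller rank. -/
theorem grows_of_rank (rank : Site → ℕ) {β : T.Assembly} : ∀ {α : T.Assembly}, Sub β α →
    {p | β p = none ∧ α p ≠ none}.Finite →
    (∀ p, β p = none → α p ≠ none → ∃ t, α p = some ⟨t, false⟩ ∧
      2 ≤ pull (fun q => if rank q < rank p then α q else none) p t) → Grows β α := by
  suffices H : ∀ (N : ℕ) (α : T.Assembly), Sub β α →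
      {p | β p = none ∧ α p ≠ none}.Finite → {p | β p = none ∧ α p ≠ none}.ncard = N →
      (∀ p, β p = none → α p ≠ none → ∃ t, α p = some ⟨t, false⟩ ∧
        2 ≤ pull (fun q => if rank q < rank p then α q else none) p t) → Grows β α from
    fun {α} h1 h2 h3 => H _ α h1 h2 rfl h3
  intro N
  induction N with
  | zero =>
    intro α hsub hfin hcard _
    rw [Set.ncard_eq_zero hfin] at hcard
    have : α = β := by
      funext p
      by_cases hp : β p = none
      · by_contra hne
        have : p ∈ {p | β p = none ∧ α p ≠ none} := ⟨hp, by rwa [hp] at hne⟩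
        simp [hcard] at this
      · exact hsub p hp
    rw [this]
    exact Relation.ReflTransGen.refl
  | succ N ih =>
    intro α hsub hfin hcard hfed
    have hne : {p | β p = none ∧ α p ≠ none}.Nonempty := by
      apply Set.nonempty_of_ncard_ne_zero
      omega
    -- An additional cube of maximal rank supports none of the other additional ones, so it can
    -- attach last.
    obtain ⟨p, hp, hmax⟩ := Set.exists_max_image _ rank hfin hne
    obtain ⟨t, ht, hpull⟩ := hfed p hp.1 hp.2
    have hset : {q | β q = none ∧ Function.update α p none q ≠ none} =
        {q | β q = none ∧ α q ≠ none} \ {p} := by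
      ext q
      by_cases hqp : q = p
      · subst hqp; simp
      · simp [hqp]
    have hstep : Grows β (Function.update α p none) := by
      apply ih
      · intro q hq
        rw [Function.update_of_ne]
        · exact hsub q hq
        · rintro rfl
          exact hq hp.1
      · rw [hset]
        exact hfin.sdiff
      · rw [hset, Set.ncard_sdiff_singleton_of_mem hp, hcard]
        rfl
      · intro q hq hq'
        have hqp : q ≠ p := by
          rintro rfl
          simp at hq'
        rw [Function.update_of_ne hqp] at hq' ⊢
        obtain ⟨s, hs, hs'⟩ := hfed q hq hq'
        refine ⟨s, hs, hs'.trans_eq ?_⟩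
        congr 1
        funext r
        split_ifs with hr
        · rw [Function.update_of_ne]
          rintro rfl
          exact absurd hr (not_lt.2 (hmax q ⟨hq, hq'⟩))
        · rfl
    refine hstep.tail ⟨p, t, by simp, hpull.trans (pull_mono ?_ p t), ?_⟩
    · intro q hq
      by_cases hr : rank q < rank p
      · simp only [if_pos hr]
        rw [Function.update_of_ne]
        rintro rfl
        exact lt_irrefl _ hr
      · simp [hr] at hq
    · rw [Function.update_idem, ← ht, Function.update_eq_self]

theorem IsFairSequence.reaches {R : Set Site} {α : T.Assembly} {a : ℕ → T.Assembly}
    (h : IsFairSequence (Move R) α a) (k : ℕ) : GrowsWithin R α (a k) := by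
  induction k with
  | zero => rw [h.start]; exact Relation.ReflTransGen.refl
  | succ k ih =>
    rcases h.step k with h' | h'
    · rwa [h']
    · exact ih.tail h'

theorem IsFairSequence.grows {α : T.Assembly} {a : ℕ → T.Assembly}
    (h : IsFairSequence Attach α a) (k : ℕ) : Grows α (a k) := by
  induction k with
  | zero => rw [h.start]; exact Relation.ReflTransGen.refl
  | succ k ih =>
    rcases h.step k with h' | h'
    · rwa [h']
    · exact ih.tail h'

theorem IsFairSequence.within {α : T.Assembly} {a : ℕ → T.Assembly}
    (h : IsFairSequence Attach α a) (R : Set Site) : IsFairSequence (Move R) α a :=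
  ⟨h.start, fun k => (h.step k).imp_right Or.inl, h.fair⟩

theorem IsFairSequence.sub {R : Set Site} {α : T.Assembly} {a : ℕ → T.Assembly}
    (h : IsFairSequence (Move R) α a) {k l : ℕ} (hkl : k ≤ l) : Sub (a k) (a l) := by
  induction l, hkl using Nat.le_induction with
  | base => exact Sub.refl _
  | succ l _ ih =>
    rcases h.step l with h' | h'
    · rwa [h']
    · exact ih.trans h'.sub

end TileSet
end TileConsensus

/-! ### The tile set: rays, gates and the path of the consensus object. -/

namespace TileConsensus

open TileSet

namespace ConsensusTiles

/-- The cube types: a row that supplies the processes with their start, a ray for every process,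
along which it grows, and the cubes of the consensus object, which carry the winner of the object.
A cube of a ray carries the input, its position on the ray (up to the last one that matters) and the
answer of the object. -/
inductive Tile (n : ℕ) (V : Type) (X : ℕ) : Type
  | row (y : Fin n) : Tile n V X
  | ray (i : Fin n) (x : V) (k : Fin (X + 4)) (w : Option V) : Tile n V X
  | obj (m : Fin (2 * n + 1)) (j : Fin n) (v : V) : Tile n V X

instance {n : ℕ} {V : Type} {X : ℕ} [Finite V] : Finite (Tile n V X) := by
  let f : Tile n V X → Fin n ⊕ (Fin n × V × Fin (X + 4) × Option V) ⊕
      (Fin (2 * n + 1) × Fin n × V)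
    | .row y => .inl y
    | .ray i x k w => .inr (.inl (i, x, k, w))
    | .obj m j v => .inr (.inr (m, j, v))
  apply Finite.of_injective f
  intro s t h
  cases s <;> cases t <;> simp_all [f]

/-- The places where cubes can be bound. -/
inductive Place (n : ℕ) : Type
  | row (y : Fin n) : Place n
  | ray (i : Fin n) (m : ℕ) : Place n
  | obj (m : Fin (2 * n + 1)) : Place n

/-- The last position that matters on a ray. -/
def cap {X : ℕ} (m : ℕ) : Fin (X + 4) := ⟨min m (X + 3), by omega⟩

/-- The site of a place. The consensus object extends above position `X` of the rays to the decision
point, and returns above position `X + 2`. -/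
def site {n : ℕ} (X : ℕ) : Place n → Site
  | .row y => (-1, y.val, 0)
  | .ray i m => (m, i.val, 0)
  | .obj m =>
    if m.val < n then (X, m.val, 1)
    else if m.val = n then (X + 1, (n : ℤ) - 1, 1)
    else (X + 2, 2 * (n : ℤ) - m.val, 1)

theorem site_injective {n : ℕ} (X : ℕ) : Function.Injective (site X : Place n → Site) := by
  intro p q h
  cases p <;> cases q <;> simp only [site] at h
  · simp only [Prod.mk.injEq, Nat.cast_inj, true_and, and_true] at h
    rw [Fin.ext h]
  · simp only [Prod.mk.injEq] at h; omega
  · split_ifs at h <;> simp at h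
  · simp only [Prod.mk.injEq] at h; omega
  · simp only [Prod.mk.injEq, Nat.cast_inj, and_true] at h
    rw [h.1, Fin.ext h.2]
  · split_ifs at h <;> simp at h
  · split_ifs at h <;> simp at h
  · split_ifs at h <;> simp at h
  · rename_i m m'
    have : m.val = m'.val := by
      have h1 := m.2
      have h2 := m'.2
      split_ifs at h <;> simp only [Prod.mk.injEq] at h <;> omega
    rw [Fin.ext this]

/-- The direction in which the consensus object continues after its cube with number `m`. -/
def dir (n m : ℕ) : Face :=
  if m + 1 < n then .north else if m ≤ n then .east else .south

section

variable {n : ℕ} {V : Type} {X : ℕ} (call : Fin n → V → Option V)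

/-- The answer of the object is needed by this cube of a ray. -/
def Gate (i : Fin n) (x : V) (k : ℕ) : Prop := call i x ≠ none ∧ k = X + 2

/-- A cube of the first type feeds a cube of the second type across its face `f`. -/
def Feeds (f : Face) : Tile n V X → Tile n V X → Prop
  | .row y, .row y' => f = .north ∧ y'.val = y.val + 1
  | .row y, .ray i _ k w => f = .east ∧ y = i ∧ k.val = 0 ∧ w = none
  | .ray i x k w, .ray i' x' k' w' => f = .east ∧ i = i' ∧ x = x' ∧
      k'.val = min (k.val + 1) (X + 3) ∧
      (Gate (X := X) call i x k' → w = none ∧ w' ≠ none) ∧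
      (¬ Gate (X := X) call i x k' → w' = w)
  | .ray i x k _, .obj m j v => f = .up ∧ k.val = X ∧ m.val = j.val ∧ i = j ∧ call i x = some v
  | .obj m j v, .obj m' j' v' => f = dir n m ∧ m'.val = m.val + 1 ∧ j.val ≤ m.val ∧ j = j' ∧ v = v'
  | .obj m _ v, .ray i x k w => f = .down ∧ Gate (X := X) call i x k ∧ m.val + i.val = 2 * n ∧
      w = some v
  | _, _ => False

open Classical in
/-- The strength of the glue on a face. -/
noncomputable def strength : Tile n V X → Face → Fin 3
  | .row _, _ => 2
  | .ray i x k _, f =>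
    if ((f = .west ∨ f = .up) ∧ Gate (X := X) call i x k) ∨
      (f = .east ∧ Gate (X := X) call i x (k.val + 1)) then 1 else 2
  | .obj m _ _, f => if f = .down ∧ n ≤ m.val then 1 else 2

open Classical in
/-- The faces at which a cube has to be fed. -/
noncomputable def inputs : Tile n V X → Finset Face
  | .row _ => {.south}
  | .ray i x k _ => if Gate (X := X) call i x k then {.west, .up} else {.west}
  | .obj m j _ => if m.val = j.val then {.down} else {(dir n (m.val - 1)).opposite}

/-- The cube types with their glues. -/
noncomputable abbrev tileSet (X : ℕ) (call : Fin n → V → Option V) [Finite V] : TileSet where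
  Tile := Tile n V X
  finite_tile := inferInstance
  Glue := Tile n V X × Face
  glue t f := ((t, f), strength call t f)
  binds g g' := g'.2 = g.2.opposite ∧ (Feeds call g.2 g.1 g'.1 ∨ Feeds call g'.2 g'.1 g.1)
  binds_symm := by
    rintro ⟨t, f⟩ ⟨t', f'⟩ ⟨h, h'⟩
    exact ⟨by simp only [] at h; rw [h, opposite_opposite], h'.symm⟩

variable {call}

/-- A bond needs equal strengths on the two faces. Where one cube feeds the other, weak faces meet
weak faces: the cap at `X + 3` does not disturb the step from `X + 1` to `X + 2`, and cubes of the
object over a gate have number at least `n`, those over a call a smaller one. -/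
theorem Feeds.strength_eq {f : Face} {s t : Tile n V X} (h : Feeds call f s t) :
    strength call s f = strength call t f.opposite := by
  cases s <;> cases t <;> simp only [Feeds] at h
  · simp [strength]
  · obtain ⟨rfl, rfl, hk, rfl⟩ := h
    simp [strength, Face.opposite, Gate, hk]
  · rename_i k w i x k' w'
    obtain ⟨rfl, rfl, rfl, hk, h1, h2⟩ := h
    have hiff : k.val = X + 1 ↔ k'.val = X + 2 := by omega
    simp [strength, Face.opposite, Gate, hiff]
  · obtain ⟨rfl, hk, hm, rfl, hc⟩ := h
    simp only [strength, Face.opposite, Gate]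
    simp [hk]
    omega
  · rename_i i x k w m j v
    obtain ⟨rfl, ⟨h1, h2⟩, h3, rfl⟩ := h
    have : n ≤ i.val := by omega
    simp [strength, Face.opposite, Gate, h1, h2, this]
  · rename_i m j v m' j' v'
    obtain ⟨rfl, h⟩ := h
    simp only [strength, dir]
    split_ifs <;> simp_all [Face.opposite]

theorem Feeds.mem_inputs {f : Face} {s t : Tile n V X} (h : Feeds call f s t) :
    f.opposite ∈ inputs call t := by
  cases s <;> cases t <;> simp only [Feeds] at h
  · simp [inputs, h.1, Face.opposite]
  · simp only [inputs, h.1, Face.opposite]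
    split_ifs <;> simp
  · simp only [inputs, h.1, Face.opposite]
    split_ifs <;> simp
  · simp only [inputs, h.1, Face.opposite]
    rw [if_pos h.2.2.1]
    simp
  · simp only [inputs, h.1, Face.opposite]
    rw [if_pos h.2.1]
    simp
  · obtain ⟨rfl, h1, h2, rfl, rfl⟩ := h
    simp only [inputs]
    rw [if_neg (by omega), h1]
    simp

/-- Row cubes are fed only by the preceding number. So the seed, the one cube that nothing has fed,
cannot be a cube that a newcomer would feed. -/
theorem not_feeds_row_zero [NeZero n] {f : Face} {s : Tile n V X} :
    ¬ Feeds call f s (.row 0) := by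
  intro h
  cases s <;> simp [Feeds] at h

/-- The inputs are one face of strength 2 or two of strength 1, so there is no slack over the
temperature. With `strength_pos` this forces every input to be present. -/
theorem sum_inputs (t : Tile n V X) : ∑ f ∈ inputs call t, (strength call t f).val = 2 := by
  cases t
  · simp [inputs, strength]
  · simp only [inputs]
    split_ifs with h
    · rw [Finset.sum_pair (by decide)]
      simp [strength, h]
    · simp [strength, h]
  · simp only [inputs]
    split_ifs with h
    · rename_i m j v
      have : ¬ n ≤ m.val := by omega
      simp [strength, this]
    · rw [Finset.sum_singleton]
      simp only [strength, dir]
      split_ifs <;> simp_all [Face.opposite]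

theorem strength_pos (t : Tile n V X) (f : Face) : 0 < (strength call t f).val := by
  cases t <;> simp only [strength] <;> (try split_ifs) <;> decide

theorem bond_le [Finite V] (s t : Tile n V X) (f : Face) :
    (tileSet X call).bond s t f ≤ (strength call s f).val := by
  unfold TileSet.bond
  split_ifs
  · exact le_rfl
  · exact Nat.zero_le _

theorem Feeds.bond_eq [Finite V] {f : Face} {s t : Tile n V X} (h : Feeds call f s t) :
    (tileSet X call).bond t s f.opposite = (strength call t f.opposite).val := by
  unfold TileSet.bond
  rw [if_pos]
  simp only [opposite_opposite]
  exact ⟨⟨trivial, Or.inr h⟩, h.strength_eq.symm⟩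

theorem feeds_of_bond [Finite V] {f : Face} {s t : Tile n V X}
    (h : (tileSet X call).bond t s f ≠ 0) : Feeds call f t s ∨ Feeds call f.opposite s t := by
  unfold TileSet.bond at h
  split_ifs at h with h'
  · exact h'.1.2
  · exact (h rfl).elim

/-- The cubes that may occur at a place. -/
def Typed : Place n → Tile n V X → Prop
  | .row y, .row y' => y = y'
  | .ray i m, .ray i' _ k _ => i = i' ∧ k = cap m
  | .obj m, .obj m' j _ => m = m' ∧ j.val ≤ m.val
  | _, _ => False

/-- The places in an order in which they can be occupied. -/
def rank (n X : ℕ) : Place n → ℕ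
  | .row y => y.val
  | .ray _ m => if m ≤ X + 1 then n + m else 3 * n + X + 4 + m
  | .obj m => n + X + 2 + m.val

theorem site_obj_succ {m m' : Fin (2 * n + 1)} (h : m'.val = m.val + 1) :
    (dir n m).next (site X (.obj m)) = site X (.obj m') := by
  have h1 := m'.2
  simp only [site, dir]
  split_ifs <;> first | omega | (simp only [Face.next, Prod.mk.injEq]; refine ⟨?_, ?_, ?_⟩ <;> first | trivial | omega)

theorem site_obj_low {m : Fin (2 * n + 1)} {j : Fin n} (h : m.val = j.val) :
    site X (.obj m) = Face.up.next (site X (.ray j X)) := by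
  have h1 := j.2
  simp only [site]
  rw [if_pos (by omega)]
  simp only [Face.next, Prod.mk.injEq]
  refine ⟨?_, ?_, ?_⟩ <;> first | trivial | omega

theorem site_obj_high {m : Fin (2 * n + 1)} {i : Fin n} (h : m.val + i.val = 2 * n) :
    site X (.obj m) = Face.up.next (site X (.ray i (X + 2))) := by
  have h1 := i.2
  simp only [site]
  rw [if_neg (by omega), if_neg (by omega)]
  simp only [Face.next, Prod.mk.injEq]
  refine ⟨?_, ?_, ?_⟩ <;> first | trivial | omega

theorem site_row_succ {y y' : Fin n} (h : y'.val = y.val + 1) :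
    Face.north.next (site X (.row y)) = site X (.row y') := by
  simp only [site, Face.next, Prod.mk.injEq]
  refine ⟨?_, ?_, ?_⟩ <;> first | trivial | omega

theorem site_ray_zero (i : Fin n) : Face.east.next (site X (.row i)) = site X (.ray i 0) := by
  simp [site, Face.next]

theorem site_ray_succ (i : Fin n) (m : ℕ) :
    Face.east.next (site X (.ray i m)) = site X (.ray i (m + 1)) := by
  simp [site, Face.next]

/-- Feeding is local and acyclic. The face and the labels fix the neighbouring place, and `rank`
lists the row, then the rays up to `X + 1`, then the object, then the rays from `X + 2` on. -/
theorem Feeds.typed {f : Face} {s t : Tile n V X} (h : Feeds call f s t) {P : Place n}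
    (hP : Typed P s) :
    ∃ Q, f.next (site X P) = site X Q ∧ Typed Q t ∧ rank n X P < rank n X Q := by
  cases s <;> cases t <;> simp only [Feeds] at h <;> cases P <;> simp only [Typed] at hP
  · rename_i y y' y''
    obtain ⟨rfl, h⟩ := h
    subst hP
    exact ⟨.row y', site_row_succ h, rfl, by simp [rank, h]⟩
  · rename_i y i x k w y'
    obtain ⟨rfl, rfl, h, -⟩ := h
    subst hP
    refine ⟨.ray y' 0, site_ray_zero _, ⟨rfl, ?_⟩, ?_⟩
    · ext; simp [h, cap]
    · simp only [rank]
      have := y'.2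
      split_ifs <;> omega
  · rename_i i x k w i' x' k' w' i'' m
    obtain ⟨rfl, rfl, rfl, h, -⟩ := h
    obtain ⟨rfl, hk⟩ := hP
    refine ⟨.ray i'' (m + 1), site_ray_succ _ _, ⟨rfl, ?_⟩, ?_⟩
    · ext
      rw [h, hk]
      simp only [cap]
      omega
    · simp only [rank]
      split_ifs <;> omega
  · rename_i i x k w m j v i' m'
    obtain ⟨rfl, h, hm, rfl, -⟩ := h
    obtain ⟨rfl, hk⟩ := hP
    have hX : m' = X := by
      rw [hk] at h
      simp only [cap] at h
      omega
    subst hX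
    refine ⟨.obj m, (site_obj_low hm).symm, ⟨rfl, hm.ge⟩, ?_⟩
    simp only [rank]
    split_ifs <;> omega
  · rename_i m j v i x k w m'
    obtain ⟨rfl, ⟨-, hk⟩, hm, -⟩ := h
    obtain ⟨rfl, hP⟩ := hP
    refine ⟨.ray i (X + 2), ?_, ⟨rfl, ?_⟩, ?_⟩
    · rw [site_obj_high hm]
      exact next_opposite .up _
    · ext
      rw [hk]
      simp [cap]
    · simp only [rank]
      split_ifs <;> omega
  · rename_i m j v m' j' v' m''
    obtain ⟨rfl, h, hj, rfl, -⟩ := h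
    obtain ⟨rfl, hP⟩ := hP
    refine ⟨.obj m', site_obj_succ h, ⟨rfl, by omega⟩, ?_⟩
    simp [rank, h]

end

end ConsensusTiles
end TileConsensus

/-! ### Legitimate assemblies: the invariant of growth with blockages. -/

namespace TileConsensus

open TileSet

namespace ConsensusTiles

section

variable {n : ℕ} {V : Type} {X : ℕ} {call : Fin n → V → Option V} [NeZero n] [Finite V]

/-- The sites of the consensus object, the row that starts the processes included. -/
def object (n X : ℕ) : Set Site :=
  {p | (∃ y : Fin n, p = site X (.row y)) ∨ ∃ m : Fin (2 * n + 1), p = site X (.obj m)}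

/-- The sites of a process. -/
def part {n : ℕ} (X : ℕ) (i : Fin n) : Set Site := {p | ∃ m, p = site X (.ray i m)}

omit [NeZero n] in
theorem ray_not_mem_object (i : Fin n) (m : ℕ) : site X (.ray i m) ∉ object n X := by
  rintro (⟨y, h⟩ | ⟨y, h⟩) <;> cases site_injective X h

omit [NeZero n] in
theorem object_finite : (object n X).Finite := by
  have : object n X = Set.range (fun y : Fin n => site X (.row y)) ∪
      Set.range (fun m : Fin (2 * n + 1) => site X (.obj m)) := by
    ext p
    simp [object, eq_comm]
  rw [this]
  exact (Set.finite_range _).union (Set.finite_range _)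

/-- At every face at which a cube `t` at `p` has to be fed, there is a cube that feeds it. -/
def Fed (α : (tileSet X call).Assembly) (p : Site) (t : Tile n V X) : Prop :=
  ∀ f ∈ inputs call t, ∃ s, α (f.next p) = some ⟨s, false⟩ ∧ Feeds call f.opposite s t

omit [NeZero n] in
theorem Fed.mono {α β : (tileSet X call).Assembly} {p : Site} {t : Tile n V X}
    (h : Fed α p t) (hs : Sub α β) : Fed β p t := by
  intro f hf
  obtain ⟨s, h1, h2⟩ := h f hf
  exact ⟨s, hs.eq_some h1, h2⟩

omit [NeZero n] in
theorem Fed.pull {α : (tileSet X call).Assembly} {p : Site} {t : Tile n V X}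
    (h : Fed α p t) : 2 ≤ pull α p t := by
  rw [pull_eq_sum, ← sum_inputs (call := call) t]
  refine le_trans (Finset.sum_le_sum fun f hf => ?_)
    (Finset.sum_le_sum_of_subset (Finset.subset_univ (inputs call t)))
  obtain ⟨s, h1, h2⟩ := h f hf
  rw [facePull_of_sound h1]
  have := h2.bond_eq
  rw [opposite_opposite] at this
  exact this.ge

/-- What is true in all assemblies that grow from the seed. -/
structure Legit (α : (tileSet X call).Assembly) : Prop where
  seed : α (site X (.row (0 : Fin n))) = some ⟨.row 0, false⟩
  fed : ∀ p t, α p = some ⟨t, false⟩ → (p = site X (.row (0 : Fin n)) ∧ t = .row 0) ∨ Fed α p t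
  typed : ∀ p t, α p = some ⟨t, false⟩ → ∃ P, p = site X P ∧ Typed P t
  blocked : ∀ p, Blocked α p → ∃ (i : Fin n) (m : ℕ), p = site X (.ray i m)
  finite : {p | α p ≠ none}.Finite

/-- A neighbour that `t` would feed needs a feeder on the common face, hence a cube at `p`, but `p`
is empty. So only feeders of `t` contribute, all at input faces, and since these total exactly 2
none may be missing. -/
theorem Legit.fed_of_pull {α : (tileSet X call).Assembly} (hα : Legit α) {p : Site}
    {t : Tile n V X} (hp : α p = none) (h : 2 ≤ pull α p t) : Fed α p t := by
  classical
  have key : ∀ f, facePull α p t f ≠ 0 →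
      ∃ s, α (f.next p) = some ⟨s, false⟩ ∧ Feeds call f.opposite s t := by
    intro f hf
    by_cases hs : Sound α (f.next p)
    · obtain ⟨s, hs⟩ := hs
      rw [facePull_of_sound hs] at hf
      rcases feeds_of_bond hf with h1 | h1
      · exfalso
        rcases hα.fed _ _ hs with ⟨-, rfl⟩ | h2
        · exact not_feeds_row_zero h1
        · obtain ⟨s', h3, -⟩ := h2 _ h1.mem_inputs
          rw [next_opposite, hp] at h3
          simp at h3
      · exact ⟨s, hs, h1⟩
    · exact (hf (facePull_of_not_sound hs)).elim
  intro f hf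
  apply key
  intro h0
  have hle : ∀ g, facePull α p t g ≤ (strength call t g).val := by
    intro g
    by_cases hs : Sound α (g.next p)
    · obtain ⟨s, hs⟩ := hs
      rw [facePull_of_sound hs]
      exact bond_le _ _ _
    · rw [facePull_of_not_sound hs]
      exact Nat.zero_le _
  have hsum : pull α p t = ∑ g ∈ inputs call t, facePull α p t g := by
    rw [pull_eq_sum]
    refine (Finset.sum_subset (Finset.subset_univ _) fun g _ hg => ?_).symm
    by_contra hne
    obtain ⟨s, -, hs⟩ := key g hne
    have := hs.mem_inputs
    rw [opposite_opposite] at this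
    exact hg this
  have hlt : pull α p t < 2 := by
    rw [hsum, ← sum_inputs (call := call) t]
    exact Finset.sum_lt_sum (fun g _ => hle g) ⟨f, hf, by rw [h0]; exact strength_pos t f⟩
  omega

/-- Every cube has an input, and the place of one feeder determines the place of the cube. -/
theorem Fed.typed {α : (tileSet X call).Assembly} (hα : Legit α) {p : Site} {t : Tile n V X}
    (h : Fed α p t) : ∃ P, p = site X P ∧ Typed P t := by
  have hne : (inputs call t).Nonempty := by
    rw [Finset.nonempty_iff_ne_empty]
    intro h0
    have := sum_inputs (call := call) t
    rw [h0] at this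
    simp at this
  obtain ⟨f, hf⟩ := hne
  obtain ⟨s, h1, h2⟩ := h f hf
  obtain ⟨P, h3, h4⟩ := hα.typed _ _ h1
  obtain ⟨Q, h5, h6, -⟩ := h2.typed h4
  rw [← h3, next_opposite] at h5
  exact ⟨Q, h5, h6⟩

theorem Legit.attach {α β : (tileSet X call).Assembly} (hα : Legit α) (h : Attach α β) :
    Legit β := by
  have hsub : Sub α β := Move.sub (R := ∅) (Or.inl h)
  obtain ⟨p, t, hp, hpull, rfl⟩ := h
  have hfed := hα.fed_of_pull hp hpull
  refine ⟨hsub.eq_some hα.seed, ?_, ?_, ?_, ?_⟩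
  · intro q s hq
    by_cases hqp : q = p
    · subst hqp
      rw [Function.update_self] at hq
      cases hq
      exact Or.inr (hfed.mono hsub)
    · rw [Function.update_of_ne hqp] at hq
      exact (hα.fed q s hq).imp_right fun h => h.mono hsub
  · intro q s hq
    by_cases hqp : q = p
    · subst hqp
      rw [Function.update_self] at hq
      cases hq
      exact hfed.typed hα
    · rw [Function.update_of_ne hqp] at hq
      exact hα.typed q s hq
  · rintro q ⟨s, hq⟩
    by_cases hqp : q = p
    · subst hqp
      simp at hq
    · rw [Function.update_of_ne hqp] at hq
      exact hα.blocked q ⟨s, hq⟩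
  · refine (hα.finite.insert p).subset fun q hq => ?_
    by_cases hqp : q = p
    · exact Or.inl hqp
    · simp only [Set.mem_ofPred_eq, Function.update_of_ne hqp] at hq
      exact Or.inr hq

/-- A blockage occurs at a site where some cube fits, hence at a place, and the places outside
`object` lie on rays. The correct cubes stay the same, so the other clauses are inherited. -/
theorem Legit.block {α β : (tileSet X call).Assembly} (hα : Legit α)
    (h : Block (object n X) α β) : Legit β := by
  have hsub : Sub α β := Move.sub (Or.inr h)
  obtain ⟨p, t, hpR, ⟨hp, t', ht'⟩, -, rfl⟩ := h
  have hfed := hα.fed_of_pull hp ht'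
  have hray : ∃ (i : Fin n) (m : ℕ), p = site X (.ray i m) := by
    obtain ⟨P, rfl, -⟩ := hfed.typed hα
    cases P with
    | row y => exact (hpR (Or.inl ⟨y, rfl⟩)).elim
    | ray i m => exact ⟨i, m, rfl⟩
    | obj m => exact (hpR (Or.inr ⟨m, rfl⟩)).elim
  have hold : ∀ q s, Function.update α p (some ⟨t, true⟩) q = some ⟨s, false⟩ →
      α q = some ⟨s, false⟩ := by
    intro q s hq
    by_cases hqp : q = p
    · subst hqp
      simp at hq
    · rwa [Function.update_of_ne hqp] at hq
  refine ⟨hsub.eq_some hα.seed, ?_, ?_, ?_, ?_⟩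
  · intro q s hq
    exact (hα.fed q s (hold q s hq)).imp_right fun h => h.mono hsub
  · exact fun q s hq => hα.typed q s (hold q s hq)
  · rintro q ⟨s, hq⟩
    by_cases hqp : q = p
    · subst hqp
      exact hray
    · rw [Function.update_of_ne hqp] at hq
      exact hα.blocked q ⟨s, hq⟩
  · refine (hα.finite.insert p).subset fun q hq => ?_
    by_cases hqp : q = p
    · exact Or.inl hqp
    · simp only [Set.mem_ofPred_eq, Function.update_of_ne hqp] at hq
      exact Or.inr hq

theorem Legit.growsWithin {α β : (tileSet X call).Assembly} (hα : Legit α)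
    (h : GrowsWithin (object n X) α β) : Legit β := by
  induction h with
  | refl => exact hα
  | tail _ h ih => exact h.elim ih.attach ih.block

/-- A legitimate assembly grows from each of its subassemblies that contain the seed and all
blockages. -/
theorem Legit.grows {α β : (tileSet X call).Assembly} (hα : Legit α) (hsub : Sub β α)
    (hseed : β (site X (.row (0 : Fin n))) ≠ none) (hbl : ∀ p, Blocked α p → β p ≠ none) : Grows β α := by
  -- The feeder of a cube has smaller rank, so it survives the truncation in `grows_of_rank`. The
  -- rank 0 off the image of `site` is only a default.
  classical
  apply grows_of_rank (Function.extend (site X) (rank n X) fun _ => 0) hsub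
  · exact hα.finite.subset fun p hp => hp.2
  · intro p hβ hp
    obtain ⟨⟨t, b⟩, ht⟩ := Option.ne_none_iff_exists'.1 hp
    cases b with
    | true => exact (hbl p ⟨t, ht⟩ hβ).elim
    | false =>
      refine ⟨t, ht, ?_⟩
      rcases hα.fed p t ht with ⟨rfl, -⟩ | h
      · exact (hseed hβ).elim
      · apply Fed.pull
        intro f hf
        obtain ⟨s, h1, h2⟩ := h f hf
        refine ⟨s, ?_, h2⟩
        obtain ⟨P, h3, h4⟩ := hα.typed _ _ h1
        obtain ⟨Q, h5, -, h6⟩ := h2.typed h4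
        rw [← h3, next_opposite] at h5
        simp only
        rw [if_pos, h1]
        rw [h3, h5, (site_injective X).extend_apply, (site_injective X).extend_apply]
        exact h6

/-! ### Cubes at the different kinds of places -/

variable {α : (tileSet X call).Assembly}

theorem Legit.row_eq (hα : Legit α) {y : Fin n} {t : Tile n V X}
    (h : α (site X (.row y)) = some ⟨t, false⟩) : t = .row y := by
  obtain ⟨P, h1, h2⟩ := hα.typed _ _ h
  cases site_injective X h1
  cases t <;> simp only [Typed] at h2
  rw [h2]

theorem Legit.ray_eq (hα : Legit α) {i : Fin n} {m : ℕ} {t : Tile n V X}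
    (h : α (site X (.ray i m)) = some ⟨t, false⟩) : ∃ x w, t = .ray i x (cap m) w := by
  obtain ⟨P, h1, h2⟩ := hα.typed _ _ h
  cases site_injective X h1
  cases t <;> simp only [Typed] at h2
  rw [← h2.1, h2.2]
  exact ⟨_, _, rfl⟩

theorem Legit.obj_eq (hα : Legit α) {m : Fin (2 * n + 1)} {t : Tile n V X}
    (h : α (site X (.obj m)) = some ⟨t, false⟩) : ∃ j v, t = .obj m j v ∧ j.val ≤ m.val := by
  obtain ⟨P, h1, h2⟩ := hα.typed _ _ h
  cases site_injective X h1
  cases t <;> simp only [Typed] at h2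
  obtain ⟨rfl, h2⟩ := h2
  exact ⟨_, _, rfl, h2⟩

omit [NeZero n] in
theorem fed_row {y y' : Fin n} (hy : y'.val = y.val + 1)
    (h : α (site X (.row y)) = some ⟨.row y, false⟩) : Fed α (site X (.row y')) (.row y') := by
  intro f hf
  simp only [inputs, Finset.mem_singleton] at hf
  subst hf
  refine ⟨.row y, ?_, rfl, hy⟩
  rw [← site_row_succ hy]
  exact (congrArg α (next_opposite .north _)).trans h

omit [NeZero n] in
theorem fed_ray_zero {i : Fin n} (x : V) (h : α (site X (.row i)) = some ⟨.row i, false⟩) :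
    Fed α (site X (.ray i 0)) (.ray i x (cap 0) none) := by
  intro f hf
  have hg : ¬ Gate (X := X) call i x (cap (X := X) 0).val := by
    rintro ⟨-, h⟩
    simp [cap] at h
  simp only [inputs, if_neg hg, Finset.mem_singleton] at hf
  subst hf
  refine ⟨.row i, ?_, rfl, rfl, by simp [cap], rfl⟩
  rw [← site_ray_zero]
  exact (congrArg α (next_opposite .east _)).trans h

omit [NeZero n] [Finite V] in
theorem gate_cap {i : Fin n} {x : V} {m : ℕ} :
    Gate (X := X) call i x (cap (X := X) m).val ↔ Gate (X := X) call i x m := by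
  unfold Gate
  apply and_congr_right
  intro _
  simp only [cap]
  omega

omit [NeZero n] in
theorem fed_ray_succ {i : Fin n} {m : ℕ} {x : V} {w : Option V}
    (h : α (site X (.ray i m)) = some ⟨.ray i x (cap m) w, false⟩)
    (hg : ¬ Gate (X := X) call i x (m + 1)) :
    Fed α (site X (.ray i (m + 1))) (.ray i x (cap (m + 1)) w) := by
  intro f hf
  rw [← gate_cap] at hg
  simp only [inputs, if_neg hg, Finset.mem_singleton] at hf
  subst hf
  refine ⟨.ray i x (cap m) w, ?_, rfl, rfl, rfl, ?_, fun h => (hg h).elim, fun _ => rfl⟩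
  · rw [← site_ray_succ]
    exact (congrArg α (next_opposite .east _)).trans h
  · simp only [cap]
    omega

/-- The number of the cube of the consensus object that gives the answer to process `i`. -/
def answerIndex (i : Fin n) : Fin (2 * n + 1) := ⟨2 * n - i.val, by omega⟩

-- The one place of cooperative binding: west and up contribute strength 1 each. The west input
-- demands an unanswered ray, and the upper one supplies the label `some v`.
omit [NeZero n] in
theorem fed_gate {i j : Fin n} {x v : V} (hc : call i x ≠ none)
    (h : α (site X (.ray i (X + 1))) = some ⟨.ray i x (cap (X + 1)) none, false⟩)
    (h' : α (site X (.obj (answerIndex i))) = some ⟨.obj (answerIndex i) j v, false⟩) :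
    Fed α (site X (.ray i (X + 2))) (.ray i x (cap (X + 2)) (some v)) := by
  intro f hf
  have hg : Gate (X := X) call i x (cap (X := X) (X + 2)).val := gate_cap.2 ⟨hc, rfl⟩
  simp only [inputs, if_pos hg, Finset.mem_insert, Finset.mem_singleton] at hf
  rcases hf with rfl | rfl
  · refine ⟨.ray i x (cap (X + 1)) none, ?_, rfl, rfl, rfl, ?_, fun _ => ⟨rfl, by simp⟩,
      fun h => (h hg).elim⟩
    · rw [← site_ray_succ]
      exact (congrArg α (next_opposite .east _)).trans h
    · simp only [cap]
      omega
  · have : (answerIndex i).val + i.val = 2 * n := by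
      simp only [answerIndex]
      omega
    refine ⟨.obj (answerIndex i) j v, ?_, rfl, hg, this, rfl⟩
    rw [← site_obj_high this]
    exact h'

omit [NeZero n] in
theorem fed_obj_self {j : Fin n} {m : Fin (2 * n + 1)} {x v : V} {w : Option V}
    (hm : m.val = j.val) (hc : call j x = some v)
    (h : α (site X (.ray j X)) = some ⟨.ray j x (cap X) w, false⟩) :
    Fed α (site X (.obj m)) (.obj m j v) := by
  intro f hf
  simp only [inputs, if_pos hm, Finset.mem_singleton] at hf
  subst hf
  refine ⟨.ray j x (cap X) w, ?_, rfl, by simp [cap], hm, rfl, hc⟩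
  rw [site_obj_low hm]
  exact (congrArg α (next_opposite .up _)).trans h

omit [NeZero n] in
theorem fed_obj_succ {j : Fin n} {m m' : Fin (2 * n + 1)} {v : V}
    (hm : m'.val = m.val + 1) (hj : j.val ≤ m.val)
    (h : α (site X (.obj m)) = some ⟨.obj m j v, false⟩) :
    Fed α (site X (.obj m')) (.obj m' j v) := by
  intro f hf
  have h1 : m'.val ≠ j.val := by omega
  simp only [inputs, if_neg h1, Finset.mem_singleton] at hf
  have h2 : m'.val - 1 = m.val := by omega
  rw [h2] at hf
  subst hf
  refine ⟨.obj m j v, ?_, opposite_opposite _, hm, hj, rfl, rfl⟩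
  rw [← site_obj_succ hm]
  exact (congrArg α (next_opposite _ _)).trans h

theorem Legit.ray_zero (hα : Legit α) {i : Fin n} {x : V} {k : Fin (X + 4)} {w : Option V}
    (h : α (site X (.ray i 0)) = some ⟨.ray i x k w, false⟩) : w = none := by
  obtain ⟨_, _, h0⟩ := hα.ray_eq h
  cases h0
  rcases hα.fed _ _ h with ⟨-, h1⟩ | h1
  · cases h1
  have hg : ¬ Gate (X := X) call i x (cap (X := X) 0).val := by
    rintro ⟨-, h⟩
    simp [cap] at h
  obtain ⟨s, hs, hs'⟩ := h1 .west (by simp only [inputs, if_neg hg, Finset.mem_singleton])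
  have hs2 : α (site X (.row i)) = some ⟨s, false⟩ := by
    rw [← hs, ← site_ray_zero]
    exact (congrArg α (next_opposite .east _)).symm
  rw [hα.row_eq hs2] at hs'
  exact hs'.2.2.2

/-- West is an input of every cube on a ray, gate or not, so the predecessor is present; the label
changes only at a gate. -/
theorem Legit.ray_pred (hα : Legit α) {i : Fin n} {m : ℕ} {x : V} {k : Fin (X + 4)}
    {w : Option V} (h : α (site X (.ray i (m + 1))) = some ⟨.ray i x k w, false⟩) :
    ∃ w', α (site X (.ray i m)) = some ⟨.ray i x (cap m) w', false⟩ ∧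
      (Gate (X := X) call i x (m + 1) → w' = none ∧ w ≠ none) ∧
      (¬ Gate (X := X) call i x (m + 1) → w = w') := by
  obtain ⟨_, _, h0⟩ := hα.ray_eq h
  cases h0
  rcases hα.fed _ _ h with ⟨-, h1⟩ | h1
  · cases h1
  obtain ⟨s, hs, hs'⟩ := h1 .west (by simp only [inputs]; split_ifs <;> simp)
  have hs2 : α (site X (.ray i m)) = some ⟨s, false⟩ := by
    rw [← hs, ← site_ray_succ]
    exact (congrArg α (next_opposite .east _)).symm
  obtain ⟨x', w', rfl⟩ := hα.ray_eq hs2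
  simp only [Feeds, gate_cap] at hs'
  obtain ⟨-, -, rfl, -, h2, h3⟩ := hs'
  exact ⟨w', hs2, h2, h3⟩

theorem Legit.gate (hα : Legit α) {i : Fin n} {x : V} {k : Fin (X + 4)} {w : Option V}
    (hc : call i x ≠ none)
    (h : α (site X (.ray i (X + 2))) = some ⟨.ray i x k w, false⟩) :
    ∃ j v, w = some v ∧
      α (site X (.obj (answerIndex i))) = some ⟨.obj (answerIndex i) j v, false⟩ := by
  obtain ⟨_, _, h0⟩ := hα.ray_eq h
  cases h0
  rcases hα.fed _ _ h with ⟨-, h1⟩ | h1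
  · cases h1
  have hg : Gate (X := X) call i x (cap (X := X) (X + 2)).val := gate_cap.2 ⟨hc, rfl⟩
  obtain ⟨s, hs, hs'⟩ := h1 .up (by simp only [inputs, if_pos hg]; simp)
  have : (answerIndex i).val + i.val = 2 * n := by
    simp only [answerIndex]
    omega
  have hs2 : α (site X (.obj (answerIndex i))) = some ⟨s, false⟩ := by
    rw [← hs, site_obj_high this]
  obtain ⟨j, v, rfl, -⟩ := hα.obj_eq hs2
  exact ⟨j, v, hs'.2.2.2, hs2⟩

/-- Where the number of the cube is that of its winner, the only input is the ray below: this is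
where a value enters the object. -/
theorem Legit.obj_self (hα : Legit α) {j : Fin n} {m : Fin (2 * n + 1)} {v : V}
    (hm : m.val = j.val) (h : α (site X (.obj m)) = some ⟨.obj m j v, false⟩) :
    ∃ x w, call j x = some v ∧ α (site X (.ray j X)) = some ⟨.ray j x (cap X) w, false⟩ := by
  rcases hα.fed _ _ h with ⟨-, h1⟩ | h1
  · cases h1
  obtain ⟨s, hs, hs'⟩ := h1 .down (by simp only [inputs, if_pos hm]; simp)
  have hs2 : α (site X (.ray j X)) = some ⟨s, false⟩ := by
    rw [← hs, site_obj_low hm]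
    exact (congrArg α (next_opposite .up _)).symm
  obtain ⟨x, w, rfl⟩ := hα.ray_eq hs2
  exact ⟨x, w, hs'.2.2.2.2, hs2⟩

theorem Legit.obj_pred (hα : Legit α) {j : Fin n} {m m' : Fin (2 * n + 1)} {v : V}
    (hm : m'.val = m.val + 1) (hj : m'.val ≠ j.val)
    (h : α (site X (.obj m')) = some ⟨.obj m' j v, false⟩) :
    α (site X (.obj m)) = some ⟨.obj m j v, false⟩ := by
  rcases hα.fed _ _ h with ⟨-, h1⟩ | h1
  · cases h1
  obtain ⟨s, hs, hs'⟩ := h1 (dir n m.val).opposite (by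
    have : m'.val - 1 = m.val := by omega
    simp only [inputs, if_neg hj, this]; simp)
  have hs2 : α (site X (.obj m)) = some ⟨s, false⟩ := by
    rw [← hs, ← site_obj_succ hm]
    exact (congrArg α (next_opposite _ _)).symm
  obtain ⟨j', v', rfl, -⟩ := hα.obj_eq hs2
  obtain ⟨-, -, -, rfl, rfl⟩ := hs'
  exact hs2

end

end ConsensusTiles
end TileConsensus

/-! ### Tracing cubes back to their causes, and what fair sequences must build. -/

namespace TileConsensus

open TileSet

namespace ConsensusTiles

section

variable {n : ℕ} {V : Type} {X : ℕ} {call : Fin n → V → Option V} [NeZero n] [Finite V]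
variable {α : (tileSet X call).Assembly}

/-! ### The causal past of a cube -/

theorem Legit.ray_prefix (hα : Legit α) {i : Fin n} {m m' : ℕ} (hm : m' ≤ m) {x : V}
    {k : Fin (X + 4)} {w : Option V} (h : α (site X (.ray i m)) = some ⟨.ray i x k w, false⟩) :
    ∃ w', α (site X (.ray i m')) = some ⟨.ray i x (cap m') w', false⟩ := by
  induction m generalizing k w with
  | zero =>
    obtain rfl : m' = 0 := by omega
    obtain ⟨_, _, h0⟩ := hα.ray_eq h
    cases h0
    exact ⟨w, h⟩
  | succ m ih =>
    rcases Nat.lt_or_ge m m' with h1 | h1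
    · obtain rfl : m' = m + 1 := by omega
      obtain ⟨_, _, h0⟩ := hα.ray_eq h
      cases h0
      exact ⟨w, h⟩
    · obtain ⟨w', h2, -⟩ := hα.ray_pred h
      exact ih h1 h2

theorem Legit.ray_unanswered (hα : Legit α) {i : Fin n} {m : ℕ} {x : V}
    {k : Fin (X + 4)} {w : Option V} (h : α (site X (.ray i m)) = some ⟨.ray i x k w, false⟩)
    (hm : ¬ (call i x ≠ none ∧ X + 2 ≤ m)) : w = none := by
  induction m generalizing k w with
  | zero => exact hα.ray_zero h
  | succ m ih =>
    obtain ⟨w', h1, -, h2⟩ := hα.ray_pred h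
    rw [h2 fun hg => hm ⟨hg.1, hg.2.ge⟩]
    exact ih h1 fun h3 => hm ⟨h3.1, by omega⟩

theorem Legit.ray_answered (hα : Legit α) {i : Fin n} {m m' : ℕ} (hm' : X + 2 ≤ m')
    (hm : m' ≤ m) {x : V} {k : Fin (X + 4)} {w : Option V}
    (h : α (site X (.ray i m)) = some ⟨.ray i x k w, false⟩) :
    α (site X (.ray i m')) = some ⟨.ray i x (cap m') w, false⟩ := by
  induction m, hm using Nat.le_induction generalizing k with
  | base =>
    obtain ⟨_, _, h0⟩ := hα.ray_eq h
    cases h0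
    exact h
  | succ m hm ih =>
    obtain ⟨w', h1, -, h2⟩ := hα.ray_pred h
    rw [← h2 fun hg => by have := hg.2; omega] at h1
    exact ih h1

/-- A cube labelled `j` with number above `j` can only have been fed along the path, with the same
label; so the label is found all the way back to number `j`. -/
theorem Legit.obj_prefix (hα : Legit α) {j : Fin n} {m m' : Fin (2 * n + 1)} {v : V}
    (hm : m'.val ≤ m.val) (hj : j.val ≤ m'.val)
    (h : α (site X (.obj m)) = some ⟨.obj m j v, false⟩) :
    α (site X (.obj m')) = some ⟨.obj m' j v, false⟩ := by
  obtain ⟨N, hN⟩ := m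
  simp only at hm
  induction N, hm using Nat.le_induction with
  | base => exact h
  | succ N hm ih =>
    refine ih (by omega) (hα.obj_pred (m := ⟨N, by omega⟩) rfl ?_ h)
    simp only [ne_eq]
    omega

/-- The number of a cube of the consensus object at which the winner is certain. -/
def decisionIndex (n : ℕ) : Fin (2 * n + 1) := ⟨n, by omega⟩

/-- The assembly contains the winner of the consensus object. -/
def Decided (α : (tileSet X call).Assembly) (j : Fin n) (v : V) : Prop :=
  α (site X (.obj (decisionIndex n))) = some ⟨.obj (decisionIndex n) j v, false⟩

/-- Rays enter the object at numbers below `n` only, so no label can change from number `n` on. -/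
theorem Legit.decided (hα : Legit α) {j : Fin n} {v : V} {m : Fin (2 * n + 1)} (hm : n ≤ m.val)
    (h : α (site X (.obj m)) = some ⟨.obj m j v, false⟩) : Decided α j v :=
  hα.obj_prefix (m' := decisionIndex n) hm j.2.le h

-- One site holds one cube; agreement rests on nothing else.
omit [NeZero n] in
theorem Decided.unique {j j' : Fin n} {v v' : V} (h : Decided α j v) (h' : Decided α j' v') :
    j = j' ∧ v = v' := by
  unfold Decided at h h'
  rw [h] at h'
  cases h'
  exact ⟨rfl, rfl⟩

omit [NeZero n] in
theorem Decided.mono {β : (tileSet X call).Assembly} {j : Fin n} {v : V} (h : Decided α j v)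
    (hs : Sub α β) : Decided β j v := hs.eq_some h

/-- The winner of the consensus object has been proposed. -/
theorem Legit.proposed (hα : Legit α) {j : Fin n} {v : V} (h : Decided α j v) :
    ∃ x w, call j x = some v ∧ α (site X (.ray j X)) = some ⟨.ray j x (cap X) w, false⟩ :=
  hα.obj_self (m := ⟨j.val, by omega⟩) rfl
    (hα.obj_prefix (m := decisionIndex n) j.2.le le_rfl h)

omit [NeZero n] in
theorem n_le_answerIndex (i : Fin n) : n ≤ (answerIndex i).val := by
  simp only [answerIndex]
  omega

/-- The answer that a process has got is the value of the winner. -/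
theorem Legit.answer (hα : Legit α) {i : Fin n} {m : ℕ} (hm : X + 2 ≤ m) {x : V}
    {k : Fin (X + 4)} {w : Option V} (hc : call i x ≠ none)
    (h : α (site X (.ray i m)) = some ⟨.ray i x k w, false⟩) :
    ∃ j v, w = some v ∧ Decided α j v := by
  obtain ⟨j, v, h1, h2⟩ := hα.gate hc (hα.ray_answered le_rfl hm h)
  exact ⟨j, v, h1, hα.decided (n_le_answerIndex i) h2⟩

/-! ### What must grow -/

variable {a : ℕ → (tileSet X call).Assembly}

theorem legit_of_fair (h : IsFairSequence (Move (object n X)) α a) (hα : Legit α) (k : ℕ) :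
    Legit (a k) :=
  hα.growsWithin (h.reaches k)

-- Fairness fills the site, though not necessarily with `t`; in the absence of blockages whatever
-- arrives is bound correctly.
omit [NeZero n] in
theorem eventually_sound (h : IsFairSequence (Move (object n X)) α a) {p : Site}
    {t : Tile n V X} {k : ℕ} (hfed : Fed (a k) p t) (hbl : ∀ k, ¬ Blocked (a k) p) :
    ∃ k' ≥ k, Sound (a k') p := by
  obtain ⟨k', hk', hne⟩ : ∃ k' ≥ k, a k' p ≠ none := by
    by_cases hp : a k p = none
    · exact h.fair k p ⟨hp, t, hfed.pull⟩
    · exact ⟨k, le_rfl, hp⟩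
  obtain ⟨⟨s, b⟩, hs⟩ := Option.ne_none_iff_exists'.1 hne
  cases b with
  | true => exact (hbl k' ⟨s, hs⟩).elim
  | false => exact ⟨k', hk', s, hs⟩

theorem not_blocked_row (h : IsFairSequence (Move (object n X)) α a) (hα : Legit α) (y : Fin n)
    (k : ℕ) : ¬ Blocked (a k) (site X (.row y)) := by
  intro hb
  obtain ⟨i, m, hp⟩ := (legit_of_fair h hα k).blocked _ hb
  cases site_injective X hp

theorem not_blocked_obj (h : IsFairSequence (Move (object n X)) α a) (hα : Legit α)
    (m : Fin (2 * n + 1)) (k : ℕ) : ¬ Blocked (a k) (site X (.obj m)) := by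
  intro hb
  obtain ⟨i, m, hp⟩ := (legit_of_fair h hα k).blocked _ hb
  cases site_injective X hp

theorem eventually_row (h : IsFairSequence (Move (object n X)) α a) (hα : Legit α) (y : Fin n) :
    ∃ k, a k (site X (.row y)) = some ⟨.row y, false⟩ := by
  obtain ⟨y, hy⟩ := y
  induction y with
  | zero =>
    refine ⟨0, ?_⟩
    rw [h.start]
    exact hα.seed
  | succ y ih =>
    obtain ⟨k, hk⟩ := ih (by omega)
    obtain ⟨k', -, t, ht⟩ := eventually_sound h (fed_row (y' := ⟨y + 1, hy⟩) rfl hk)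
      (not_blocked_row h hα _)
    have := (legit_of_fair h hα k').row_eq ht
    exact ⟨k', by rw [ht, this]⟩

/-- It is open which winner takes the next site, but whatever cube stands at one number can feed the
next, and nothing is ever blocked in the object. -/
theorem eventually_obj (h : IsFairSequence (Move (object n X)) α a) (hα : Legit α)
    {m m' : Fin (2 * n + 1)} (hm : m.val ≤ m'.val) {k : ℕ}
    (hk : Sound (a k) (site X (.obj m))) :
    ∃ k' ≥ k, Sound (a k') (site X (.obj m')) := by
  obtain ⟨N, hN⟩ := m'
  simp only at hm
  induction N, hm using Nat.le_induction with
  | base => exact ⟨k, le_rfl, hk⟩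
  | succ N hm ih =>
    obtain ⟨k₁, hk₁, t, ht⟩ := ih (by omega)
    obtain ⟨j, v, rfl, hj⟩ := (legit_of_fair h hα k₁).obj_eq ht
    obtain ⟨k₂, hk₂, hs⟩ := eventually_sound h
      (fed_obj_succ (m' := ⟨N + 1, hN⟩) rfl hj ht) (not_blocked_obj h hα _)
    exact ⟨k₂, hk₁.le.trans hk₂, hs⟩

/-- Whoever has invoked the consensus object will find it answering. -/
theorem eventually_answer (h : IsFairSequence (Move (object n X)) α a) (hα : Legit α)
    {i : Fin n} {x v : V} {w : Option V} (hc : call i x = some v) {k : ℕ}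
    (hk : a k (site X (.ray i X)) = some ⟨.ray i x (cap X) w, false⟩) (i' : Fin n) :
    ∃ k' ≥ k, ∃ j v', a k' (site X (.obj (answerIndex i'))) =
      some ⟨.obj (answerIndex i') j v', false⟩ := by
  have hi : i.val < 2 * n + 1 := by omega
  obtain ⟨k₁, hk₁, hs⟩ := eventually_sound h
    (fed_obj_self (m := ⟨i.val, hi⟩) rfl hc hk) (not_blocked_obj h hα _)
  obtain ⟨k₂, hk₂, t, ht⟩ := eventually_obj h hα (m' := answerIndex i')
    (i.2.le.trans (n_le_answerIndex i')) hs
  obtain ⟨j, v', rfl, -⟩ := (legit_of_fair h hα k₂).obj_eq ht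
  exact ⟨k₂, hk₁.le.trans hk₂, j, v', ht⟩

/-- A process that is not hit by a blockage never stops. -/
theorem eventually_ray [Nonempty V] (h : IsFairSequence (Move (object n X)) α a) (hα : Legit α)
    {i : Fin n} (hbl : ∀ k m, ¬ Blocked (a k) (site X (.ray i m))) (m : ℕ) :
    ∃ k, Sound (a k) (site X (.ray i m)) := by
  induction m with
  | zero =>
    obtain ⟨k, hk⟩ := eventually_row h hα i
    obtain ⟨k', -, hs⟩ := eventually_sound h (fed_ray_zero (Classical.arbitrary V) hk)
      (fun k => hbl k 0)
    exact ⟨k', hs⟩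
  | succ m ih =>
    obtain ⟨k, t, ht⟩ := ih
    obtain ⟨x, w, rfl⟩ := (legit_of_fair h hα k).ray_eq ht
    by_cases hg : Gate (X := X) call i x (m + 1)
    · obtain ⟨hc, hm⟩ := hg
      obtain rfl : m = X + 1 := by omega
      obtain ⟨v, hv⟩ := Option.ne_none_iff_exists'.1 hc
      have hw := (legit_of_fair h hα k).ray_unanswered ht (by omega)
      subst hw
      -- A ray in front of its gate has passed `X`, so its own call has already set the object
      -- going.
      obtain ⟨w', hw'⟩ := (legit_of_fair h hα k).ray_prefix (Nat.le_succ X) ht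
      obtain ⟨k₁, hk₁, j, v', h1⟩ := eventually_answer h hα hv hw' i
      obtain ⟨k₂, -, hs⟩ := eventually_sound h (fed_gate hc ((h.sub hk₁).eq_some ht) h1)
        (fun k => hbl k _)
      exact ⟨k₂, hs⟩
    · obtain ⟨k', -, hs⟩ := eventually_sound h (fed_ray_succ ht hg) (fun k => hbl k _)
      exact ⟨k', hs⟩

/-! ### The tile assembly system -/

/-- The seed is a single cube. -/
def seedAssembly (n : ℕ) [NeZero n] (V : Type) (X : ℕ) : Site → Option (Cube (Tile n V X)) :=
  Function.update (fun _ => none) (site X (.row (0 : Fin n))) (some ⟨.row 0, false⟩)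

omit [Finite V] in
theorem seedAssembly_eq {p : Site} {c : Cube (Tile n V X)} (h : seedAssembly n V X p = some c) :
    p = site X (.row (0 : Fin n)) ∧ c = ⟨.row 0, false⟩ := by
  unfold seedAssembly at h
  by_cases hp : p = site X (.row (0 : Fin n))
  · subst hp
    rw [Function.update_self] at h
    exact ⟨rfl, (Option.some.inj h).symm⟩
  · rw [Function.update_of_ne hp] at h
    cases h

omit [Finite V] in
theorem seedAssembly_finite : {p | seedAssembly n V X p ≠ none}.Finite := by
  refine (Set.finite_singleton (site X (.row (0 : Fin n)))).subset fun p hp => ?_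
  obtain ⟨c, hc⟩ := Option.ne_none_iff_exists'.1 hp
  exact (seedAssembly_eq hc).1

/-- The tile assembly system. -/
noncomputable abbrev cubeSystem (X : ℕ) (call : Fin n → V → Option V) : CubeSystem where
  toTileSet := tileSet X call
  seed := seedAssembly n V X
  seed_finite := seedAssembly_finite
  seed_nonempty := ⟨site X (.row (0 : Fin n)), by simp [seedAssembly]⟩
  seed_correct := by
    rintro p ⟨t, h⟩
    have := (seedAssembly_eq h).2
    simp at this
  seed_stable := by
    -- No cut separates a single cube.
    rintro S ⟨p, hp, t, ht⟩ ⟨q, hq, s, hs⟩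
    rw [(seedAssembly_eq ht).1] at hp
    rw [(seedAssembly_eq hs).1] at hq
    exact (hq hp).elim

theorem legit_seed : Legit (cubeSystem X call).seed where
  seed := by simp [seedAssembly]
  fed p t h := Or.inl ⟨(seedAssembly_eq h).1, congrArg Cube.tile (seedAssembly_eq h).2⟩
  typed p t h := by
    obtain ⟨h1, h2⟩ := seedAssembly_eq h
    obtain rfl : t = .row 0 := congrArg Cube.tile h2
    exact ⟨_, h1, rfl⟩
  blocked := by
    rintro p ⟨t, h⟩
    have := (seedAssembly_eq h).2
    simp at this
  finite := seedAssembly_finite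

end

end ConsensusTiles
end TileConsensus

/-! ### Processes as functions of input, answer and time. -/

namespace TileConsensus

namespace System

variable {n : ℕ} {V : Type} (M : System.{u} n V)

/-! ### The life of a process -/

/-- The next state of a process that gets the answer `w` if it is waiting. -/
def advance (i : Fin n) (w : V) (q : LocalState (M i).State V) : LocalState (M i).State V :=
  match q.control with
  | .running s =>
    match (M i).act s with
    | .compute s' => { q with clock := q.clock + 1, control := .running s' }
    | .invoke v resume =>
      { q with
        clock := q.clock + 1, control := .waiting resume, calls := q.calls + 1, proposal := some v }
    | .halt => q
  | .waiting resume =>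
    { q with clock := q.clock + 1, control := .running (resume w), decision := some w }

/-- The state of a process after `k` events if the consensus object answers `w`. -/
def run (i : Fin n) (x w : V) (k : ℕ) : LocalState (M i).State V :=
  (M.advance i w)^[k]
    { input := x, clock := 0, control := .running ((M i).init x), calls := 0,
      proposal := none, decision := none, crashed := false }

theorem run_succ (i : Fin n) (x w : V) (k : ℕ) :
    M.run i x w (k + 1) = M.advance i w (M.run i x w k) :=
  Function.iterate_succ_apply' _ _ _

/-- The process waits for the answer of the consensus object. -/
def Waiting {S : Type u} (q : LocalState S V) : Prop := ∃ resume, q.control = .waiting resume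

theorem advance_of_not_waiting {i : Fin n} {q : LocalState (M i).State V} (h : ¬ Waiting q)
    (w w' : V) : M.advance i w q = M.advance i w' q := by
  unfold advance
  cases hq : q.control with
  | running s => rfl
  | waiting r => exact (h ⟨r, hq⟩).elim

/-- The crash flag plays no part in the computation, so `run`, which knows no crashes, also
describes crashed processes. -/
theorem advance_crashed (i : Fin n) (w : V) (q : LocalState (M i).State V) (b : Bool) :
    M.advance i w { q with crashed := b } = { M.advance i w q with crashed := b } := by
  unfold advance
  cases hq : q.control with
  | running s => cases hs : (M i).act s <;> simp [hs, hq]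
  | waiting r => simp

/-- The answer is consulted only when a waiting process resumes. -/
theorem run_congr {i : Fin n} {x w : V} {k : ℕ} (h : ∀ m < k, ¬ Waiting (M.run i x w m)) (w' : V) :
    M.run i x w' k = M.run i x w k := by
  induction k with
  | zero => rfl
  | succ k ih =>
    rw [run_succ, run_succ, ih fun m hm => h m (by omega)]
    exact M.advance_of_not_waiting (h k (by omega)) _ _

variable [Nonempty V]

/-- The process invokes the consensus object if it is started on `x`. -/
def Calls (i : Fin n) (x : V) : Prop := ∃ m, Waiting (M.run i x (Classical.arbitrary V) m)

/-- The number of events of the process up to its call of the consensus object. -/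
noncomputable def callTime (i : Fin n) (x : V) : ℕ :=
  sInf {m | Waiting (M.run i x (Classical.arbitrary V) m)}

open Classical in
/-- The value with which the process invokes the consensus object. -/
noncomputable def call (i : Fin n) (x : V) : Option V :=
  if M.Calls i x then (M.run i x (Classical.arbitrary V) (M.callTime i x)).proposal else none

variable {M}

theorem Calls.waiting {i : Fin n} {x : V} (h : M.Calls i x) :
    Waiting (M.run i x (Classical.arbitrary V) (M.callTime i x)) :=
  Nat.sInf_mem (s := {m | Waiting (M.run i x (Classical.arbitrary V) m)}) h

theorem callTime_le {i : Fin n} {x : V} {m : ℕ}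
    (h : Waiting (M.run i x (Classical.arbitrary V) m)) : M.callTime i x ≤ m :=
  Nat.sInf_le h

/-- Up to the first wait the answer does not matter, so the arbitrary answer used in `callTime` and
`call` is harmless. -/
theorem run_callTime (i : Fin n) (x w : V) :
    M.run i x w (M.callTime i x) = M.run i x (Classical.arbitrary V) (M.callTime i x) :=
  M.run_congr (fun _ hm h => absurd (callTime_le h) (by omega)) w

omit [Nonempty V] in
theorem proposal_of_waiting (i : Fin n) (x w : V) (k : ℕ) (h : Waiting (M.run i x w k)) :
    (M.run i x w k).proposal ≠ none := by
  cases k with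
  | zero =>
    obtain ⟨r, h⟩ := h
    cases h
  | succ k =>
    rw [run_succ] at h ⊢
    obtain ⟨r, h⟩ := h
    unfold advance at h ⊢
    cases hq : (M.run i x w k).control with
    | waiting r => simp [hq] at h
    | running s =>
      cases hs : (M i).act s <;> simp_all

theorem call_ne_none {i : Fin n} {x : V} : M.call i x ≠ none ↔ M.Calls i x := by
  unfold call
  split_ifs with h
  · simp only [h, iff_true]
    exact proposal_of_waiting _ _ _ _ h.waiting
  · simp [h]

theorem callTime_pos {i : Fin n} {x : V} (h : M.Calls i x) : 0 < M.callTime i x := by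
  rw [Nat.pos_iff_ne_zero]
  intro h0
  obtain ⟨r, hr⟩ := h.waiting
  rw [h0] at hr
  cases hr

/-- The shape of the states of a process in legal executions. -/
structure LocallyLegal (i : Fin n) (q : LocalState (M i).State V) : Prop where
  eq_run : q = { M.run i q.input (q.decision.getD (Classical.arbitrary V)) q.clock with
    crashed := q.crashed }
  early : q.decision = none → M.Calls i q.input → q.clock ≤ M.callTime i q.input
  late : q.decision ≠ none → M.Calls i q.input ∧ M.callTime i q.input < q.clock
  waiting_iff : Waiting q ↔ M.Calls i q.input ∧ q.clock = M.callTime i q.input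
  proposal_of_le : M.Calls i q.input → M.callTime i q.input ≤ q.clock →
    q.proposal = M.call i q.input ∧ 0 < q.calls
  proposal_of_not : ¬ (M.Calls i q.input ∧ M.callTime i q.input ≤ q.clock) → q.proposal = none

theorem locallyLegal_initial (i : Fin n) (x : V) : LocallyLegal i
    { input := x, clock := 0, control := .running ((M i).init x), calls := 0,
      proposal := none, decision := none, crashed := false } where
  eq_run := rfl
  early _ _ := Nat.zero_le _
  late h := (h rfl).elim
  waiting_iff := by
    constructor
    · rintro ⟨r, h⟩
      cases h
    · rintro ⟨h, h0⟩
      exact absurd h0.symm (callTime_pos h).ne'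
  proposal_of_le h h0 := by
    exact absurd (Nat.le_zero.1 h0) (callTime_pos h).ne'
  proposal_of_not _ := rfl

theorem LocallyLegal.crash {i : Fin n} {q : LocalState (M i).State V} (h : LocallyLegal i q)
    (b : Bool) : LocallyLegal i { q with crashed := b } where
  eq_run := by
    have := h.eq_run
    generalize M.run i q.input (q.decision.getD (Classical.arbitrary V)) q.clock = r at this ⊢
    rw [this]
  early := h.early
  late := h.late
  waiting_iff := h.waiting_iff
  proposal_of_le := h.proposal_of_le
  proposal_of_not := h.proposal_of_not

theorem LocallyLegal.eq_advance {i : Fin n} {q : LocalState (M i).State V}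
    (h : LocallyLegal i q) (w : V) (hw : w = q.decision.getD (Classical.arbitrary V)) :
    M.advance i w q = { M.run i q.input w (q.clock + 1) with crashed := q.crashed } := by
  subst hw
  rw [run_succ, ← advance_crashed, ← h.eq_run]

/-- The process runs before and after this step, whereas it waits at `callTime`; so the clock
neither leaves nor reaches that value. -/
theorem LocallyLegal.compute {i : Fin n} {q : LocalState (M i).State V} (h : LocallyLegal i q)
    {s s' : (M i).State} (hs : q.control = .running s) (hact : (M i).act s = .compute s') :
    LocallyLegal i { q with clock := q.clock + 1, control := .running s' } := by
  have hnw : ¬ Waiting q := by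
    rintro ⟨r, hr⟩
    rw [hs] at hr
    cases hr
  have hadv := h.eq_advance _ rfl
  have hq' : M.advance i (q.decision.getD (Classical.arbitrary V)) q =
      { q with clock := q.clock + 1, control := .running s' } := by
    simp [advance, hs, hact]
  rw [hq'] at hadv
  have hne : M.Calls i q.input → q.clock ≠ M.callTime i q.input :=
    fun h1 h2 => hnw (h.waiting_iff.2 ⟨h1, h2⟩)
  have hne' : M.Calls i q.input → q.clock + 1 ≠ M.callTime i q.input := by
    intro h1 h2
    by_cases hd : q.decision = none
    · rw [hd, Option.getD_none, h2] at hadv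
      obtain ⟨r, hr⟩ := h1.waiting
      have := congrArg LocalState.control hadv
      simp only [hr] at this
      cases this
    · have := (h.late hd).2
      omega
  refine ⟨hadv, ?_, ?_, ?_, ?_, ?_⟩
  · intro h1 h2
    have := h.early h1 h2
    have := hne h2
    simp only
    omega
  · intro h1
    exact ⟨(h.late h1).1, (h.late h1).2.trans (Nat.lt_succ_self _)⟩
  · constructor
    · rintro ⟨r, hr⟩
      cases hr
    · rintro ⟨h1, h2⟩
      exact (hne' h1 h2).elim
  · intro h1 h2
    have := hne' h1
    exact h.proposal_of_le h1 (by simp only at h2; omega)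
  · intro h1
    apply h.proposal_of_not
    rintro ⟨h2, h3⟩
    exact h1 ⟨h2, h3.trans (Nat.le_succ _)⟩

/-- Without an earlier call the clock is still below `callTime`. The new state waits, so `callTime`
is at most the new clock. Hence the two agree, and the proposed value is `call`. -/
theorem LocallyLegal.invoke {i : Fin n} {q : LocalState (M i).State V} (h : LocallyLegal i q)
    {s : (M i).State} {v : V} {r : V → (M i).State} (hs : q.control = .running s)
    (hact : (M i).act s = .invoke v r) (hcalls : q.calls = 0) :
    LocallyLegal i { q with
      clock := q.clock + 1, control := .waiting r, calls := q.calls + 1, proposal := some v } := by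
  have hnot : ¬ (M.Calls i q.input ∧ M.callTime i q.input ≤ q.clock) := by
    rintro ⟨h1, h2⟩
    have := (h.proposal_of_le h1 h2).2
    omega
  have hd : q.decision = none := by
    by_contra hd
    exact hnot ⟨(h.late hd).1, (h.late hd).2.le⟩
  have hadv := h.eq_advance _ rfl
  have hq' : M.advance i (q.decision.getD (Classical.arbitrary V)) q = { q with
      clock := q.clock + 1, control := .waiting r, calls := q.calls + 1, proposal := some v } := by
    simp [advance, hs, hact]
  rw [hq'] at hadv
  have hadv' := hadv
  rw [hd, Option.getD_none] at hadv'
  have hw : Waiting (M.run i q.input (Classical.arbitrary V) (q.clock + 1)) :=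
    ⟨r, (congrArg LocalState.control hadv').symm⟩
  have hC : M.Calls i q.input := ⟨_, hw⟩
  have htime : q.clock + 1 = M.callTime i q.input := by
    have := callTime_le hw
    by_contra hne
    exact hnot ⟨hC, by omega⟩
  refine ⟨hadv, ?_, ?_, ?_, ?_, ?_⟩
  · exact fun _ _ => htime.le
  · exact fun h1 => (h1 hd).elim
  · exact ⟨fun _ => ⟨hC, htime⟩, fun _ => ⟨r, rfl⟩⟩
  · intro _ _
    refine ⟨?_, Nat.succ_pos _⟩
    simp only [call, if_pos hC, ← htime]
    exact congrArg LocalState.proposal hadv'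
  · exact fun h1 => (h1 ⟨hC, htime.ge⟩).elim

/-- The actual answer enters the description here: the runs for all answers coincide up to
`callTime`, so the arbitrary answer can be exchanged for `w`. -/
theorem LocallyLegal.respond {i : Fin n} {q : LocalState (M i).State V} (h : LocallyLegal i q)
    {r : V → (M i).State} (hs : q.control = .waiting r) (w : V) :
    LocallyLegal i { q with
      clock := q.clock + 1, control := .running (r w), decision := some w } := by
  obtain ⟨hC, htime⟩ := h.waiting_iff.1 ⟨r, hs⟩
  have hd : q.decision = none := by
    by_contra hd
    have := (h.late hd).2
    omega
  have hq' : M.advance i w q = { q with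
      clock := q.clock + 1, control := .running (r w), decision := some w } := by
    simp [advance, hs]
  have hq : q = { M.run i q.input w q.clock with crashed := q.crashed } := by
    have := h.eq_run
    rw [hd, Option.getD_none, htime, ← run_callTime i q.input w, ← htime] at this
    exact this
  have hadv : M.advance i w q = { M.run i q.input w (q.clock + 1) with crashed := q.crashed } := by
    rw [run_succ, ← advance_crashed, ← hq]
  rw [hq'] at hadv
  refine ⟨hadv, ?_, ?_, ?_, ?_, ?_⟩
  · intro h1
    cases h1
  · intro _
    exact ⟨hC, by simp only; omega⟩
  · constructor
    · rintro ⟨r, hr⟩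
      cases hr
    · rintro ⟨-, h2⟩
      simp only at h2
      omega
  · exact fun h1 _ => h.proposal_of_le h1 htime.ge
  · intro h1
    exact (h1 ⟨hC, by simp only; omega⟩).elim

theorem LocallyLegal.decision_of_lt {i : Fin n} {q : LocalState (M i).State V}
    (h : LocallyLegal i q) (hC : M.Calls i q.input) (ht : M.callTime i q.input < q.clock) :
    q.decision ≠ none := by
  intro hd
  have := h.early hd hC
  omega

/-! ### Legal configurations -/

/-- The shape of the configurations in legal executions. -/
structure Legal (C : M.Config) : Prop where
  proc : ∀ i, LocallyLegal i (C.proc i)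
  request : ∀ i, C.obj.request i = (C.proc i).proposal
  answered : ∀ i w, (C.proc i).decision = some w → ∃ j, C.obj.chosen = some (j, w)
  proposed : ∀ j w, C.obj.chosen = some (j, w) → (C.proc j).proposal = some w
  decided : C.obj.chosen ≠ none → ∃ i, (C.proc i).decision ≠ none
  crashes : (Finset.univ.filter fun j => (C.proc j).crashed = true).card < n

omit [Nonempty V] in
theorem Reachable.step {C C' : M.Config} {e : Event n} (h : M.Reachable C) (hs : M.Step C e C') :
    M.Reachable C' := by
  obtain ⟨x, hx⟩ := h
  exact ⟨x, hx.tail ⟨e, hs⟩⟩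

omit [Nonempty V] in
theorem reachable_initial (x : Fin n → V) : M.Reachable (M.initial x) :=
  ⟨x, Relation.ReflTransGen.refl⟩

theorem legal_initial (hn : 0 < n) (x : Fin n → V) : Legal (M.initial x) where
  proc i := locallyLegal_initial i (x i)
  request _ := rfl
  answered _ _ h := by cases h
  proposed _ _ h := by cases h
  decided h := (h rfl).elim
  crashes := by simpa [initial] using hn

omit [Nonempty V] in
theorem crashed_update (C : M.Config) (i : Fin n) (q : LocalState (M i).State V)
    (h : q.crashed = (C.proc i).crashed) (j : Fin n) :
    (Function.update C.proc i q j).crashed = (C.proc j).crashed := by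
  by_cases hj : j = i
  · subst hj
    simpa using h
  · simp [hj]

theorem Legal.step (hcalls : M.InvokesAtMostOnce) {C C' : M.Config} {e : Event n}
    (hC : M.Reachable C) (h : Legal C) (hs : M.Step C e C') : Legal C' := by
  have hC' := hC.step hs
  cases hs with
  | compute i s s' hlive hs hact =>
    have hdec : ∀ j, (Function.update C.proc i { C.proc i with
        clock := (C.proc i).clock + 1, control := .running s' } j).decision =
        (C.proc j).decision := by
      intro j
      by_cases hj : j = i
      · subst hj; simp
      · simp [hj]
    have hprop : ∀ j, (Function.update C.proc i { C.proc i with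
        clock := (C.proc i).clock + 1, control := .running s' } j).proposal =
        (C.proc j).proposal := by
      intro j
      by_cases hj : j = i
      · subst hj; simp
      · simp [hj]
    refine ⟨?_, ?_, ?_, ?_, ?_, ?_⟩
    · intro j
      by_cases hj : j = i
      · subst hj
        simpa [Config.setProc] using (h.proc j).compute hs hact
      · simpa [Config.setProc, hj] using h.proc j
    · intro j
      simp only [Config.setProc, hprop]
      exact h.request j
    · intro j w
      simp only [Config.setProc, hdec]
      exact h.answered j w
    · intro j w
      simp only [Config.setProc, hprop]
      exact h.proposed j w
    · simp only [Config.setProc, hdec]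
      exact h.decided
    · simp only [Config.setProc, crashed_update C i { C.proc i with
        clock := (C.proc i).clock + 1, control := .running s' } rfl]
      exact h.crashes
  | invoke i s v r hlive hs hact =>
    -- The bound on calls, applied to the successor, leaves no earlier call.
    have hzero : (C.proc i).calls = 0 := by
      have := hcalls _ hC' i
      simp only [Function.update_self] at this
      omega
    have hlocal := (h.proc i).invoke hs hact hzero
    -- A winner has already proposed, so the caller is not the winner and `proposed` is not
    -- disturbed.
    have hnone : (C.proc i).proposal = none := by
      apply (h.proc i).proposal_of_not
      rintro ⟨h1, h2⟩
      have := ((h.proc i).proposal_of_le h1 h2).2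
      omega
    have hdec : ∀ j, (Function.update C.proc i { C.proc i with
        clock := (C.proc i).clock + 1, control := .waiting r, calls := (C.proc i).calls + 1,
        proposal := some v } j).decision = (C.proc j).decision := by
      intro j
      by_cases hj : j = i
      · subst hj; simp
      · simp [hj]
    refine ⟨?_, ?_, ?_, ?_, ?_, ?_⟩
    · intro j
      by_cases hj : j = i
      · subst hj
        simpa using hlocal
      · simpa [hj] using h.proc j
    · intro j
      by_cases hj : j = i
      · subst hj
        simp
      · simpa [hj] using h.request j
    · intro j w
      simp only [hdec]
      exact h.answered j w
    · intro j w hw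
      have := h.proposed j w hw
      by_cases hj : j = i
      · subst hj
        rw [hnone] at this
        cases this
      · simpa [hj] using this
    · simp only [hdec]
      exact h.decided
    · simp only [crashed_update C i { C.proc i with
        clock := (C.proc i).clock + 1, control := .waiting r, calls := (C.proc i).calls + 1,
        proposal := some v } rfl]
      exact h.crashes
  | respond i j w r hlive hs hw =>
    have hprop : ∀ j, (Function.update C.proc i { C.proc i with
        clock := (C.proc i).clock + 1, control := .running (r w), decision := some w } j).proposal =
        (C.proc j).proposal := by
      intro j
      by_cases hj : j = i
      · subst hj; simp
      · simp [hj]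
    refine ⟨?_, ?_, ?_, ?_, ?_, ?_⟩
    · intro j
      by_cases hj : j = i
      · subst hj
        simpa using (h.proc j).respond hs w
      · simpa [hj] using h.proc j
    · intro j
      simp only [hprop]
      exact h.request j
    · intro k w' hk
      by_cases hki : k = i
      · subst hki
        simp only [Function.update_self] at hk
        cases hk
        exact ⟨j, rfl⟩
      · simp only [Function.update_of_ne hki] at hk
        obtain ⟨j', hj'⟩ := h.answered k w' hk
        rcases hw with hw | ⟨hw, -⟩
        · rw [hw] at hj'
          cases hj'
          exact ⟨j, rfl⟩
        · rw [hw] at hj'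
          cases hj'
    · intro j' w' hj'
      simp only at hj'
      cases hj'
      simp only [hprop]
      rcases hw with hw | ⟨-, hw⟩
      · exact h.proposed j w hw
      · rw [← h.request j, hw]
    · intro _
      exact ⟨i, by simp⟩
    · simp only [crashed_update C i { C.proc i with
        clock := (C.proc i).clock + 1, control := .running (r w), decision := some w } rfl]
      exact h.crashes
  | crash i hlive hcount =>
    have hdec : ∀ j, (Function.update C.proc i { C.proc i with crashed := true } j).decision =
        (C.proc j).decision := by
      intro j
      by_cases hj : j = i
      · subst hj; simp
      · simp [hj]
    have hprop : ∀ j, (Function.update C.proc i { C.proc i with crashed := true } j).proposal =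
        (C.proc j).proposal := by
      intro j
      by_cases hj : j = i
      · subst hj; simp
      · simp [hj]
    refine ⟨?_, ?_, ?_, ?_, ?_, ?_⟩
    · intro j
      by_cases hj : j = i
      · subst hj
        simpa [Config.setProc] using (h.proc j).crash true
      · simpa [Config.setProc, hj] using h.proc j
    · intro j
      simp only [Config.setProc, hprop]
      exact h.request j
    · intro j w
      simp only [Config.setProc, hdec]
      exact h.answered j w
    · intro j w
      simp only [Config.setProc, hprop]
      exact h.proposed j w
    · simp only [Config.setProc, hdec]
      exact h.decided
    · refine lt_of_le_of_lt ?_ hcount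
      refine (Finset.card_le_card (t := insert i _) ?_).trans (Finset.card_insert_le _ _)
      intro j hj
      rw [Finset.mem_insert]
      by_cases hji : j = i
      · exact Or.inl hji
      · right
        rw [Finset.mem_filter] at hj ⊢
        simpa [Config.setProc, hji] using hj

theorem Reachable.legal (hn : 0 < n) (hcalls : M.InvokesAtMostOnce) {C : M.Config}
    (h : M.Reachable C) : Legal C := by
  obtain ⟨x, hx⟩ := h
  induction hx with
  | refl => exact legal_initial hn x
  | tail h₁ h₂ ih =>
    obtain ⟨e, he⟩ := h₂
    exact ih.step hcalls ⟨x, h₁⟩ he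

end System
end TileConsensus

/-! ### The order of configurations and its realization by executions. -/

namespace TileConsensus

namespace System

variable {n : ℕ} {V : Type} {M : System.{u} n V}

/-! ### Progress -/

/-- `C'` arises from `C` by one event of process `i` other than a crash. -/
structure Moved (C C' : M.Config) (i : Fin n) (d : Option V) (ch : Option (Fin n × V)) : Prop where
  others : ∀ j, j ≠ i → C'.proc j = C.proc j
  input : (C'.proc i).input = (C.proc i).input
  clock : (C'.proc i).clock = (C.proc i).clock + 1
  crashed : (C'.proc i).crashed = false
  decision : (C'.proc i).decision = d
  chosen : C'.obj.chosen = ch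

theorem exists_step (hrun : M.RunsForever) {C : M.Config} (hC : M.Reachable C) {i : Fin n}
    (hlive : (C.proc i).crashed = false) (hw : ¬ Waiting (C.proc i)) :
    ∃ C', M.Step C (.step i) C' ∧ Moved C C' i (C.proc i).decision C.obj.chosen := by
  cases hs : (C.proc i).control with
  | waiting r => exact (hw ⟨r, hs⟩).elim
  | running s =>
    cases hact : (M i).act s with
    | halt => exact (hrun C hC i s hs hact).elim
    | compute s' =>
      refine ⟨_, Step.compute C i s s' hlive hs hact, ⟨?_, ?_, ?_, ?_, ?_, rfl⟩⟩
      · intro j hj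
        simp [Config.setProc, hj]
      all_goals simp [Config.setProc, hlive]
    | invoke v r =>
      refine ⟨_, Step.invoke C i s v r hlive hs hact, ⟨?_, ?_, ?_, ?_, ?_, rfl⟩⟩
      · intro j hj
        simp [hj]
      all_goals simp [hlive]

theorem exists_respond {C : M.Config} {i j : Fin n} {w : V}
    (hlive : (C.proc i).crashed = false) (hw : Waiting (C.proc i))
    (hc : C.obj.chosen = some (j, w) ∨ C.obj.chosen = none ∧ C.obj.request j = some w) :
    ∃ C', M.Step C (.respond i) C' ∧ Moved C C' i (some w) (some (j, w)) := by
  obtain ⟨r, hr⟩ := hw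
  refine ⟨_, Step.respond C i j w r hlive hr hc, ⟨?_, ?_, ?_, ?_, ?_, rfl⟩⟩
  · intro j hj
    simp [hj]
  all_goals simp [hlive]

/-- `q'` is a possible later state of a process in state `q`. -/
structure LocalLe {S : Type u} (q q' : LocalState S V) : Prop where
  input : q'.input = q.input
  clock : q.clock ≤ q'.clock
  crashed : q.crashed = true → q' = q
  decision : ∀ w, q.decision = some w → q'.decision = some w

theorem LocalLe.refl {S : Type u} (q : LocalState S V) : LocalLe q q :=
  ⟨rfl, le_rfl, fun _ => rfl, fun _ h => h⟩

/-- `C'` is a possible later configuration. -/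
structure ConfigLe (C C' : M.Config) : Prop where
  proc : ∀ i, LocalLe (C.proc i) (C'.proc i)
  chosen : ∀ c, C.obj.chosen = some c → C'.obj.chosen = some c

variable [Nonempty V]

/-- The clock alone tells whether a caller has been answered: it has exactly when `callTime` is
exceeded. -/
theorem LocallyLegal.decision_eq {i : Fin n} {q q' : LocalState (M i).State V}
    (h : LocallyLegal i q) (h' : LocallyLegal i q') (hle : LocalLe q q')
    (hclock : q'.clock = q.clock) : q'.decision = q.decision := by
  cases hd : q.decision with
  | some w => exact hle.decision w hd
  | none =>
    by_contra hd'
    obtain ⟨h1, h2⟩ := h'.late hd'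
    rw [hle.input] at h1 h2
    rw [hclock] at h2
    exact h.decision_of_lt h1 h2 hd

theorem LocallyLegal.eq_of_le {i : Fin n} {q q' : LocalState (M i).State V}
    (h : LocallyLegal i q) (h' : LocallyLegal i q') (hle : LocalLe q q')
    (hclock : q'.clock = q.clock) (hcrashed : q'.crashed = q.crashed) : q' = q := by
  rw [h.eq_run, h'.eq_run, hle.input, hclock, h.decision_eq h' hle hclock, hcrashed]

theorem Step.le {C C' : M.Config} {e : Event n} (hC : Legal C) (h : M.Step C e C') :
    ConfigLe C C' := by
  cases h with
  | compute i s s' hlive hs hact =>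
    refine ⟨fun j => ?_, fun c hc => hc⟩
    by_cases hj : j = i
    · subst hj
      simp only [Config.setProc, Function.update_self]
      exact ⟨rfl, Nat.le_succ _, by simp [hlive], fun _ h => h⟩
    · simp only [Config.setProc, Function.update_of_ne hj]
      exact LocalLe.refl _
  | invoke i s v r hlive hs hact =>
    refine ⟨fun j => ?_, fun c hc => hc⟩
    by_cases hj : j = i
    · subst hj
      simp only [Function.update_self]
      exact ⟨rfl, Nat.le_succ _, by simp [hlive], fun _ h => h⟩
    · simp only [Function.update_of_ne hj]
      exact LocalLe.refl _
  | respond i j w r hlive hs hw =>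
    refine ⟨fun j => ?_, fun c hc => ?_⟩
    · by_cases hj : j = i
      · subst hj
        simp only [Function.update_self]
        refine ⟨rfl, Nat.le_succ _, by simp [hlive], fun w' hw' => ?_⟩
        have h1 := ((hC.proc j).waiting_iff.1 ⟨r, hs⟩).2
        have h2 := ((hC.proc j).late (by simp [hw'])).2
        omega
      · simp only [Function.update_of_ne hj]
        exact LocalLe.refl _
    · rcases hw with hw | ⟨hw, -⟩
      · rw [hw] at hc
        exact hc
      · rw [hw] at hc
        cases hc
  | crash i hlive hcount =>
    refine ⟨fun j => ?_, fun c hc => hc⟩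
    by_cases hj : j = i
    · subst hj
      simp only [Config.setProc, Function.update_self]
      exact ⟨rfl, le_rfl, by simp [hlive], fun _ h => h⟩
    · simp only [Config.setProc, Function.update_of_ne hj]
      exact LocalLe.refl _

/-- The requests recorded by the object repeat the proposals of the processes, so the tiles need not
represent them separately. -/
theorem Legal.eq_of_proc {C C' : M.Config} (h : Legal C) (h' : Legal C')
    (hproc : C.proc = C'.proc) (hchosen : C.obj.chosen = C'.obj.chosen) : C = C' := by
  have hreq : C.obj.request = C'.obj.request := by
    funext i
    rw [h.request, h'.request, hproc]
  obtain ⟨p, r, c⟩ := C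
  obtain ⟨p', r', c'⟩ := C'
  simp only at hproc hreq hchosen
  rw [hproc, hreq, hchosen]

/-- The number of events that a process is behind. -/
def behind {S : Type u} (q q' : LocalState S V) : ℕ :=
  (q'.clock - q.clock) + if q'.crashed = true ∧ q.crashed = false then 1 else 0

/-- The missing events are scheduled by priority: steps before answers, answers before crashes.
Steps first, so that the winner of `C'` has called before anybody is answered; crashes last, so that
nobody is kept from moving. Each event lowers the number of missing events. -/
theorem leads_of_le (hn : 0 < n) (hcalls : M.InvokesAtMostOnce) (hrun : M.RunsForever)
    {C' : M.Config} (hC' : M.Reachable C') : ∀ {C : M.Config}, M.Reachable C →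
    ConfigLe C C' → M.Leads C C' := by
  classical
  have hL' := hC'.legal hn hcalls
  suffices H : ∀ (N : ℕ) (C : M.Config), ∑ i, behind (C.proc i) (C'.proc i) = N →
      M.Reachable C → ConfigLe C C' → M.Leads C C' from fun {C} => H _ C rfl
  intro N
  induction N using Nat.strong_induction_on with
  | _ N ih =>
  intro C hN hC hle
  have hL := hC.legal hn hcalls
  have advance : ∀ (i : Fin n) (e : Event n) (C₁ : M.Config) (d : Option V)
      (ch : Option (Fin n × V)), M.Step C e C₁ → Moved C C₁ i d ch →
      (C.proc i).crashed = false → (C.proc i).clock < (C'.proc i).clock →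
      (∀ w, d = some w → (C'.proc i).decision = some w) →
      (∀ c, ch = some c → C'.obj.chosen = some c) → M.Leads C C' := by
    intro i e C₁ d ch hs hm hlive hlt hd hch
    refine Relation.ReflTransGen.head ⟨e, hs⟩ (ih _ ?_ C₁ rfl (hC.step hs) ⟨fun j => ?_, ?_⟩)
    · rw [← hN]
      apply Finset.sum_lt_sum
      · intro j _
        by_cases hj : j = i
        · subst hj
          simp only [behind, hm.clock, hm.crashed, hlive]
          omega
        · rw [hm.others j hj]
      · refine ⟨i, Finset.mem_univ _, ?_⟩
        simp only [behind, hm.clock, hm.crashed, hlive]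
        omega
    · by_cases hj : j = i
      · subst hj
        refine ⟨by rw [hm.input, (hle.proc j).input], by rw [hm.clock]; exact hlt, ?_, ?_⟩
        · simp [hm.crashed]
        · rw [hm.decision]
          exact hd
      · rw [hm.others j hj]
        exact hle.proc j
    · rw [hm.chosen]
      exact hch
  have hlive : ∀ i, (C.proc i).clock < (C'.proc i).clock → (C.proc i).crashed = false := by
    intro i hi
    by_contra hc
    rw [Bool.not_eq_false] at hc
    rw [(hle.proc i).crashed hc] at hi
    omega
  by_cases hA : ∃ i, (C.proc i).clock < (C'.proc i).clock ∧ ¬ Waiting (C.proc i)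
  · obtain ⟨i, hi, hw⟩ := hA
    obtain ⟨C₁, hs, hm⟩ := exists_step hrun hC (hlive i hi) hw
    exact advance i _ C₁ _ _ hs hm (hlive i hi) hi (hle.proc i).decision hle.chosen
  push Not at hA
  by_cases hB : ∃ i, (C.proc i).clock < (C'.proc i).clock
  · obtain ⟨i, hi⟩ := hB
    have hw := hA i hi
    obtain ⟨h1, h2⟩ := (hL.proc i).waiting_iff.1 hw
    rw [h2, ← (hle.proc i).input] at hi
    rw [← (hle.proc i).input] at h1
    obtain ⟨w, hd⟩ := Option.ne_none_iff_exists'.1 ((hL'.proc i).decision_of_lt h1 hi)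
    obtain ⟨j, hj⟩ := hL'.answered i w hd
    have hc : C.obj.chosen = some (j, w) ∨ C.obj.chosen = none ∧ C.obj.request j = some w := by
      cases hch : C.obj.chosen with
      | some c =>
        have := hle.chosen c hch
        rw [hj] at this
        left
        rw [this]
      | none =>
        right
        refine ⟨rfl, ?_⟩
        rw [hL.request]
        -- The winner has called in `C` already: if it is behind, it waits, hence is at its call; if
        -- not, its clock is that of `C'`.
        have hp := hL'.proposed j w hj
        have hcall : M.Calls j (C'.proc j).input ∧
            M.callTime j (C'.proc j).input ≤ (C'.proc j).clock := by
          by_contra hnot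
          rw [(hL'.proc j).proposal_of_not hnot] at hp
          cases hp
        rw [((hL'.proc j).proposal_of_le hcall.1 hcall.2).1, (hle.proc j).input] at hp
        rw [(hle.proc j).input] at hcall
        rw [((hL.proc j).proposal_of_le hcall.1 ?_).1, hp]
        rcases (hle.proc j).clock.lt_or_eq with hlt | heq
        · exact ((hL.proc j).waiting_iff.1 (hA j hlt)).2.ge
        · rw [heq]
          exact hcall.2
    have hi' : (C.proc i).clock < (C'.proc i).clock := by
      rw [h2, ← (hle.proc i).input]
      exact hi
    obtain ⟨C₁, hs, hm⟩ := exists_respond (hlive i hi') hw hc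
    exact advance i _ C₁ _ _ hs hm (hlive i hi') hi'
      (fun w' hw' => by cases hw'; exact hd) (fun c hc' => by cases hc'; exact hj)
  push Not at hB
  have hclock : ∀ i, (C'.proc i).clock = (C.proc i).clock :=
    fun i => le_antisymm (hB i) (hle.proc i).clock
  by_cases hD : ∃ i, (C'.proc i).crashed = true ∧ (C.proc i).crashed = false
  · obtain ⟨i, hi', hi⟩ := hD
    -- The crashes of `C` together with that of `i` all occur in `C'`, which has fewer than `n`.
    have hcount : (Finset.univ.filter fun j => (C.proc j).crashed = true).card + 1 < n := by
      refine lt_of_le_of_lt ?_ hL'.crashes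
      rw [← Finset.card_insert_of_notMem (a := i) (by simp [hi])]
      apply Finset.card_le_card
      intro j hj
      rw [Finset.mem_insert, Finset.mem_filter] at hj
      rw [Finset.mem_filter]
      refine ⟨Finset.mem_univ _, ?_⟩
      rcases hj with rfl | ⟨-, hj⟩
      · exact hi'
      · rw [(hle.proc j).crashed hj]
        exact hj
    have hs := Step.crash C i hi hcount
    refine Relation.ReflTransGen.head ⟨_, hs⟩ (ih _ ?_ _ rfl (hC.step hs) ⟨fun j => ?_, hle.chosen⟩)
    · rw [← hN]
      apply Finset.sum_lt_sum
      · intro j _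
        by_cases hj : j = i
        · subst hj
          simp [behind, Config.setProc]
        · simp [Config.setProc, hj]
      · refine ⟨i, Finset.mem_univ _, ?_⟩
        simp [behind, Config.setProc, hi, hi']
    · by_cases hj : j = i
      · subst hj
        simp only [Config.setProc, Function.update_self]
        have hq : C'.proc j = { C.proc j with crashed := true } := by
          rw [(hL'.proc j).eq_run, ((hL.proc j).crash true).eq_run, (hle.proc j).input, hclock j,
            (hL.proc j).decision_eq (hL'.proc j) (hle.proc j) (hclock j), hi']
        rw [hq]
        exact LocalLe.refl _
      · simp only [Config.setProc, Function.update_of_ne hj]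
        exact hle.proc j
  · push Not at hD
    have hproc : C.proc = C'.proc := by
      funext i
      refine ((hL.proc i).eq_of_le (hL'.proc i) (hle.proc i) (hclock i) ?_).symm
      cases hc : (C.proc i).crashed with
      | true => rw [(hle.proc i).crashed hc, hc]
      | false =>
        by_contra hne
        rw [Bool.not_eq_false] at hne
        exact hD i hne hc
    have hchosen : C.obj.chosen = C'.obj.chosen := by
      cases hch : C.obj.chosen with
      | some c => rw [hle.chosen c hch]
      | none =>
        by_contra hne
        -- An object that has chosen has answered somebody, and this answer is visible in the
        -- process states, which agree.
        obtain ⟨i, hi⟩ := hL'.decided (Ne.symm hne)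
        obtain ⟨w, hw⟩ := Option.ne_none_iff_exists'.1 hi
        rw [← hproc] at hw
        obtain ⟨j, hj⟩ := hL.answered i w hw
        rw [hch] at hj
        cases hj
    rw [hL.eq_of_proc hL' hproc hchosen]
    exact Relation.ReflTransGen.refl

/-! ### Occurring states -/

/-- A process can be run alone as long as it does not wait, that is, up to its call or after its
answer. -/
theorem exists_run (hn : 0 < n) (hcalls : M.InvokesAtMostOnce) (hrun : M.RunsForever)
    {C : M.Config} (hC : M.Reachable C) {i : Fin n} (hlive : (C.proc i).crashed = false) {m : ℕ}
    (hm : (C.proc i).clock ≤ m)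
    (hcall : (C.proc i).decision = none → M.Calls i (C.proc i).input →
      m ≤ M.callTime i (C.proc i).input) :
    ∃ C', M.Reachable C' ∧ (∀ j, j ≠ i → C'.proc j = C.proc j) ∧
      (C'.proc i).input = (C.proc i).input ∧ (C'.proc i).clock = m ∧
      (C'.proc i).crashed = false ∧ (C'.proc i).decision = (C.proc i).decision ∧
      C'.obj.chosen = C.obj.chosen := by
  induction m, hm using Nat.le_induction with
  | base => exact ⟨C, hC, fun _ _ => rfl, rfl, rfl, hlive, rfl, rfl⟩
  | succ m hm ih =>
    obtain ⟨C₁, h1, h2, h3, h4, h5, h6, h7⟩ :=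
      ih fun h h' => (Nat.le_succ m).trans (hcall h h')
    have hL := (h1.legal hn hcalls).proc i
    have hw : ¬ Waiting (C₁.proc i) := by
      intro hw
      obtain ⟨h8, h9⟩ := hL.waiting_iff.1 hw
      have hd : (C₁.proc i).decision = none := by
        by_contra hd
        have := (hL.late hd).2
        omega
      rw [h3] at h8 h9
      have := hcall (h6 ▸ hd) h8
      omega
    obtain ⟨C₂, hs, hm⟩ := exists_step hrun h1 h5 hw
    refine ⟨C₂, h1.step hs, fun j hj => by rw [hm.others j hj, h2 j hj], by rw [hm.input, h3],
      by rw [hm.clock, h4], hm.crashed, by rw [hm.decision, h6], by rw [hm.chosen, h7]⟩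

theorem exists_unanswered (hn : 0 < n) (hcalls : M.InvokesAtMostOnce) (hrun : M.RunsForever)
    (i : Fin n) (x : V) (m : ℕ) (hm : M.Calls i x → m ≤ M.callTime i x) :
    ∃ C, M.Reachable C ∧ (C.proc i).input = x ∧ (C.proc i).clock = m ∧
      (C.proc i).crashed = false ∧ (C.proc i).decision = none := by
  obtain ⟨C, h1, -, h2, h3, h4, h5, -⟩ := exists_run hn hcalls hrun
    (reachable_initial (M := M) fun _ => x) (i := i) rfl (m := m) (Nat.zero_le _) fun _ h => hm h
  exact ⟨C, h1, h2, h3, h4, h5⟩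

/-- Give `x` to process `i` and `y` to all others. Let `j` run to its call and `i` to its own,
answer `i` with the value of `j`, and let `i` run on. The condition `hij` covers a process that wins
itself. -/
theorem exists_answered (hn : 0 < n) (hcalls : M.InvokesAtMostOnce) (hrun : M.RunsForever)
    {i j : Fin n} {x y w : V} {m : ℕ} (hi : M.Calls i x) (hj : M.call j y = some w)
    (hij : i = j → x = y) (hm : M.callTime i x < m) :
    ∃ C, M.Reachable C ∧ (C.proc i).input = x ∧ (C.proc i).clock = m ∧
      (C.proc i).crashed = false ∧ (C.proc i).decision = some w := by
  have hjc : M.Calls j y := call_ne_none.1 (by simp [hj])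
  have hxj : (if j = i then x else y) = y := by
    split_ifs with h
    · exact hij h.symm
    · rfl
  obtain ⟨C₁, h1, h2, h3, h4, h5, h6, h7⟩ := exists_run hn hcalls hrun
    (reachable_initial (M := M) fun k => if k = i then x else y) (i := j) rfl
    (m := M.callTime j y) (Nat.zero_le _) (by
      intro _ _
      simp only [initial, hxj]
      exact le_rfl)
  have hin : (C₁.proc i).input = x ∧ (C₁.proc i).clock ≤ M.callTime i x ∧
      (C₁.proc i).crashed = false ∧ (C₁.proc i).decision = none := by
    by_cases hji : i = j
    · obtain rfl := hij hji
      subst hji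
      simp only [initial] at h3
      exact ⟨h3, h4.le, h5, h6⟩
    · rw [h2 i hji]
      simp [initial]
  obtain ⟨hin1, hin2, hin3, hin4⟩ := hin
  have hjin : (C₁.proc j).input = y := by
    rw [h3]
    simp only [initial, hxj]
  have hprop : (C₁.proc j).proposal = some w := by
    rw [((h1.legal hn hcalls).proc j |>.proposal_of_le (by rwa [hjin]) (by rw [hjin, h4])).1,
      hjin, hj]
  obtain ⟨C₂, k1, k2, k3, k4, k5, k6, k7⟩ := exists_run hn hcalls hrun h1 hin3
    (m := M.callTime i x) hin2 (by rw [hin1]; exact fun _ _ => le_rfl)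
  have hprop₂ : (C₂.proc j).proposal = some w := by
    by_cases hji : j = i
    · obtain rfl := hij hji.symm
      subst hji
      have hL := (k1.legal hn hcalls).proc j
      rw [(hL.proposal_of_le (by rwa [k3, hin1]) (by rw [k3, hin1, k4])).1, k3, hin1, hj]
    · rw [k2 j hji, hprop]
  have hw : Waiting (C₂.proc i) := by
    rw [((k1.legal hn hcalls).proc i).waiting_iff, k3, hin1]
    exact ⟨hi, k4⟩
  obtain ⟨C₃, hs, hmv⟩ := exists_respond (j := j) (w := w) k5 hw (by
    right
    rw [k7, h7, (k1.legal hn hcalls).request]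
    exact ⟨rfl, hprop₂⟩)
  obtain ⟨C₄, l1, -, l3, l4, l5, l6, -⟩ := exists_run hn hcalls hrun (k1.step hs) hmv.crashed
    (m := m) (by rw [hmv.clock, k4]; exact hm) (by rw [hmv.decision]; simp)
  exact ⟨C₄, l1, by rw [l3, hmv.input, k3, hin1], l4, l5, by rw [l6, hmv.decision]⟩

end System
end TileConsensus

/-! ### Configurations as assemblies. -/

namespace TileConsensus

open TileSet TileConsensus.System

namespace ConsensusTiles

section

variable {n : ℕ} {V : Type} {X : ℕ} [NeZero n] [Finite V] [Nonempty V] {M : System.{u} n V}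

/-! ### The representation of a configuration -/

open Classical in
/-- The rays start so that all invocations happen at position `X`. -/
noncomputable def offset (X : ℕ) (M : System.{u} n V) (i : Fin n) (x : V) : ℕ :=
  if M.Calls i x then X - M.callTime i x else 0

/-- The last position on the ray of a process. -/
noncomputable def tip (X : ℕ) (i : Fin n) (q : LocalState (M i).State V) : ℕ :=
  offset X M i q.input + q.clock + q.decision.toList.length

/-- The ray of a process in state `q`. -/
noncomputable def rayCell (X : ℕ) (i : Fin n) (q : LocalState (M i).State V) (m : ℕ) :
    Option (Cube (Tile n V X)) :=
  if m ≤ tip X i q then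
    some ⟨.ray i q.input (cap m) (if X + 2 ≤ m then q.decision else none), false⟩
  else if m = tip X i q + 1 ∧ q.crashed = true then some ⟨.row 0, true⟩
  else none

/-- The consensus object with the winner `c`. -/
def objCell (X : ℕ) (c : Option (Fin n × V)) (m : Fin (2 * n + 1)) :
    Option (Cube (Tile n V X)) :=
  c.bind fun c => if c.1.val ≤ m.val then some ⟨.obj m c.1 c.2, false⟩ else none

/-- The cubes that represent a configuration. -/
noncomputable def cell (X : ℕ) (C : M.Config) : Place n → Option (Cube (Tile n V X))
  | .row y => some ⟨.row y, false⟩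
  | .ray i m => rayCell X i (C.proc i) m
  | .obj m => objCell X C.obj.chosen m

/-- The tile configuration that represents a configuration. -/
noncomputable def rep (X : ℕ) (C : M.Config) : (tileSet X M.call).Assembly :=
  Function.extend (site X) (cell X C) fun _ => none

theorem rep_site (C : M.Config) (P : Place n) : rep X C (site X P) = cell X C P :=
  (site_injective X).extend_apply _ _ _

theorem exists_of_rep {C : M.Config} {p : Site} (h : rep X C p ≠ none) :
    ∃ P : Place n, p = site X P := by
  by_contra hne
  apply h
  apply Function.extend_apply'
  rintro ⟨P, rfl⟩
  exact hne ⟨P, rfl⟩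

omit [NeZero n] [Finite V] [Nonempty V] in
theorem objCell_eq_some {c : Option (Fin n × V)} {m : Fin (2 * n + 1)} {k : Cube (Tile n V X)}
    (h : objCell X c m = some k) :
    ∃ j v, c = some (j, v) ∧ j.val ≤ m.val ∧ k = ⟨.obj m j v, false⟩ := by
  cases c with
  | none => cases h
  | some c =>
    simp only [objCell, Option.bind_some] at h
    split_ifs at h with hj
    cases h
    exact ⟨c.1, c.2, rfl, hj, rfl⟩

omit [NeZero n] [Finite V] [Nonempty V] in
theorem objCell_of_le {j : Fin n} {v : V} {m : Fin (2 * n + 1)} (h : j.val ≤ m.val) :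
    objCell X (some (j, v)) m = some ⟨.obj m j v, false⟩ := by
  simp [objCell, h]

omit [Finite V] in
theorem rayCell_of_le {i : Fin n} {q : LocalState (M i).State V} {m : ℕ} (h : m ≤ tip X i q) :
    rayCell X i q m =
      some ⟨.ray i q.input (cap m) (if X + 2 ≤ m then q.decision else none), false⟩ :=
  if_pos h

omit [Finite V] in
theorem le_of_rayCell {i : Fin n} {q : LocalState (M i).State V} {m : ℕ} {t : Tile n V X}
    (h : rayCell X i q m = some ⟨t, false⟩) : m ≤ tip X i q := by
  by_contra h1
  rw [rayCell, if_neg h1] at h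
  by_cases h2 : m = tip X i q + 1 ∧ q.crashed = true
  · rw [if_pos h2] at h
    cases h
  · rw [if_neg h2] at h
    cases h

omit [Finite V] in
theorem rayCell_blocked {i : Fin n} {q : LocalState (M i).State V} {m : ℕ} {t : Tile n V X} :
    rayCell X i q m = some ⟨t, true⟩ ↔ m = tip X i q + 1 ∧ q.crashed = true ∧ t = .row 0 := by
  by_cases h1 : m ≤ tip X i q
  · rw [rayCell_of_le h1]
    simp only [Option.some.injEq, Cube.mk.injEq, Bool.false_eq_true, and_false, false_iff]
    omega
  · rw [rayCell, if_neg h1]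
    by_cases h2 : m = tip X i q + 1 ∧ q.crashed = true
    · rw [if_pos h2]
      simp only [Option.some.injEq, Cube.mk.injEq, and_true, h2, true_and]
      exact eq_comm
    · rw [if_neg h2]
      simp only [reduceCtorEq, false_iff]
      tauto

variable (hX : ∀ i x, M.callTime i x ≤ X)
include hX

omit [NeZero n] [Finite V] hX in
theorem tip_of_not_calls {i : Fin n} {q : LocalState (M i).State V} (h : LocallyLegal i q)
    (hc : ¬ M.Calls i q.input) : q.decision = none ∧ tip X i q = q.clock := by
  have hd : q.decision = none := by
    by_contra hd
    exact hc (h.late hd).1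
  refine ⟨hd, ?_⟩
  simp [tip, hd, offset, hc]

-- The head start brings the call to position `X` exactly, so a waiting process has its tip there.
-- The equation is additive to avoid truncated subtraction.
omit [NeZero n] [Finite V] in
theorem tip_of_undecided {i : Fin n} {q : LocalState (M i).State V} (h : LocallyLegal i q)
    (hc : M.Calls i q.input) (hd : q.decision = none) :
    tip X i q + M.callTime i q.input = X + q.clock ∧ tip X i q ≤ X := by
  have h1 := h.early hd hc
  have h2 := hX i q.input
  simp only [tip, hd, offset, hc, if_true, Option.toList_none, List.length_nil]
  omega

-- The answer counts for two cubes, at `X + 1` and `X + 2`, so the tip goes from `X` to `X + 2` at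
-- once.
omit [NeZero n] [Finite V] in
theorem tip_of_decided {i : Fin n} {q : LocalState (M i).State V} (h : LocallyLegal i q)
    (hd : q.decision ≠ none) :
    M.Calls i q.input ∧ tip X i q + M.callTime i q.input = X + q.clock + 1 ∧
      X + 2 ≤ tip X i q := by
  obtain ⟨hc, h1⟩ := h.late hd
  have h2 := hX i q.input
  obtain ⟨w, hw⟩ := Option.ne_none_iff_exists'.1 hd
  refine ⟨hc, ?_⟩
  simp only [tip, hw, offset, hc, if_true, Option.toList_some, List.length_singleton]
  omega

-- The tip of a caller is never at `X + 1`. So the site beyond a tip needs no help from the object,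
-- and a blockage can be bound there even while the process waits for an object that has not
-- answered: every crash can be represented.
omit [NeZero n] [Finite V] in
theorem not_gate_tip {i : Fin n} {q : LocalState (M i).State V} (h : LocallyLegal i q) :
    ¬ Gate (X := X) M.call i q.input (tip X i q + 1) := by
  rintro ⟨h1, h2⟩
  rw [call_ne_none] at h1
  by_cases hd : q.decision = none
  · have := (tip_of_undecided hX h h1 hd).2
    omega
  · have := (tip_of_decided hX h hd).2.2
    omega

theorem fed_rep_tip {C : M.Config} {i : Fin n} (h : LocallyLegal i (C.proc i)) :
    ∃ t, Fed (rep X C) (site X (.ray i (tip X i (C.proc i) + 1))) t := by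
  exact ⟨_, fed_ray_succ ((rep_site C _).trans (rayCell_of_le le_rfl)) (not_gate_tip hX h)⟩

/-- Legality supplies the feeders at the two interfaces: an answer that has been received is the
winner's value, so the gate is fed from above, and the winner has proposed, so its ray reaches `X`
and feeds the start of the path. -/
theorem legit_rep {C : M.Config} (hC : Legal C) : Legit (rep X C) where
  seed := rep_site C _
  fed p t hp := by
    obtain ⟨P, rfl⟩ := exists_of_rep (C := C) (X := X) (p := p) (by simp [hp])
    rw [rep_site] at hp
    cases P with
    | row y =>
      cases hp
      obtain ⟨y, hy⟩ := y
      cases y with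
      | zero => exact Or.inl ⟨rfl, rfl⟩
      | succ y => exact Or.inr (fed_row (y := ⟨y, by omega⟩) rfl (rep_site C _))
    | ray i m =>
      right
      have hle := le_of_rayCell hp
      have hL := hC.proc i
      rw [cell, rayCell_of_le hle] at hp
      cases hp
      cases m with
      | zero =>
        rw [if_neg (by omega)]
        exact fed_ray_zero _ (rep_site C _)
      | succ m =>
        have hpred := (rep_site (X := X) C (.ray i m)).trans
          (rayCell_of_le ((Nat.le_succ m).trans hle))
        by_cases hg : Gate (X := X) M.call i (C.proc i).input (m + 1)
        · obtain ⟨hc, hm⟩ := hg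
          obtain rfl : m = X + 1 := by omega
          have hd : (C.proc i).decision ≠ none := by
            intro hd
            have := (tip_of_undecided hX hL (call_ne_none.1 hc) hd).2
            omega
          obtain ⟨w, hw⟩ := Option.ne_none_iff_exists'.1 hd
          obtain ⟨j, hj⟩ := hC.answered i w hw
          rw [if_pos le_rfl, hw]
          rw [if_neg (by omega)] at hpred
          refine fed_gate (j := j) hc hpred ((rep_site C _).trans ?_)
          rw [cell, hj]
          exact objCell_of_le (j.2.le.trans (n_le_answerIndex i))
        · refine fed_ray_succ (hpred.trans ?_) hg
          congr 3
          -- This is the passage where `rayCell` begins to show the decision; without a gate there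
          -- is no call, so the decision is `none` and the label does not change.
          by_cases hm : m = X + 1
          · subst hm
            rw [(tip_of_not_calls (X := X) hL fun hc => hg ⟨call_ne_none.2 hc, rfl⟩).1]
            simp
          · by_cases h1 : X + 2 ≤ m
            · rw [if_pos h1, if_pos (by omega)]
            · rw [if_neg h1, if_neg (by omega)]
    | obj m =>
      right
      obtain ⟨j, v, hch, hj, h0⟩ := objCell_eq_some hp
      cases h0
      rcases hj.lt_or_eq with hlt | heq
      · refine fed_obj_succ (m := ⟨m.val - 1, by omega⟩) (by simp only; omega) (by simp only; omega)
          ((rep_site C _).trans ?_)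
        rw [cell, hch]
        exact objCell_of_le (by simp only; omega)
      · have hprop := hC.proposed j v hch
        have hL := hC.proc j
        have hcall : M.Calls j (C.proc j).input ∧
            M.callTime j (C.proc j).input ≤ (C.proc j).clock := by
          by_contra hnot
          rw [hL.proposal_of_not hnot] at hprop
          cases hprop
        refine fed_obj_self heq.symm ?_ ((rep_site C _).trans (rayCell_of_le ?_))
        · rw [← (hL.proposal_of_le hcall.1 hcall.2).1, hprop]
        · by_cases hd : (C.proc j).decision = none
          · have := (tip_of_undecided hX hL hcall.1 hd).1
            omega
          · have := (tip_of_decided hX hL hd).2.2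
            omega
  typed p t hp := by
    obtain ⟨P, rfl⟩ := exists_of_rep (C := C) (X := X) (p := p) (by simp [hp])
    refine ⟨P, rfl, ?_⟩
    rw [rep_site] at hp
    cases P with
    | row y =>
      cases hp
      rfl
    | ray i m =>
      rw [cell, rayCell_of_le (le_of_rayCell hp)] at hp
      cases hp
      exact ⟨rfl, rfl⟩
    | obj m =>
      obtain ⟨j, v, -, hj, h0⟩ := objCell_eq_some hp
      cases h0
      exact ⟨rfl, hj⟩
  blocked := by
    rintro p ⟨t, hp⟩
    obtain ⟨P, rfl⟩ := exists_of_rep (C := C) (X := X) (p := p) (by simp [hp])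
    rw [rep_site] at hp
    cases P with
    | row y => simp [cell] at hp
    | ray i m => exact ⟨i, m, rfl⟩
    | obj m =>
      obtain ⟨j, v, -, hj, h0⟩ := objCell_eq_some hp
      cases h0
  finite := by
    have hfin : (object n X ∪ ⋃ i : Fin n, (fun m => site X (.ray i m)) ''
        Set.Iic (tip X i (C.proc i) + 1)).Finite :=
      object_finite.union (Set.finite_iUnion fun i => (Set.finite_Iic _).image _)
    refine hfin.subset fun p hp => ?_
    obtain ⟨P, rfl⟩ := exists_of_rep hp
    cases P with
    | row y => exact Or.inl (Or.inl ⟨y, rfl⟩)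
    | ray i m =>
      refine Or.inr (Set.mem_iUnion.2 ⟨i, m, ?_, rfl⟩)
      by_contra hm
      rw [Set.mem_Iic] at hm
      apply hp
      rw [rep_site, cell, rayCell, if_neg (by omega), if_neg (by omega)]
    | obj m => exact Or.inl (Or.inr ⟨m, rfl⟩)

omit [NeZero n] [Finite V] hX in
theorem tip_mono {i : Fin n} {q q' : LocalState (M i).State V} (hle : LocalLe q q') :
    tip X i q ≤ tip X i q' := by
  have h1 := hle.clock
  have h2 : q.decision.toList.length ≤ q'.decision.toList.length := by
    cases hd : q.decision with
    | none => simp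
    | some w => simp [hle.decision w hd]
  simp only [tip, hle.input]
  omega

-- A crashed ray does not change, and a live one only gets longer. Labels stay the same, since cubes
-- from `X + 2` on exist only when the answer has arrived or none will ever come.
omit [Finite V] in
theorem rayCell_sub {i : Fin n} {q q' : LocalState (M i).State V} (h : LocallyLegal i q)
    (h' : LocallyLegal i q') (hle : LocalLe q q') {m : ℕ} (hm : rayCell X i q m ≠ none) :
    rayCell X i q' m = rayCell X i q m := by
  by_cases hcr : q.crashed = true
  · rw [hle.crashed hcr]
  · have hmt : m ≤ tip X i q := by
      by_contra hmt
      apply hm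
      rw [rayCell, if_neg hmt, if_neg (by tauto)]
    rw [rayCell_of_le hmt, rayCell_of_le (hmt.trans (tip_mono hle)), hle.input]
    congr 3
    by_cases hX2 : X + 2 ≤ m
    · rw [if_pos hX2, if_pos hX2]
      by_cases hd : q.decision = none
      · by_cases hc : M.Calls i q.input
        · have := (tip_of_undecided hX h hc hd).2
          omega
        · rw [(tip_of_not_calls (X := X) h hc).1]
          rw [← hle.input] at hc
          rw [(tip_of_not_calls (X := X) h' hc).1]
      · obtain ⟨w, hw⟩ := Option.ne_none_iff_exists'.1 hd
        rw [hw, hle.decision w hw]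
    · rw [if_neg hX2, if_neg hX2]

theorem rep_sub {C C' : M.Config} (hC : Legal C) (hC' : Legal C') (hle : ConfigLe C C') :
    Sub (rep X C) (rep X C') := by
  intro p hp
  obtain ⟨P, rfl⟩ := exists_of_rep hp
  rw [rep_site] at hp
  rw [rep_site, rep_site]
  cases P with
  | row y => rfl
  | ray i m => exact rayCell_sub hX (hC.proc i) (hC'.proc i) (hle.proc i) hp
  | obj m =>
    obtain ⟨k, hk⟩ := Option.ne_none_iff_exists'.1 hp
    obtain ⟨j, v, hch, -, -⟩ := objCell_eq_some hk
    simp only [cell]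
    rw [hch, hle.chosen _ hch]

-- A ray shows its input in the first cube, its answer in the tip, and its clock in its length. A
-- blockage beyond the tip pins the tip of the larger ray too, so a crashed state is contained only
-- in itself.
omit [Finite V] in
theorem localLe_of_rayCell {i : Fin n} {q q' : LocalState (M i).State V} (h : LocallyLegal i q)
    (h' : LocallyLegal i q') (hsub : ∀ m, rayCell X i q m ≠ none →
      rayCell X i q' m = rayCell X i q m) : LocalLe q q' := by
  have hle : ∀ m, m ≤ tip X i q → m ≤ tip X i q' ∧ q'.input = q.input ∧
      (X + 2 ≤ m → q'.decision = q.decision) := by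
    intro m hm
    have h1 := hsub m (by rw [rayCell_of_le hm]; simp)
    rw [rayCell_of_le hm] at h1
    have h2 := le_of_rayCell h1
    rw [rayCell_of_le h2] at h1
    simp only [Option.some.injEq, Cube.mk.injEq, Tile.ray.injEq] at h1
    refine ⟨h2, h1.1.2.1, fun h3 => ?_⟩
    simpa [h3] using h1.1.2.2.2
  have hin := (hle 0 (Nat.zero_le _)).2.1
  have htip := (hle _ le_rfl).1
  have hdec : ∀ w, q.decision = some w → q'.decision = some w := by
    intro w hw
    rw [← hw]
    exact (hle _ le_rfl).2.2 (tip_of_decided hX h (by simp [hw])).2.2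
  have hclock : q.clock ≤ q'.clock := by
    by_cases hc : M.Calls i q.input
    · have hc' := hc
      rw [← hin] at hc'
      by_cases hd : q.decision = none
      · by_cases hd' : q'.decision = none
        · have h1 := (tip_of_undecided hX h hc hd).1
          have h2 := (tip_of_undecided hX h' hc' hd').1
          rw [hin] at h2
          omega
        · have h1 := h.early hd hc
          have h2 := (h'.late hd').2
          rw [hin] at h2
          omega
      · obtain ⟨w, hw⟩ := Option.ne_none_iff_exists'.1 hd
        have h1 := (tip_of_decided hX h hd).2.1
        have h2 := (tip_of_decided hX h' (by simp [hdec w hw])).2.1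
        rw [hin] at h2
        omega
    · have hc' := hc
      rw [← hin] at hc'
      rw [← (tip_of_not_calls (X := X) h hc).2, ← (tip_of_not_calls h' hc').2]
      exact htip
  refine ⟨hin, hclock, fun hcr => ?_, hdec⟩
  have hblock := hsub (tip X i q + 1) (by rw [rayCell_blocked.2 ⟨rfl, hcr, rfl⟩]; simp)
  rw [rayCell_blocked.2 ⟨rfl, hcr, rfl⟩, rayCell_blocked] at hblock
  obtain ⟨h1, h2, -⟩ := hblock
  have hclock' : q'.clock = q.clock := by
    have h3 : q.decision.toList.length ≤ q'.decision.toList.length := by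
      cases hd : q.decision with
      | none => simp
      | some w => simp [hdec w hd]
    have h4 : tip X i q = tip X i q' := by omega
    simp only [tip, hin] at h4
    omega
  have hdec' : q'.decision = q.decision := by
    have h4 : tip X i q = tip X i q' := by omega
    simp only [tip, hin, hclock'] at h4
    cases hd : q.decision with
    | some w => exact hdec w hd
    | none =>
      cases hd' : q'.decision with
      | none => rfl
      | some w => simp [hd, hd'] at h4
  rw [h.eq_run, h'.eq_run, hin, hclock', hdec', h2, hcr]

theorem configLe_of_sub {C C' : M.Config} (hC : Legal C) (hC' : Legal C')
    (hsub : Sub (rep X C) (rep X C')) : ConfigLe C C' := by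
  constructor
  · intro i
    apply localLe_of_rayCell hX (hC.proc i) (hC'.proc i)
    intro m hm
    have := hsub (site X (.ray i m)) (by rw [rep_site]; exact hm)
    rwa [rep_site, rep_site] at this
  · rintro ⟨j, v⟩ hc
    have h1 : objCell X C.obj.chosen (decisionIndex n) = some ⟨.obj (decisionIndex n) j v, false⟩ := by
      rw [hc]
      exact objCell_of_le j.2.le
    have := hsub (site X (.obj (decisionIndex n))) (by rw [rep_site, cell, h1]; simp)
    rw [rep_site, rep_site, cell, cell, h1] at this
    obtain ⟨j', v', h2, -, h3⟩ := objCell_eq_some this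
    cases h3
    exact h2

omit hX in
theorem blocked_rep {C : M.Config} {p : Site} (h : Blocked (rep X C) p) :
    ∃ i, p = site X (.ray i (tip X i (C.proc i) + 1)) ∧ (C.proc i).crashed = true := by
  obtain ⟨t, ht⟩ := h
  obtain ⟨P, rfl⟩ := exists_of_rep (C := C) (X := X) (p := p) (by simp [ht])
  rw [rep_site] at ht
  cases P with
  | row y => simp [cell] at ht
  | ray i m =>
    obtain ⟨rfl, h1, -⟩ := rayCell_blocked.1 ht
    exact ⟨i, rfl, h1⟩
  | obj m =>
    obtain ⟨j, v, -, -, h⟩ := objCell_eq_some ht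
    cases h

/-- Without new crashes every blockage of the larger representation is in the smaller one, as
`Legit.grows` requires. -/
theorem grows_rep {C C' : M.Config} (hC : Legal C) (hC' : Legal C') (hle : ConfigLe C C')
    (hcr : ∀ i, (C'.proc i).crashed = true → (C.proc i).crashed = true) :
    Grows (rep X C) (rep X C') := by
  refine (legit_rep hX hC').grows (rep_sub hX hC hC' hle) (by rw [(legit_rep hX hC).seed]; simp) ?_
  intro p hp
  obtain ⟨i, rfl, h⟩ := blocked_rep hp
  rw [(hle.proc i).crashed (hcr i h), rep_site, cell, rayCell_blocked.2 ⟨rfl, hcr i h, rfl⟩]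
  simp

theorem grows_rep_initial (x : Fin n → V) :
    Grows (cubeSystem X M.call).seed (rep X (M.initial x)) := by
  have hL : Legal (M.initial x) := legal_initial (NeZero.pos n) x
  refine (legit_rep hX hL).grows ?_ (by rw [legit_seed.seed]; simp) ?_
  · intro p hp
    obtain ⟨c, hc⟩ := Option.ne_none_iff_exists'.1 hp
    obtain ⟨rfl, rfl⟩ := seedAssembly_eq hc
    rw [hc]
    exact rep_site _ _
  · intro p hp
    obtain ⟨i, -, h⟩ := blocked_rep hp
    cases h

omit [NeZero n] [Finite V] hX [Nonempty V] in
theorem step_crashed {C C' : M.Config} {e : Event n} (hs : M.Step C e C') (he : ¬ e.IsCrash)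
    (i : Fin n) : (C'.proc i).crashed = (C.proc i).crashed := by
  cases hs with
  | compute j s s' => exact crashed_update C j { C.proc j with
        clock := (C.proc j).clock + 1, control := .running s' } rfl i
  | invoke j s v r =>
    exact crashed_update C j { C.proc j with
        clock := (C.proc j).clock + 1, control := .waiting r, calls := (C.proc j).calls + 1,
        proposal := some v } rfl i
  | respond j k w r =>
    exact crashed_update C j { C.proc j with
        clock := (C.proc j).clock + 1, control := .running (r w), decision := some w } rfl i
  | crash j => exact (he trivial).elim

omit hX in
theorem rep_crash {C C' : M.Config} {i : Fin n} (hs : M.Step C (.crash i) C') :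
    (C.proc i).crashed = false ∧ rep X C' = Function.update (rep X C)
      (site X (.ray i (tip X i (C.proc i) + 1))) (some ⟨.row 0, true⟩) := by
  cases hs with
  | crash _ hlive hcount =>
    refine ⟨hlive, ?_⟩
    funext p
    by_cases hp : ∃ P : Place n, p = site X P
    · obtain ⟨P, rfl⟩ := hp
      rw [rep_site]
      by_cases hP : P = .ray i (tip X i (C.proc i) + 1)
      · subst hP
        rw [Function.update_self]
        simp only [cell, Config.setProc, Function.update_self]
        exact rayCell_blocked.2 ⟨rfl, rfl, rfl⟩
      · rw [Function.update_of_ne fun h => hP (site_injective X h), rep_site]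
        cases P with
        | row y => rfl
        | obj m => rfl
        | ray j m =>
          by_cases hj : j = i
          · subst hj
            simp only [cell, Config.setProc, Function.update_self, rayCell]
            have hm : m ≠ tip X j (C.proc j) + 1 := fun h => hP (by rw [h])
            simp [tip] at hm ⊢
            simp [hm]
          · simp [cell, Config.setProc, hj]
    · have h1 : rep X C p = none := by
        by_contra hne
        exact hp (exists_of_rep hne)
      rw [Function.update_of_ne fun h => hp ⟨_, h⟩, h1]
      by_contra hne
      exact hp (exists_of_rep hne)

/-- The site beyond the tip is fed by the ray, so some cube fits there, but a cube of the row does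
not: binding one is an admissible error. -/
theorem block_rep {C C' : M.Config} (hC : Legal C) {i : Fin n} (hs : M.Step C (.crash i) C') :
    Block (object n X) (rep X C) (rep X C') := by
  obtain ⟨hlive, hrep⟩ := rep_crash hs
  have hnone : rep X C (site X (.ray i (tip X i (C.proc i) + 1))) = none := by
    rw [rep_site, cell, rayCell, if_neg (by omega), if_neg (by simp [hlive])]
  obtain ⟨t, ht⟩ := fed_rep_tip hX (hC.proc i)
  refine ⟨_, .row 0, ray_not_mem_object _ _, ⟨hnone, t, ht.pull⟩, ?_, hrep⟩
  by_contra hlt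
  obtain ⟨P, h1, h2⟩ := ((legit_rep hX hC).fed_of_pull hnone (not_lt.1 hlt)).typed (legit_rep hX hC)
  cases site_injective X h1
  exact h2

end

end ConsensusTiles
end TileConsensus

/-! ### Following a fair assembly sequence by an execution. -/

namespace TileConsensus

open TileSet TileConsensus.System

namespace System

variable {n : ℕ} {V : Type} {M : System.{u} n V}

theorem Step.clock_succ {C C' : M.Config} {e : Event n} (hs : M.Step C e C') (he : ¬ e.IsCrash) :
    (C'.proc e.process).clock = (C.proc e.process).clock + 1 := by
  cases hs with
  | compute j s s' => simp [Config.setProc, Event.process]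
  | invoke j s v r => simp [Event.process]
  | respond j k w r => simp [Event.process]
  | crash j => exact (he trivial).elim

end System

namespace ConsensusTiles

section

variable {n : ℕ} {V : Type} {X : ℕ} [NeZero n] [Finite V] [Nonempty V] {M : System.{u} n V}
variable {α : (tileSet X M.call).Assembly}

theorem Legit.input_eq (hα : Legit α) {i : Fin n} {m m' : ℕ} {x x' : V} {k k' : Fin (X + 4)}
    {w w' : Option V} (h : α (site X (.ray i m)) = some ⟨.ray i x k w, false⟩)
    (h' : α (site X (.ray i m')) = some ⟨.ray i x' k' w', false⟩) : x = x' := by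
  obtain ⟨w₁, h₁⟩ := hα.ray_prefix (Nat.zero_le m) h
  obtain ⟨w₂, h₂⟩ := hα.ray_prefix (Nat.zero_le m') h'
  rw [h₁] at h₂
  cases h₂
  rfl

/-- The last cube of the consensus object. -/
def lastIndex (n : ℕ) : Fin (2 * n + 1) := ⟨2 * n, by omega⟩

theorem Legit.decided_last (hα : Legit α) {j : Fin n} {v : V}
    (h : α (site X (.obj (lastIndex n))) = some ⟨.obj (lastIndex n) j v, false⟩) :
    Decided α j v :=
  hα.decided (by simp only [lastIndex]; omega) h

theorem decided_of_sub {C : M.Config} (hs : Sub (rep X C) α) {j : Fin n} {v : V}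
    (hc : C.obj.chosen = some (j, v)) : Decided α j v := by
  refine hs.eq_some ((rep_site C _).trans ?_)
  rw [cell, hc]
  exact objCell_of_le j.2.le

variable (hX : ∀ i x, M.callTime i x ≤ X)
include hX

/-- An assembly contains the ray of a process as soon as it contains the last cube of it. -/
theorem Legit.rayCell_eq (hα : Legit α) {i : Fin n} {q : LocalState (M i).State V}
    (hq : LocallyLegal i q) (hlive : q.crashed = false)
    (hin : ∃ m k w, α (site X (.ray i m)) = some ⟨.ray i q.input k w, false⟩)
    (htip : Sound α (site X (.ray i (tip X i q))))
    (hd : ∀ w, q.decision = some w → ∃ j, Decided α j w) {m : ℕ} (hm : rayCell X i q m ≠ none) :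
    α (site X (.ray i m)) = rayCell X i q m := by
  have hmt : m ≤ tip X i q := by
    by_contra hmt
    apply hm
    rw [rayCell, if_neg hmt, if_neg (by simp [hlive])]
  obtain ⟨t, ht⟩ := htip
  obtain ⟨x, w, rfl⟩ := hα.ray_eq ht
  obtain ⟨m', k', w', h'⟩ := hin
  obtain rfl := hα.input_eq ht h'
  obtain ⟨w₁, h₁⟩ := hα.ray_prefix hmt ht
  rw [h₁, rayCell_of_le hmt]
  by_cases hc : M.Calls i q.input
  · by_cases hX2 : X + 2 ≤ m
    · rw [if_pos hX2]
      obtain ⟨j, v, rfl, hv⟩ := hα.answer hX2 (call_ne_none.2 hc) h₁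
      have hdec : q.decision ≠ none := by
        intro hdec
        have := (tip_of_undecided hX hq hc hdec).2
        omega
      obtain ⟨w₂, hw₂⟩ := Option.ne_none_iff_exists'.1 hdec
      obtain ⟨j', hj'⟩ := hd w₂ hw₂
      rw [hw₂, (hv.unique hj').2]
    · rw [if_neg hX2, hα.ray_unanswered h₁ fun h => hX2 h.2]
  · rw [(tip_of_not_calls (X := X) hq hc).1, hα.ray_unanswered h₁ fun h => hc (call_ne_none.1 h.1)]
    simp

/-- After a move of process `i`, the representation of the new configuration is contained in an
assembly if the new part of it is. -/
theorem sub_of_moved {C C' : M.Config} (hC' : Legal C') (hα : Legit α)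
    (hs : Sub (rep X C) α) {i : Fin n} {d : Option V} {ch : Option (Fin n × V)}
    (hm : Moved C C' i d ch) (htip : Sound α (site X (.ray i (tip X i (C'.proc i)))))
    (hch : ∀ j v, ch = some (j, v) →
      α (site X (.obj (lastIndex n))) = some ⟨.obj (lastIndex n) j v, false⟩) :
    Sub (rep X C') α := by
  intro p hp
  obtain ⟨P, rfl⟩ := exists_of_rep hp
  rw [rep_site] at hp ⊢
  cases P with
  | row y =>
    have := hs (site X (.row y)) (by rw [rep_site]; simp [cell])
    rw [this, rep_site]
    rfl
  | ray i' m =>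
    by_cases hi : i' = i
    · subst hi
      refine hα.rayCell_eq hX (hC'.proc i') hm.crashed ?_ htip ?_ hp
      · rw [hm.input]
        exact ⟨0, _, _, hs.eq_some ((rep_site C (.ray i' 0)).trans
          (rayCell_of_le (Nat.zero_le _)))⟩
      · intro w hw
        obtain ⟨j, hj⟩ := hC'.answered i' w hw
        rw [hm.chosen] at hj
        exact ⟨j, hα.decided_last (hch j w hj)⟩
    · simp only [cell, hm.others i' hi] at hp ⊢
      have := hs (site X (.ray i' m)) (by rw [rep_site]; exact hp)
      rw [this, rep_site]
      rfl
  | obj m =>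
    obtain ⟨k, hk⟩ := Option.ne_none_iff_exists'.1 hp
    obtain ⟨j, v, h1, h2, rfl⟩ := objCell_eq_some hk
    rw [hk]
    rw [hm.chosen] at h1
    exact hα.obj_prefix (by simp only [lastIndex]; omega) h2 (hch j v h1)

/-! ### Crash-free executions inside a fair assembly sequence -/

/-- The configuration arises from `C` without crashes, and the sequence `a` contains it. -/
structure Follows (C : M.Config) (a : ℕ → (tileSet X M.call).Assembly) (C' : M.Config) : Prop where
  reachable : M.Reachable C'
  crashed : ∀ i, (C'.proc i).crashed = (C.proc i).crashed
  grows : Grows (rep X C) (rep X C')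
  sub : ∃ k, Sub (rep X C') (a k)

variable (hcalls : M.InvokesAtMostOnce) {C : M.Config} (hC : M.Reachable C)
  {a : ℕ → (tileSet X M.call).Assembly} (ha : IsFairSequence Attach (rep X C) a)
include hcalls hC ha

theorem legit_sequence (k : ℕ) : Legit (a k) :=
  legit_of_fair (ha.within (object n X)) (legit_rep hX (hC.legal (NeZero.pos n) hcalls)) k

-- Error-free growth adds no blockages, and those of `rep X C` lie on rays of crashed processes.
omit hX hcalls hC in
theorem not_blocked_sequence {i : Fin n} (hi : (C.proc i).crashed = false) (k m : ℕ) :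
    ¬ Blocked (a k) (site X (.ray i m)) := by
  intro h
  obtain ⟨j, h1, h2⟩ := blocked_rep ((ha.grows k).blocked h)
  cases site_injective X h1
  rw [hi] at h2
  cases h2

/-- It suffices to wait: the live ray grows to the new tip, and a decided object grows to its last
cube. A common later stage contains both and the old representation. -/
theorem Follows.moved {C₁ C₂ : M.Config} (h : Follows C a C₁) {e : Event n}
    (hs : M.Step C₁ e C₂) (he : ¬ e.IsCrash) {i : Fin n} {d : Option V}
    {ch : Option (Fin n × V)} (hm : Moved C₁ C₂ i d ch)
    (hch : ∀ j v, ch = some (j, v) → ∃ k, Decided (a k) j v) : Follows C a C₂ := by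
  have hL := h.reachable.legal (NeZero.pos n) hcalls
  have hL₂ := (h.reachable.step hs).legal (NeZero.pos n) hcalls
  have hcr := step_crashed hs he
  have hw := ha.within (object n X)
  have hleg := legit_rep (X := X) hX (hC.legal (NeZero.pos n) hcalls)
  refine ⟨h.reachable.step hs, fun i => (hcr i).trans (h.crashed i),
    h.grows.trans (grows_rep hX hL hL₂ (hs.le hL) fun i hi => (hcr i).symm.trans hi), ?_⟩
  obtain ⟨k₁, h₁⟩ := h.sub
  have hlive : (C.proc i).crashed = false := by
    rw [← h.crashed i, ← hcr i]
    exact hm.crashed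
  obtain ⟨k₂, h₂⟩ := eventually_ray hw hleg (not_blocked_sequence ha hlive)
    (tip X i (C₂.proc i))
  obtain ⟨k₃, h₃⟩ : ∃ k, ∀ j v, ch = some (j, v) →
      a k (site X (.obj (lastIndex n))) = some ⟨.obj (lastIndex n) j v, false⟩ := by
    cases ch with
    | none => exact ⟨0, fun j v h => by cases h⟩
    | some c =>
      obtain ⟨j, v⟩ := c
      obtain ⟨k, hk⟩ := hch j v rfl
      obtain ⟨k', hk', t, ht⟩ := eventually_obj hw hleg (m := decisionIndex n) (m' := lastIndex n)
        (by simp only [decisionIndex, lastIndex]; omega) ⟨_, hk⟩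
      obtain ⟨j', v', rfl, -⟩ := (legit_sequence hX hcalls hC ha k').obj_eq ht
      have huniq := ((legit_sequence hX hcalls hC ha k').decided_last ht).unique
        (hk.mono (hw.sub hk'))
      refine ⟨k', fun j'' v'' h => ?_⟩
      cases h
      rw [ht, huniq.1, huniq.2]
  refine ⟨max k₁ (max k₂ k₃), sub_of_moved hX hL₂ (legit_sequence hX hcalls hC ha _)
    (h₁.trans (hw.sub (le_max_left _ _))) hm
    ((hw.sub ((le_max_left _ _).trans (le_max_right _ _))).sound h₂) fun j v hjv => ?_⟩
  exact (hw.sub ((le_max_right _ _).trans (le_max_right _ _))).eq_some (h₃ j v hjv)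

/-- Process `i` can move without leaving the sequence `a`. -/
def Enabled (C : M.Config) (a : ℕ → (tileSet X M.call).Assembly) (C₁ : M.Config) (i : Fin n) :
    Prop :=
  ∃ r : Event n × M.Config, M.Step C₁ r.1 r.2 ∧ ¬ r.1.IsCrash ∧ r.1.process = i ∧ Follows C a r.2

theorem enabled_of_not_waiting (hrun : M.RunsForever) {C₁ : M.Config} (h : Follows C a C₁)
    {i : Fin n} (hi : (C.proc i).crashed = false) (hw : ¬ Waiting (C₁.proc i)) :
    Enabled C a C₁ i := by
  obtain ⟨C₂, hs, hm⟩ := exists_step hrun h.reachable ((h.crashed i).trans hi) hw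
  refine ⟨(_, C₂), hs, id, rfl, h.moved hX hcalls hC ha hs id hm fun j v hc => ?_⟩
  obtain ⟨k, hk⟩ := h.sub
  exact ⟨k, decided_of_sub hk hc⟩

/-- The process is answered with the winner of the sequence. If the execution has chosen before, its
choice is contained in the sequence too, so it is the same. -/
theorem enabled_of_waiting {C₁ : M.Config} (h : Follows C a C₁)
    {i : Fin n} (hi : (C.proc i).crashed = false) (hw : Waiting (C₁.proc i)) {j : Fin n} {w : V}
    {k : ℕ} (hk : Decided (a k) j w) (hreq : (C₁.proc j).proposal = some w) :
    Enabled C a C₁ i := by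
  have hc : C₁.obj.chosen = some (j, w) ∨ C₁.obj.chosen = none ∧ C₁.obj.request j = some w := by
    cases hch : C₁.obj.chosen with
    | none =>
      right
      rw [(h.reachable.legal (NeZero.pos n) hcalls).request]
      exact ⟨rfl, hreq⟩
    | some c =>
      left
      obtain ⟨k', hk'⟩ := h.sub
      have hsub := fun {k l} => (ha.within (object n X)).sub (k := k) (l := l)
      obtain ⟨rfl, rfl⟩ := ((decided_of_sub hk' hch).mono (hsub (le_max_left k' k))).unique
        (hk.mono (hsub (le_max_right k' k)))
      rfl
  obtain ⟨C₂, hs, hm⟩ := exists_respond ((h.crashed i).trans hi) hw hc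
  refine ⟨(_, C₂), hs, id, rfl, h.moved hX hcalls hC ha hs id hm fun j' v' h' => ?_⟩
  cases h'
  exact ⟨k, hk⟩

omit hX hcalls hC ha

open Classical in
/-- The round-robin execution that follows the sequence `a`. -/
noncomputable def schedule (C : M.Config) (a : ℕ → (tileSet X M.call).Assembly) : ℕ → M.Config
  | 0 => C
  | t + 1 => if h : Enabled C a (schedule C a t) (Fin.ofNat n t) then h.choose.2
      else schedule C a t

open Classical in
/-- The events of the round-robin execution. -/
noncomputable def scheduled (C : M.Config) (a : ℕ → (tileSet X M.call).Assembly) (t : ℕ) :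
    Option (Event n) :=
  if h : Enabled C a (schedule C a t) (Fin.ofNat n t) then some h.choose.1 else none

theorem schedule_of_enabled {t : ℕ} (h : Enabled C a (schedule C a t) (Fin.ofNat n t)) :
    ∃ e, scheduled C a t = some e ∧ M.Step (schedule C a t) e (schedule C a (t + 1)) ∧
      ¬ e.IsCrash ∧ e.process = Fin.ofNat n t ∧ Follows C a (schedule C a (t + 1)) := by
  have h1 : schedule C a (t + 1) = h.choose.2 := dif_pos h
  rw [h1]
  exact ⟨h.choose.1, dif_pos h, h.choose_spec⟩

theorem schedule_of_not_enabled {t : ℕ} (h : ¬ Enabled C a (schedule C a t) (Fin.ofNat n t)) :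
    scheduled C a t = none ∧ schedule C a (t + 1) = schedule C a t :=
  ⟨dif_neg h, dif_neg h⟩

include hX hcalls hC ha

omit hX hcalls in
theorem follows_schedule (t : ℕ) : Follows C a (schedule C a t) := by
  induction t with
  | zero => exact ⟨hC, fun _ => rfl, Relation.ReflTransGen.refl, 0, by rw [ha.start]; exact Sub.refl _⟩
  | succ t ih =>
    by_cases h : Enabled C a (schedule C a t) (Fin.ofNat n t)
    · obtain ⟨e, -, -, -, -, h⟩ := schedule_of_enabled h
      exact h
    · rw [(schedule_of_not_enabled h).2]
      exact ih

omit hX in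
theorem clock_schedule (i : Fin n) {t t' : ℕ} (h : t ≤ t') :
    ((schedule C a t).proc i).clock ≤ ((schedule C a t').proc i).clock := by
  induction t', h using Nat.le_induction with
  | base => exact le_rfl
  | succ t' _ ih =>
    refine ih.trans ?_
    by_cases h : Enabled C a (schedule C a t') (Fin.ofNat n t')
    · obtain ⟨e, -, h, -⟩ := schedule_of_enabled h
      exact ((h.le ((follows_schedule hC ha t').reachable.legal (NeZero.pos n)
        hcalls)).proc i).clock
    · rw [(schedule_of_not_enabled h).2]

omit hX hcalls hC ha in
theorem exists_turn (i : Fin n) (t : ℕ) : ∃ t' ≥ t, Fin.ofNat n t' = i := by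
  refine ⟨n * t + i.val, ?_, ?_⟩
  · have := Nat.le_mul_of_pos_left t (NeZero.pos n)
    omega
  · ext
    simp [Nat.mod_eq_of_lt i.2]

theorem input_schedule {j : Fin n} {k m : ℕ} {x : V} {c : Fin (X + 4)} {w : Option V}
    (hk : a k (site X (.ray j m)) = some ⟨.ray j x c w, false⟩) (t : ℕ) :
    ((schedule C a t).proc j).input = x := by
  obtain ⟨k', hk'⟩ := (follows_schedule hC ha t).sub
  have h1 := hk'.eq_some ((rep_site _ (.ray j 0)).trans (rayCell_of_le (Nat.zero_le _)))
  have hsub := fun {k l} => (ha.within (object n X)).sub (k := k) (l := l)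
  exact (legit_sequence hX hcalls hC ha _).input_eq ((hsub (le_max_left k' k)).eq_some h1)
    ((hsub (le_max_right k' k)).eq_some hk)

/-- The process that wins in the sequence `a` gets to its call. -/
theorem eventually_proposed (hrun : M.RunsForever) {j : Fin n} {w : V} {k : ℕ}
    (hk : Decided (a k) j w) :
    ∃ t, ∀ t' ≥ t, ((schedule C a t').proc j).proposal = some w := by
  obtain ⟨x, w', hcall, hray⟩ := (legit_sequence hX hcalls hC ha k).proposed hk
  have hx := input_schedule hX hcalls hC ha hray
  have hcj : M.Calls j x := call_ne_none.1 (by simp [hcall])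
  have hlegal := fun t =>
    (follows_schedule hC ha t).reachable.legal (NeZero.pos n) hcalls
  suffices H : ∃ t, M.callTime j x ≤ ((schedule C a t).proc j).clock by
    obtain ⟨t, ht⟩ := H
    refine ⟨t, fun t' ht' => ?_⟩
    rw [(((hlegal t').proc j).proposal_of_le (by rwa [hx t']) ?_).1, hx t', hcall]
    rw [hx t']
    exact ht.trans (clock_schedule hcalls hC ha j ht')
  cases hcr : (C.proc j).crashed with
  | true =>
    -- A crashed winner had called before: its ray is blocked just beyond its tip, yet the sequence
    -- has its cube at `X`, so the tip was at `X` or further.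
    refine ⟨0, ?_⟩
    have hL : LocallyLegal j (C.proc j) := (hlegal 0).proc j
    have hx0 : (C.proc j).input = x := hx 0
    have hsub : Sub (rep X C) (a k) := (ha.grows k).sub
    have htip : X ≤ tip X j (C.proc j) := by
      by_contra hlt
      obtain ⟨w₁, h₁⟩ := (legit_sequence hX hcalls hC ha k).ray_prefix
        (m' := tip X j (C.proc j) + 1) (by omega) hray
      have h₂ := hsub.eq_some ((rep_site C (.ray j (tip X j (C.proc j) + 1))).trans
        (rayCell_blocked.2 ⟨rfl, hcr, rfl⟩))
      rw [h₁] at h₂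
      cases h₂
    change M.callTime j x ≤ (C.proc j).clock
    rw [← hx0] at hcj ⊢
    by_cases hd : (C.proc j).decision = none
    · have := (tip_of_undecided hX hL hcj hd).1
      omega
    · exact (hL.late hd).2.le
  | false =>
    suffices H : ∀ m ≤ M.callTime j x, ∃ t, m ≤ ((schedule C a t).proc j).clock from H _ le_rfl
    intro m
    induction m with
    | zero => exact fun _ => ⟨0, Nat.zero_le _⟩
    | succ m ih =>
      intro hm
      obtain ⟨t, ht⟩ := ih (by omega)
      obtain ⟨t', ht', hturn⟩ := exists_turn j t
      have hmono := clock_schedule hcalls hC ha j ht'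
      by_cases hlt : m + 1 ≤ ((schedule C a t').proc j).clock
      · exact ⟨t', hlt⟩
      · have hnw : ¬ Waiting ((schedule C a t').proc j) := by
          rw [((hlegal t').proc j).waiting_iff, hx t']
          rintro ⟨-, h⟩
          omega
        have hen := enabled_of_not_waiting hX hcalls hC ha hrun
          (follows_schedule hC ha t') hcr hnw
        rw [← hturn] at hen
        obtain ⟨e, -, hs, he, hp, -⟩ := schedule_of_enabled hen
        have := hs.clock_succ he
        rw [hp, hturn] at this
        exact ⟨t' + 1, by omega⟩

/-- A live process that does not wait is always enabled. One that waits at some time has its cube at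
`X` in the sequence, so there the object decides; once the winner has called in the execution as
well, the answer is legal and stays so. Hence each live process is enabled from some time on, and
its turn comes. -/
theorem isFairRun_schedule (hrun : M.RunsForever) :
    M.IsFairRun C (schedule C a) (scheduled C a) where
  start := rfl
  idle t ht := by
    by_cases h : Enabled C a (schedule C a t) (Fin.ofNat n t)
    · obtain ⟨e, h, -⟩ := schedule_of_enabled h
      rw [h] at ht
      cases ht
    · exact (schedule_of_not_enabled h).2
  step t e ht := by
    by_cases h : Enabled C a (schedule C a t) (Fin.ofNat n t)
    · obtain ⟨e', h, hs, he, -⟩ := schedule_of_enabled h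
      rw [h] at ht
      cases ht
      exact ⟨he, hs⟩
    · rw [(schedule_of_not_enabled h).1] at ht
      cases ht
  fair t i hstopped := by
    have hfol := follows_schedule hC ha
    have hi : (C.proc i).crashed = false := by
      by_contra hne
      apply hstopped
      left
      rw [(hfol t).crashed i]
      simpa using hne
    suffices H : ∃ t₁ ≥ t, ∀ t' ≥ t₁, Enabled C a (schedule C a t') i by
      obtain ⟨t₁, ht₁, H⟩ := H
      obtain ⟨t', ht', hturn⟩ := exists_turn i t₁
      have hen := H t' ht'
      rw [← hturn] at hen
      obtain ⟨e, h, -, -, hp, -⟩ := schedule_of_enabled hen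
      exact ⟨t', ht₁.trans ht', e, h, hp.trans hturn⟩
    by_cases hw : ∃ t₀, Waiting ((schedule C a t₀).proc i)
    · obtain ⟨t₀, hw⟩ := hw
      obtain ⟨k₀, hk₀⟩ := (hfol t₀).sub
      have hL := (hfol t₀).reachable.legal (NeZero.pos n) hcalls
      obtain ⟨hc, hclock⟩ := (hL.proc i).waiting_iff.1 hw
      obtain ⟨v, hv⟩ := Option.ne_none_iff_exists'.1 (call_ne_none.2 hc)
      have htip : X ≤ tip X i ((schedule C a t₀).proc i) := by
        by_cases hd : ((schedule C a t₀).proc i).decision = none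
        · have := (tip_of_undecided hX (hL.proc i) hc hd).1
          omega
        · have := (tip_of_decided hX (hL.proc i) hd).2.2
          omega
      have hray := hk₀.eq_some ((rep_site _ (.ray i X)).trans (rayCell_of_le htip))
      obtain ⟨k, -, j, w, hans⟩ := eventually_answer (ha.within (object n X))
        (legit_rep hX (hC.legal (NeZero.pos n) hcalls)) hv hray i
      have hdec := (legit_sequence hX hcalls hC ha k).decided (n_le_answerIndex i) hans
      obtain ⟨t₁, ht₁⟩ := eventually_proposed hX hcalls hC ha hrun hdec
      refine ⟨max t t₁, le_max_left _ _, fun t' ht' => ?_⟩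
      by_cases hw' : Waiting ((schedule C a t').proc i)
      · exact enabled_of_waiting hX hcalls hC ha (hfol t') hi hw' hdec
          (ht₁ t' ((le_max_right _ _).trans ht'))
      · exact enabled_of_not_waiting hX hcalls hC ha hrun (hfol t') hi hw'
    · exact ⟨t, le_rfl, fun t' _ => enabled_of_not_waiting hX hcalls hC ha hrun (hfol t') hi
        fun h => hw ⟨t', h⟩⟩

/-- The execution reaches `𝒞` at a configuration contained in some stage. All blockages of this
stage date from `rep X C`, so the stage can be grown from that representation. -/
theorem must_achieve (hrun : M.RunsForever) {𝒞 : Set M.Config} (h𝒞 : M.MustAchieve C 𝒞) :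
    ∃ k, ∃ C' ∈ 𝒞, M.Reachable C' ∧ Grows (rep X C) (rep X C') ∧ Grows (rep X C') (a k) := by
  obtain ⟨t, ht⟩ := h𝒞 _ _ (isFairRun_schedule hX hcalls hC ha hrun)
  have hfol := follows_schedule hC ha t
  obtain ⟨k, hk⟩ := hfol.sub
  refine ⟨k, _, ht, hfol.reachable, hfol.grows, (legit_sequence hX hcalls hC ha k).grows hk ?_ ?_⟩
  · rw [(legit_rep hX (hfol.reachable.legal (NeZero.pos n) hcalls)).seed]
    simp
  · intro p hp
    obtain ⟨t, ht⟩ := (ha.grows k).blocked hp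
    rw [hfol.grows.sub.eq_some ht]
    simp

end

end ConsensusTiles
end TileConsensus

/-! ### Modularity, simulation and the Consensus Subroutine Problem. -/

namespace TileConsensus

open TileSet TileConsensus.System

namespace ConsensusTiles

section

variable {n : ℕ} {V : Type} {X : ℕ} [NeZero n] [Finite V] [Nonempty V] {M : System.{u} n V}

/-- The simulation. -/
noncomputable def simulation (X : ℕ) (M : System.{u} n V) :
    SimulationData (cubeSystem X M.call) M where
  h := rep X
  part := part X
  object := object n X

omit [NeZero n] in
theorem exists_common_stage {P : Fin n → ℕ → Prop}
    (hmono : ∀ i k l, k ≤ l → P i k → P i l) (h : ∀ i, ∃ k, P i k) : ∃ k, ∀ i, P i k := by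
  choose k hk using h
  exact ⟨Finset.univ.sup k, fun i => hmono i _ _ (Finset.le_sup (Finset.mem_univ i)) (hk i)⟩

theorem legit_of_growsWithin {α : (tileSet X M.call).Assembly}
    (h : GrowsWithin (object n X) (cubeSystem X M.call).seed α) : Legit α :=
  legit_seed.growsWithin h

omit [NeZero n] in
theorem not_blocked_part {a : ℕ → (tileSet X M.call).Assembly} {i : Fin n}
    (h : ∀ k, ∀ p ∈ part X i, ¬ Blocked (a k) p) (k m : ℕ) :
    ¬ Blocked (a k) (site X (.ray i m)) := h k _ ⟨m, rfl⟩

variable (hX : ∀ i x, M.callTime i x ≤ X)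
  (hcalls : M.InvokesAtMostOnce)
include hX hcalls

theorem proc_eq_iff {C C' : M.Config} (hC : M.Reachable C) (hC' : M.Reachable C') (i : Fin n) :
    (∀ p ∈ part X i, rep X C p = rep X C' p) ↔ C.proc i = C'.proc i := by
  have hL := (hC.legal (NeZero.pos n) hcalls).proc i
  have hL' := (hC'.legal (NeZero.pos n) hcalls).proc i
  constructor
  · intro h
    have h1 : ∀ m, rayCell X i (C.proc i) m = rayCell X i (C'.proc i) m := by
      intro m
      have := h _ ⟨m, rfl⟩
      rwa [rep_site, rep_site] at this
    have hle := localLe_of_rayCell hX hL hL' fun m _ => (h1 m).symm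
    have hle' := localLe_of_rayCell hX hL' hL fun m _ => h1 m
    refine (hL.eq_of_le hL' hle (le_antisymm hle'.clock hle.clock) ?_).symm
    by_cases hc : (C.proc i).crashed = true
    · rw [hle.crashed hc]
    · by_cases hc' : (C'.proc i).crashed = true
      · rw [← hle'.crashed hc']
      · rw [Bool.not_eq_true] at hc hc'
        rw [hc, hc']
  · rintro h p ⟨m, rfl⟩
    rw [rep_site, rep_site, cell, cell, h]

theorem isModular : (simulation X M).IsModular where
  object_finite := object_finite
  part_object i := by
    rw [Set.disjoint_left]
    rintro p ⟨m, rfl⟩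
    exact ray_not_mem_object i m
  part_part i j hij := by
    rw [Set.disjoint_left]
    rintro p ⟨m, rfl⟩ ⟨m', h⟩
    cases site_injective X h
    exact hij rfl
  support α hα p hp := by
    have hL := legit_of_growsWithin hα
    obtain ⟨⟨t, b⟩, ht⟩ := Option.ne_none_iff_exists'.1 hp
    cases b with
    | true =>
      obtain ⟨i, m, h⟩ := hL.blocked p ⟨t, ht⟩
      exact Or.inr ⟨i, m, h⟩
    | false =>
      obtain ⟨P, h, -⟩ := hL.typed p t ht
      cases P with
      | row y => exact Or.inl (Or.inl ⟨y, h⟩)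
      | ray i m => exact Or.inr ⟨i, m, h⟩
      | obj m => exact Or.inl (Or.inr ⟨m, h⟩)
  state _ _ hC hC' i := proc_eq_iff hX hcalls hC hC' i

-- The inputs are read off the rays. Head starts end at `X` at the latest, so a stage with the whole
-- row and all rays up to `X` contains the initial representation for these inputs.
omit hcalls in
theorem initial_must {a : ℕ → (tileSet X M.call).Assembly}
    (ha : IsFairSequence Attach (cubeSystem X M.call).seed a) :
    ∃ k x, Grows (rep X (M.initial x)) (a k) := by
  have hw := ha.within (object n X)
  have hbl : ∀ k p, ¬ Blocked (a k) p := fun k p h =>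
    (cubeSystem X M.call).seed_correct p ((ha.grows k).blocked h)
  obtain ⟨k₁, h₁⟩ := exists_common_stage
    (P := fun i k => a k (site X (.row i)) = some ⟨.row i, false⟩)
    (fun i k l hkl h => (hw.sub hkl).eq_some h) fun i => eventually_row hw legit_seed i
  obtain ⟨k₂, h₂⟩ := exists_common_stage (P := fun i k => Sound (a k) (site X (.ray i X)))
    (fun i k l hkl h => (hw.sub hkl).sound h)
    fun i => eventually_ray hw legit_seed (fun k m => hbl k _) X
  have hleg := legit_of_fair hw legit_seed (max k₁ k₂)
  have hray : ∀ i, ∃ x w, a (max k₁ k₂) (site X (.ray i X)) =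
      some ⟨.ray i x (cap X) w, false⟩ := by
    intro i
    obtain ⟨t, ht⟩ := (hw.sub (le_max_right k₁ k₂)).sound (h₂ i)
    obtain ⟨x, w, rfl⟩ := hleg.ray_eq ht
    exact ⟨x, w, ht⟩
  choose x w hxw using hray
  have hL : Legal (M.initial x) := legal_initial (NeZero.pos n) x
  refine ⟨max k₁ k₂, x, hleg.grows ?_ (by rw [(legit_rep hX hL).seed]; simp)
    fun p hp => (hbl _ _ hp).elim⟩
  intro p hp
  obtain ⟨P, rfl⟩ := exists_of_rep hp
  rw [rep_site] at hp ⊢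
  cases P with
  | row y => exact (hw.sub (le_max_left k₁ k₂)).eq_some (h₁ y)
  | ray i m =>
    have htip : tip X i ((M.initial x).proc i) ≤ X := by
      by_cases hc : M.Calls i (x i)
      · exact (tip_of_undecided hX (hL.proc i) hc rfl).2
      · rw [(tip_of_not_calls (X := X) (hL.proc i) hc).2]
        exact Nat.zero_le _
    refine hleg.rayCell_eq hX (hL.proc i) rfl ⟨_, _, _, hxw i⟩ ?_ (fun w hw => by cases hw) hp
    obtain ⟨w', h'⟩ := hleg.ray_prefix htip (hxw i)
    exact ⟨_, h'⟩
  | obj m =>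
    obtain ⟨c, hc⟩ := Option.ne_none_iff_exists'.1 hp
    obtain ⟨j, v, h, -⟩ := objCell_eq_some hc
    cases h

theorem growsWithin_of_step {C C' : M.Config} {e : Event n} (hC : M.Reachable C)
    (hs : M.Step C e C') : GrowsWithin (object n X) (rep X C) (rep X C') ∧
      (¬ e.IsCrash → Grows (rep X C) (rep X C')) := by
  have hL := hC.legal (NeZero.pos n) hcalls
  have hL' := (hC.step hs).legal (NeZero.pos n) hcalls
  have hgrow : ¬ e.IsCrash → Grows (rep X C) (rep X C') := fun he =>
    grows_rep hX hL hL' (hs.le hL) fun i hi => (step_crashed hs he i).symm.trans hi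
  refine ⟨?_, hgrow⟩
  cases e with
  | step i => exact (hgrow id).within _
  | respond i => exact (hgrow id).within _
  | crash i => exact Relation.ReflTransGen.single (Or.inr (block_rep hX hL hs))

theorem growsWithin_rep {C : M.Config} (hC : M.Reachable C) :
    GrowsWithin (object n X) (cubeSystem X M.call).seed (rep X C) := by
  obtain ⟨x, hx⟩ := hC
  induction hx with
  | refl => exact (grows_rep_initial hX x).within _
  | tail h₁ h₂ ih =>
    obtain ⟨e, he⟩ := h₂
    exact ih.trans (growsWithin_of_step hX hcalls ⟨x, h₁⟩ he).1

omit hX hcalls in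
theorem blocked_crash {C C' : M.Config} {i : Fin n}
    (hs : M.Step C (.crash i) C') :
    ∃ p ∈ part X i, ¬ Blocked (rep X C) p ∧
      {q | Blocked (rep X C') q} = insert p {q | Blocked (rep X C) q} := by
  obtain ⟨hlive, hrep⟩ := rep_crash hs
  refine ⟨_, ⟨tip X i (C.proc i) + 1, rfl⟩, ?_, ?_⟩
  · intro h
    obtain ⟨j, h1, h2⟩ := blocked_rep h
    cases site_injective X h1
    rw [hlive] at h2
    cases h2
  · ext q
    rw [Set.mem_insert_iff, Set.mem_ofPred_eq, Set.mem_ofPred_eq, hrep]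
    by_cases hq : q = site X (.ray i (tip X i (C.proc i) + 1))
    · subst hq
      simp [Blocked]
    · simp [Blocked, hq]

theorem simulates (hrun : M.RunsForever) : (simulation X M).Simulates where
  initial x := grows_rep_initial hX x
  initial_must a ha := initial_must hX ha
  injective C hC C' hC' h := by
    have hL := hC.legal (NeZero.pos n) hcalls
    have hL' := hC'.legal (NeZero.pos n) hcalls
    have h' : rep X C = rep X C' := h
    have hle : ConfigLe C C' := configLe_of_sub hX hL hL' (h' ▸ Sub.refl _)
    have hle' : ConfigLe C' C := configLe_of_sub hX hL' hL (h' ▸ Sub.refl _)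
    refine hL.eq_of_proc hL' (funext fun i => ?_) ?_
    · exact (proc_eq_iff hX hcalls hC hC' i).1 fun p _ => congrFun h' p
    · exact Option.ext fun c => ⟨hle.chosen c, hle'.chosen c⟩
  stable C hC := (cubeSystem X M.call).seed_stable.growsWithin (growsWithin_rep hX hcalls hC)
  step C e C' hC hs := (growsWithin_of_step hX hcalls hC hs).1
  step_correct C e C' hC hs := (growsWithin_of_step hX hcalls hC hs).2
  only C C' hC hC' h hg := h (leads_of_le (NeZero.pos n) hcalls hrun hC' hC
    (configLe_of_sub hX (hC.legal (NeZero.pos n) hcalls) (hC'.legal (NeZero.pos n) hcalls) hg.sub))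
  must C 𝒞 hC h𝒞 a ha := must_achieve hX hcalls hC ha hrun h𝒞
  crash _ _ _ _ hs := blocked_crash hs
  halted C hC hstopped := by
    -- At most `n - 1` processes crash and none halts, so they cannot all have stopped.
    exfalso
    have hL := hC.legal (NeZero.pos n) hcalls
    have hall : ∀ i, (C.proc i).crashed = true := by
      intro i
      rcases hstopped i with h | ⟨s, hs, hact⟩
      · exact h
      · exact (hrun C hC i s hs hact).elim
    have := hL.crashes
    simp [hall] at this

omit hX in
theorem rayCell_of_shows {α : (tileSet X M.call).Assembly} {i : Fin n}
    {q : LocalState (M i).State V} (h : (simulation X M).Shows α i q) :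
    LocallyLegal i q ∧ ∀ m, rayCell X i q m ≠ none →
      α (site X (.ray i m)) = rayCell X i q m := by
  obtain ⟨C, hC, rfl, h⟩ := h
  refine ⟨(hC.legal (NeZero.pos n) hcalls).proc i, fun m hm => ?_⟩
  have h1 : rep X C (site X (.ray i m)) = rayCell X i (C.proc i) m := rep_site C _
  rw [← h1]
  exact h _ ⟨m, rfl⟩ (by simpa only [simulation, h1] using hm)

/-- `Shows` looks at the part of process `i` only, so any reachable configuration with the right
state of `i` is a witness, whatever the other processes do in it. -/
theorem shows_of_sound {α : (tileSet X M.call).Assembly} (hα : Legit α) {C : M.Config}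
    (hC : M.Reachable C) {i : Fin n} (hlive : (C.proc i).crashed = false)
    (hin : ∃ m k w, α (site X (.ray i m)) = some ⟨.ray i (C.proc i).input k w, false⟩)
    (htip : Sound α (site X (.ray i (tip X i (C.proc i)))))
    (hd : ∀ w, (C.proc i).decision = some w → ∃ j, Decided α j w) :
    (simulation X M).Shows α i (C.proc i) := by
  refine ⟨C, hC, rfl, ?_⟩
  rintro p ⟨m, rfl⟩ hm
  have h1 : rep X C (site X (.ray i m)) = rayCell X i (C.proc i) m := rep_site C _
  simp only [simulation, h1] at hm ⊢
  exact hα.rayCell_eq hX ((hC.legal (NeZero.pos n) hcalls).proc i) hlive hin htip hd hm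

theorem decided_of_shows {α : (tileSet X M.call).Assembly} (hα : Legit α) {i : Fin n}
    {q : LocalState (M i).State V} {w : V} (h : (simulation X M).Shows α i q)
    (hw : q.decision = some w) : ∃ j, Decided α j w := by
  obtain ⟨hL, hray⟩ := rayCell_of_shows hcalls h
  obtain ⟨hc, -, htip⟩ := tip_of_decided hX hL (by simp [hw])
  have h1 := hray (X + 2) (by rw [rayCell_of_le htip]; simp)
  rw [rayCell_of_le htip, if_pos le_rfl, hw] at h1
  obtain ⟨j, v, h2, h3⟩ := hα.answer le_rfl (call_ne_none.2 hc) h1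
  cases h2
  exact ⟨j, h3⟩

/-- The ray grows without bound; what remains is a legal execution with its input and answer. The
answer is the call of a winner on an input that the assembly shows, which is what `exists_answered`
asks for. -/
theorem shows_late (hrun : M.RunsForever) {a : ℕ → (tileSet X M.call).Assembly}
    (ha : IsFairSequence (Move (object n X)) (cubeSystem X M.call).seed a) {i : Fin n}
    (hbl : ∀ k, ∀ p ∈ part X i, ¬ Blocked (a k) p) (m : ℕ) :
    ∃ k q, (simulation X M).Shows (a k) i q ∧ m ≤ q.clock := by
  obtain ⟨k, t, ht⟩ := eventually_ray ha legit_seed (not_blocked_part hbl) (X + m + 2)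
  have hleg := legit_of_fair ha legit_seed k
  obtain ⟨x, w, rfl⟩ := hleg.ray_eq ht
  by_cases hc : M.Calls i x
  · obtain ⟨j, v, rfl, hdec⟩ := hleg.answer (by omega) (call_ne_none.2 hc) ht
    obtain ⟨y, w', hj, hray⟩ := hleg.proposed hdec
    -- The clock `callTime + m + 1` of an answered process puts its tip at `X + m + 2`, the cube
    -- found above.
    obtain ⟨C, hC, hin, hclock, hlive, hd⟩ := exists_answered (NeZero.pos n) hcalls hrun hc hj
      (fun hij => by subst hij; exact hleg.input_eq ht hray)
      (m := M.callTime i x + m + 1) (by omega)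
    refine ⟨k, _, shows_of_sound hX hcalls hleg hC hlive (by rw [hin]; exact ⟨_, _, _, ht⟩) ?_ ?_,
      by omega⟩
    · have h1 := (tip_of_decided hX ((hC.legal (NeZero.pos n) hcalls).proc i) (by simp [hd])).2.1
      rw [hin, hclock] at h1
      have h2 : tip X i (C.proc i) = X + m + 2 := by omega
      rw [h2]
      exact ⟨_, ht⟩
    · intro w' hw'
      rw [hd] at hw'
      cases hw'
      exact ⟨j, hdec⟩
  · obtain ⟨C, hC, hin, hclock, hlive, hd⟩ := exists_unanswered (NeZero.pos n) hcalls hrun i x m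
      fun h => (hc h).elim
    refine ⟨k, _, shows_of_sound hX hcalls hleg hC hlive (by rw [hin]; exact ⟨_, _, _, ht⟩) ?_ ?_,
      by omega⟩
    · rw [(tip_of_not_calls (X := X) ((hC.legal (NeZero.pos n) hcalls).proc i) (by rwa [hin])).2, hclock]
      obtain ⟨w', h'⟩ := hleg.ray_prefix (m' := m) (by omega) ht
      exact ⟨_, h'⟩
    · intro w' hw'
      rw [hd] at hw'
      cases hw'

theorem solvesConsensusSubroutine (hrun : M.RunsForever) :
    (simulation X M).SolvesConsensusSubroutine where
  agreement α hα i j q q' w w' h h' hw hw' := by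
    have hleg := legit_of_growsWithin hα
    obtain ⟨_, h1⟩ := decided_of_shows hX hcalls hleg h hw
    obtain ⟨_, h2⟩ := decided_of_shows hX hcalls hleg h' hw'
    exact (h1.unique h2).2
  validity α hα i q w h hw := by
    have hleg := legit_of_growsWithin hα
    obtain ⟨j, h1⟩ := decided_of_shows hX hcalls hleg h hw
    obtain ⟨x, w', hj, hray⟩ := hleg.proposed h1
    have hc : M.Calls j x := call_ne_none.1 (by simp [hj])
    -- The winner's ray is known up to `X`, and this is its tip at the moment of its call.
    obtain ⟨C, hC, hin, hclock, hlive, hd⟩ := exists_unanswered (NeZero.pos n) hcalls hrun j x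
      (M.callTime j x) fun _ => le_rfl
    have hL := (hC.legal (NeZero.pos n) hcalls).proc j
    refine ⟨j, _, shows_of_sound hX hcalls hleg hC hlive (by rw [hin]; exact ⟨_, _, _, hray⟩)
      ?_ ?_, ?_⟩
    · have h2 := (tip_of_undecided hX hL (by rwa [hin]) hd).1
      rw [hin, hclock] at h2
      have h3 : tip X j (C.proc j) = X := by omega
      rw [h3]
      exact ⟨_, hray⟩
    · intro w' hw'
      rw [hd] at hw'
      cases hw'
    · rw [(hL.proposal_of_le (by rwa [hin]) (by rw [hin, hclock])).1, hin, hj]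
  termination a ha i hbl k q h hq := by
    obtain ⟨hL, hray⟩ := rayCell_of_shows hcalls h
    have hc : M.Calls i q.input := by
      by_contra hc
      exact hq (hL.proposal_of_not fun h => hc h.1)
    -- Beyond `callTime` a caller is decided, and both states have the input of the same ray.
    obtain ⟨k', q', h', hclock⟩ := shows_late hX hcalls hrun ha hbl (M.callTime i q.input + 1)
    obtain ⟨hL', hray'⟩ := rayCell_of_shows hcalls h'
    have hcell : ∀ {r : LocalState (M i).State V}, rayCell X i r 0 = some
        ⟨.ray i r.input (cap 0) (if X + 2 ≤ 0 then r.decision else none), false⟩ :=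
      rayCell_of_le (Nat.zero_le _)
    have h1 := (ha.sub (le_max_left k k')).eq_some ((hray 0 (by rw [hcell]; simp)).trans hcell)
    have h2 := (ha.sub (le_max_right k k')).eq_some ((hray' 0 (by rw [hcell]; simp)).trans hcell)
    have hin : q.input = q'.input := (legit_of_fair ha legit_seed _).input_eq h1 h2
    rw [hin] at hc hclock
    exact ⟨k', q', h', hL'.decision_of_lt hc hclock⟩
  unobstructed a ha i hbl m := shows_late hX hcalls hrun ha hbl m

end

end ConsensusTiles
end TileConsensus

theorem theorem5 (n : ℕ) (hn : 3 ≤ n) (V : Type) [Finite V] [Nonempty V]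
    (M : TileConsensus.System.{u} n V) (hcalls : M.InvokesAtMostOnce) (hrun : M.RunsForever) :
    ∃ T : TileConsensus.CubeSystem, T.SimulatesConsensusSubroutine M := by
  have : NeZero n := ⟨by omega⟩
  -- Finitely many processes and inputs have a common bound on their call times; for one that never
  -- calls, `callTime` is the infimum of the empty set, 0.
  obtain ⟨X, hX⟩ := (Set.finite_range fun p : Fin n × V => M.callTime p.1 p.2).bddAbove
  have hX' : ∀ i x, M.callTime i x ≤ X := fun i x => hX ⟨(i, x), rfl⟩
  exact ⟨TileConsensus.ConsensusTiles.cubeSystem X M.call,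
    TileConsensus.ConsensusTiles.simulation X M,
    TileConsensus.ConsensusTiles.isModular hX' hcalls,
    TileConsensus.ConsensusTiles.simulates hX' hcalls hrun,
    TileConsensus.ConsensusTiles.solvesConsensusSubroutine hX' hcalls hrun⟩
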